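/- **The calculus.** Fix an infinite set of variables. Expressions, values, answers, evaluation contexts and dependencies are given by \[ \begin{array}{lcl} M,N &::=& x \mid \lambda x.M \mid M\,N \mid \mathsf{let\ rec}\ D\ \mathsf{in}\ M \mid \bullet\\ D &::=& \epsilon \mid D,\ x\ \mathsf{be}\ M\\ V &::=& \lambda x.M \mid \bullet \qquad A \;::=\; V \mid \mathsf{let\ rec}\ D\ \mathsf{in}\ A\\ E &::=& [\,] \mid E\,M \mid \mathsf{let\ rec}\ D\ \mathsf{in}\ E \mid \mathsf{let\ rec}\ x\ \mathsf{be}\ E, D\ \mathsf{in}\ E'[x] \mid \mathsf{let\ rec}\ x'\ \mathsf{be}\ E, D[x,x'], D\ \mathsf{in}\ E'[x]\\ D[x,x'] &::=& x\ \mathsf{be}\ E[x'] \mid D[x,x''],\ x''\ \mathsf{be}\ E[x'] \end{array} \] The variables defined by one $D$ are pairwise distinct and their order is irrelevant; $\mathsf{let\ rec}\ D\ \mathsf{in}\ M$ binds them in $M$ and in all right-hand sides of $D$. A *program* is a closed expression. Expressions $M,N$ are $\alpha$-equivalent, $M\equiv_\alpha N$, if they agree up to the names of bound variables and the order of definitions.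 **Reduction semantics.** The rules are, with $D[x,P]$ denoting $D[x,x']$ with its last $x'$ replaced by $P$, \[ \begin{array}{rl} \beta_{need}: & (\lambda x.M)\,N \mapsto \mathsf{let\ rec}\ x\ \mathsf{be}\ N\ \mathsf{in}\ M\\ lift: & (\mathsf{let\ rec}\ D\ \mathsf{in}\ A)\,N \mapsto \mathsf{let\ rec}\ D\ \mathsf{in}\ A\,N\\ deref: & \mathsf{let\ rec}\ x\ \mathsf{be}\ V, D\ \mathsf{in}\ E[x] \mapsto \mathsf{let\ rec}\ x\ \mathsf{be}\ V, D\ \mathsf{in}\ E[V]\\ deref_{env}: & \mathsf{let\ rec}\ D[x,x'], x'\ \mathsf{be}\ V, D\ \mathsf{in}\ E[x] \mapsto \mathsf{let\ rec}\ D[x,V], x'\ \mathsf{be}\ V, D\ \mathsf{in}\ E[x]\\ assoc: & \mathsf{let\ rec}\ x\ \mathsf{be}\ (\mathsf{let\ rec}\ D\ \mathsf{in}\ A), D'\ \mathsf{in}\ E[x] \mapsto \mathsf{let\ rec}\ D, x\ \mathsf{be}\ A, D'\ \mathsf{in}\ E[x]\\ assoc_{env}: & \mathsf{let\ rec}\ x'\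 \mathsf{be}\ (\mathsf{let\ rec}\ D\ \mathsf{in}\ A), D[x,x'], D'\ \mathsf{in}\ E[x] \mapsto \mathsf{let\ rec}\ D, x'\ \mathsf{be}\ A, D[x,x'], D'\ \mathsf{in}\ E[x]\\ error: & \mathsf{let\ rec}\ D[x,x], D\ \mathsf{in}\ E[x] \mapsto \mathsf{let\ rec}\ D[x,\bullet], D\ \mathsf{in}\ E[x]\\ error_{env}: & \mathsf{let\ rec}\ D[x',x'], D'[x,x'], D\ \mathsf{in}\ E[x] \mapsto \mathsf{let\ rec}\ D[x',\bullet], D'[x,x'], D\ \mathsf{in}\ E[x]\\ error_\beta: & \bullet\,M \mapsto \bullet \end{array} \] Reduction is defined on $\alpha$-equivalence classes: $M\to N$ if the class of $M$ has a representative $E[R]$ in which all binding occurrences have pairwise distinct names (distinct also from the free variables), $R\mapsto R'$, and $N\equiv_\alpha E[R']$. The relation $\twoheadrightarrow$ is the reflexive and transitive closure of $\to$. **Natural semantics.** Heaps $\Psi,\Phi$ are finite maps from variables to expressions. On raw expressions (no implicit renaming), the judgment $\Psi\vdash M\Downarrow\Phi:V$ is inductively defined by: (Value) $\Psi\vdash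 V\Downarrow\Psi:V$; (Application) if $\Psi\vdash M_1\Downarrow\Phi:\lambda x.N$ and $\Phi[x'\mapsto M_2]\vdash N[x'/x]\Downarrow\Psi':V$ with $x'$ fresh, then $\Psi\vdash M_1M_2\Downarrow\Psi':V$; (Variable) if $x\in\mathrm{dom}\,\Psi$ and $\Psi[x\mapsto\bullet]\vdash\Psi(x)\Downarrow\Phi:V$, then $\Psi\vdash x\Downarrow\Phi[x\mapsto V]:V$; (Letrec) if $\Psi[x_i'\mapsto M_i']_{i\le n}\vdash N'\Downarrow\Phi:V$ with $x_1',\dots,x_n'$ fresh and pairwise distinct, then $\Psi\vdash\mathsf{let\ rec}\ x_1\ \mathsf{be}\ M_1,\dots,x_n\ \mathsf{be}\ M_n\ \mathsf{in}\ N\Downarrow\Phi:V$, where $M_i',N'$ arise from $M_i,N$ by substituting the $x_j'$ for the $x_j$; ($\mathrm{Error}_\beta$) if $\Psi\vdash M_1\Downarrow\Phi:\bullet$, then $\Psi\vdash M_1M_2\Downarrow\Phi:\bullet$. Fresh variables occur, free or bound, neither in the heap ($\Phi$ in Application, $\Psi$ in Letrec; domain and stored expressions) nor in the expressions at hand ($M_2$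 and $\lambda x.N$ in Application, the whole $\mathsf{let\ rec}$ expression in Letrec). We write $\vdash M\Downarrow\Psi:V$ when the initial heap is empty. For a sequence $\Theta=(\mathsf{let\ rec}\ D_1\ \mathsf{in}\ [\,]),\dots,(\mathsf{let\ rec}\ D_k\ \mathsf{in}\ [\,])$, $k\ge 0$, let $\Theta[M]=\mathsf{let\ rec}\ D_1\ \mathsf{in}\ \cdots\ \mathsf{let\ rec}\ D_k\ \mathsf{in}\ M$. When the variables defined in $D_1,\dots,D_k$ are pairwise distinct, $\lfloor\Theta\rfloor$ is the heap that consists of exactly the definitions in $D_1,\dots,D_k$. **Theorem.** For every program $M$: 1. if $M\twoheadrightarrow A$ for an answer $A$, then there are $\Theta$ and a value $V$ such that $\Theta[V]\equiv_\alpha A$ and $\vdash M\Downarrow\lfloor\Theta\rfloor:V$; 2. if $\vdash M\Downarrow\Psi:V$, then there is $\Theta$ with $\lfloor\Theta\rfloor=\Psi$ and $M\twoheadrightarrow\Theta[V]$. -/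

import Mathlib

namespace Letrec

universe u

/-- Raw (named) expressions `M, N ::= x | λx.M | M N | let rec D in M | •`, where a sequence of
definitions `D = x₁ be M₁, …, xₙ be Mₙ` is a list of pairs. -/
inductive Tm (Var : Type u) : Type u
  | var (x : Var) : Tm Var
  | lam (x : Var) (M : Tm Var) : Tm Var
  | app (M N : Tm Var) : Tm Var
  | letrec (D : List (Var × Tm Var)) (M : Tm Var) : Tm Var
  | bh : Tm Var

/-- Sequences of definitions `D`. -/
abbrev Defs (Var : Type u) : Type u := List (Var × Tm Var)

/-- The variables `x₁, …, xₙ` defined by `D`. -/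
def names {Var : Type u} (D : Defs Var) : List Var := D.map Prod.fst

section Basic

variable {Var : Type u} [DecidableEq Var]

mutual
/-- Free variables. -/
def Tm.fv : Tm Var → Finset Var
  | .var x => {x}
  | .lam x M => M.fv.erase x
  | .app M N => M.fv ∪ N.fv
  | .letrec D M => (fvDefs D ∪ M.fv) \ (names D).toFinset
  | .bh => ∅
/-- Union of the free variables of the right-hand sides of a sequence of definitions. -/
def fvDefs : List (Var × Tm Var) → Finset Var
  | [] => ∅
  | (_, M) :: D => M.fv ∪ fvDefs D
end

mutual
/-- All variables that occur in an expression, free, bound or at a binder. -/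
def Tm.occ : Tm Var → Finset Var
  | .var x => {x}
  | .lam x M => insert x M.occ
  | .app M N => M.occ ∪ N.occ
  | .letrec D M => occDefs D ∪ M.occ
  | .bh => ∅
/-- All variables that occur in a sequence of definitions. -/
def occDefs : List (Var × Tm Var) → Finset Var
  | [] => ∅
  | (x, M) :: D => insert x (M.occ ∪ occDefs D)
end

mutual
/-- The list, with multiplicity, of all binding occurrences in an expression. -/
def Tm.binders : Tm Var → List Var
  | .var _ => []
  | .lam x M => x :: M.binders
  | .app M N => M.binders ++ N.binders
  | .letrec D M => bindersDefs D ++ M.binders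
  | .bh => []
/-- The list of all binding occurrences in a sequence of definitions. -/
def bindersDefs : List (Var × Tm Var) → List Var
  | [] => []
  | (x, M) :: D => x :: (M.binders ++ bindersDefs D)
end

mutual
/-- Simultaneous replacement of the *free* occurrences of every variable `x` by `f x`. Bound
variables are not renamed; it is only ever used with new names, which cannot be captured. -/
def Tm.rename (f : Var → Var) : Tm Var → Tm Var
  | .var x => .var (f x)
  | .lam x M => .lam x (M.rename (Function.update f x x))
  | .app M N => .app (M.rename f) (N.rename f)
  | .letrec D M =>
      .letrec (renameDefs (fun y => if y ∈ names D then y else f y) D)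
        (M.rename (fun y => if y ∈ names D then y else f y))
  | .bh => .bh
/-- `rename` in the right-hand sides of a sequence of definitions. -/
def renameDefs (f : Var → Var) : List (Var × Tm Var) → List (Var × Tm Var)
  | [] => []
  | (x, M) :: D => (x, M.rename f) :: renameDefs f D
end

/-- `M[x'/x]`. -/
def Tm.subst (M : Tm Var) (x' x : Var) : Tm Var := M.rename (Function.update id x x')

/-- The definitions `f x₁ be f M₁, …, f xₙ be f Mₙ`: both the defined variables and the free
occurrences in the right-hand sides are renamed. -/
def renameAll (f : Var → Var) (D : Defs Var) : Defs Var :=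
  D.map fun b => (f b.1, b.2.rename f)

/-- `f` replaces the variables in `xs` by pairwise distinct new variables outside `S`, and leaves
all other variables alone. -/
def Freshening (xs : List Var) (S : Set Var) (f : Var → Var) : Prop :=
  (∀ x ∈ xs, ∀ y ∈ xs, f x = f y → x = y) ∧ (∀ x ∈ xs, f x ∉ S) ∧ ∀ x ∉ xs, f x = x

/-- Each `let rec` in the expression defines pairwise distinct variables. -/
inductive Tm.WF : Tm Var → Prop
  | var (x : Var) : WF (.var x)
  | lam {x : Var} {M : Tm Var} : WF M → WF (.lam x M)
  | app {M N : Tm Var} : WF M → WF N → WF (.app M N)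
  | letrec {D : Defs Var} {M : Tm Var} :
      (names D).Nodup → (∀ b ∈ D, WF b.2) → WF M → WF (.letrec D M)
  | bh : WF .bh

/-- A program is a closed expression. -/
def IsProgram (M : Tm Var) : Prop := M.WF ∧ M.fv = ∅

/-- Values `V ::= λx.M | •`. -/
inductive IsValue : Tm Var → Prop
  | lam (x : Var) (M : Tm Var) : IsValue (.lam x M)
  | bh : IsValue .bh

/-- Answers `A ::= V | let rec D in A`. -/
inductive IsAnswer : Tm Var → Prop
  | value {V : Tm Var} : IsValue V → IsAnswer V
  | letrec (D : Defs Var) {A : Tm Var} : IsAnswer A → IsAnswer (.letrec D A)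

/-- `α`-equivalence: the least congruence that contains the renaming of bound variables to new
names. Since the definitions of a `let rec` are unordered, it also permits their permutation. -/
inductive Alpha : Tm Var → Tm Var → Prop
  | refl (M : Tm Var) : Alpha M M
  | symm {M N : Tm Var} : Alpha M N → Alpha N M
  | trans {M N P : Tm Var} : Alpha M N → Alpha N P → Alpha M P
  | lam {M M' : Tm Var} (x : Var) : Alpha M M' → Alpha (.lam x M) (.lam x M')
  | app {M M' N N' : Tm Var} : Alpha M M' → Alpha N N' → Alpha (.app M N) (.app M' N')
  | letrec_body {M M' : Tm Var} (D : Defs Var) : Alpha M M' → Alpha (.letrec D M) (.letrec D M')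
  | letrec_def {N N' : Tm Var} (x : Var) (D : Defs Var) (M : Tm Var) :
      Alpha N N' → Alpha (.letrec ((x, N) :: D) M) (.letrec ((x, N') :: D) M)
  | letrec_perm {D D' : Defs Var} (M : Tm Var) :
      D.Perm D' → Alpha (.letrec D M) (.letrec D' M)
  | lam_rename {x x' : Var} {M : Tm Var} :
      x' ∉ (Tm.lam x M).occ → Alpha (.lam x M) (.lam x' (M.subst x' x))
  | letrec_rename {D : Defs Var} {M : Tm Var} {f : Var → Var} :
      Freshening (names D) (Tm.letrec D M).occ f →
        Alpha (.letrec D M) (.letrec (renameAll f D) (M.rename f))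

/-- `α`-equivalence as a setoid. -/
def alphaSetoid (Var : Type u) [DecidableEq Var] : Setoid (Tm Var) :=
  ⟨Alpha, Alpha.refl, Alpha.symm, Alpha.trans⟩

/-- `α`-equivalence classes of expressions. -/
abbrev Cls (Var : Type u) [DecidableEq Var] : Type u := Quotient (alphaSetoid Var)

/-- The class of an expression. -/
def Tm.cls (M : Tm Var) : Cls Var := Quotient.mk (alphaSetoid Var) M

/-- Canonical representatives: all binding occurrences use pairwise distinct names (which are also
distinct from the free variables, if there are any). -/
def Tm.Canonical (M : Tm Var) : Prop := M.binders.Nodup ∧ ∀ x ∈ M.binders, x ∉ M.fv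

end Basic

section Reduction

variable {Var : Type u}

mutual
/-- Evaluation contexts
`E ::= [] | E M | let rec D in E | let rec x be E, D in E'[x]`
`    | let rec x' be E, D[x,x'], D in E'[x]`. -/
inductive Ctx (Var : Type u) : Type u
  | hole : Ctx Var
  | app (E : Ctx Var) (M : Tm Var) : Ctx Var
  | letBody (D : List (Var × Tm Var)) (E : Ctx Var) : Ctx Var
  | letDef (x : Var) (E : Ctx Var) (D : List (Var × Tm Var)) (E' : Ctx Var) : Ctx Var
  | letDep (x' : Var) (E : Ctx Var) (Δ : Deps Var) (D : List (Var × Tm Var)) (E' : Ctx Var) :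
      Ctx Var
/-- Dependencies `D[x,x'] ::= x be E[x'] | D[x,x''], x'' be E[x']`, with the final `x'` left
open. -/
inductive Deps (Var : Type u) : Type u
  | single (x : Var) (E : Ctx Var) : Deps Var
  | snoc (Δ : Deps Var) (x'' : Var) (E : Ctx Var) : Deps Var
end

/-- The first variable `x` of a dependency `D[x,x']`. -/
def Deps.start : Deps Var → Var
  | .single x _ => x
  | .snoc Δ _ _ => Δ.start

mutual
/-- `E[M]`. Filling is textual. -/
def Ctx.fill : Ctx Var → Tm Var → Tm Var
  | .hole, M => M
  | .app E N, M => .app (E.fill M) N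
  | .letBody D E, M => .letrec D (E.fill M)
  | .letDef x E D E', M => .letrec ((x, E.fill M) :: D) (E'.fill (.var x))
  | .letDep x' E Δ D E', M =>
      .letrec ((x', E.fill M) :: (Δ.fill (.var x') ++ D)) (E'.fill (.var Δ.start))
/-- `D[x,M]`: the definitions of a dependency, with `M` at its open end. -/
def Deps.fill : Deps Var → Tm Var → List (Var × Tm Var)
  | .single x E, M => [(x, E.fill M)]
  | .snoc Δ x'' E, M => Δ.fill (.var x'') ++ [(x'', E.fill M)]
end

/-- The reduction rules. -/
inductive Redex : Tm Var → Tm Var → Prop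
  | beta_need (x : Var) (M N : Tm Var) :
      Redex (.app (.lam x M) N) (.letrec [(x, N)] M)
  | lift (D : Defs Var) (A N : Tm Var) : IsAnswer A →
      Redex (.app (.letrec D A) N) (.letrec D (.app A N))
  | deref (x : Var) (V : Tm Var) (D : Defs Var) (E : Ctx Var) : IsValue V →
      Redex (.letrec ((x, V) :: D) (E.fill (.var x))) (.letrec ((x, V) :: D) (E.fill V))
  | deref_env (Δ : Deps Var) (x' : Var) (V : Tm Var) (D : Defs Var) (E : Ctx Var) : IsValue V →
      Redex (.letrec (Δ.fill (.var x') ++ (x', V) :: D) (E.fill (.var Δ.start)))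
        (.letrec (Δ.fill V ++ (x', V) :: D) (E.fill (.var Δ.start)))
  | assoc (x : Var) (D : Defs Var) (A : Tm Var) (D' : Defs Var) (E : Ctx Var) : IsAnswer A →
      Redex (.letrec ((x, .letrec D A) :: D') (E.fill (.var x)))
        (.letrec (D ++ (x, A) :: D') (E.fill (.var x)))
  | assoc_env (x' : Var) (D : Defs Var) (A : Tm Var) (Δ : Deps Var) (D' : Defs Var)
      (E : Ctx Var) : IsAnswer A →
      Redex (.letrec ((x', .letrec D A) :: (Δ.fill (.var x') ++ D')) (E.fill (.var Δ.start)))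
        (.letrec (D ++ (x', A) :: (Δ.fill (.var x') ++ D')) (E.fill (.var Δ.start)))
  | error (Δ : Deps Var) (D : Defs Var) (E : Ctx Var) :
      Redex (.letrec (Δ.fill (.var Δ.start) ++ D) (E.fill (.var Δ.start)))
        (.letrec (Δ.fill .bh ++ D) (E.fill (.var Δ.start)))
  | error_env (Δ Δ' : Deps Var) (D : Defs Var) (E : Ctx Var) :
      Redex (.letrec (Δ.fill (.var Δ.start) ++ (Δ'.fill (.var Δ.start) ++ D))
          (E.fill (.var Δ'.start)))
        (.letrec (Δ.fill .bh ++ (Δ'.fill (.var Δ.start) ++ D)) (E.fill (.var Δ'.start)))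
  | error_beta (M : Tm Var) : Redex (.app .bh M) .bh

variable [DecidableEq Var]

/-- Standard reduction `M → N` on `α`-equivalence classes: a canonical representative is
decomposed into an evaluation context and a redex, and the redex is contracted. -/
def Step (c c' : Cls Var) : Prop :=
  ∃ (E : Ctx Var) (R R' : Tm Var), Redex R R' ∧ (E.fill R).Canonical ∧
    (E.fill R).cls = c ∧ (E.fill R').cls = c'

/-- `↠`, the reflexive and transitive closure of `→`. -/
def Reduces (c c' : Cls Var) : Prop := Relation.ReflTransGen Step c c'

end Reduction

section Natural

variable {Var : Type u} [DecidableEq Var]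

/-- Heaps: finite mappings from variables to (raw) expressions. -/
abbrev Heap (Var : Type u) : Type u := Finmap fun _ : Var => Tm Var

/-- `Ψ[xᵢ ↦ Mᵢ]` for the definitions `D = x₁ be M₁, …, xₙ be Mₙ`. -/
def Heap.extend (Ψ : Heap Var) (D : Defs Var) : Heap Var :=
  D.foldr (fun b Φ => Φ.insert b.1 b.2) Ψ

/-- The variables that occur in a heap, in its domain or in an expression it contains. -/
def Heap.occ (Ψ : Heap Var) : Set Var :=
  {x | ∃ (y : Var) (M : Tm Var), Ψ.lookup y = some M ∧ (x = y ∨ x ∈ M.occ)}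

/-- The natural semantics: `Eval Ψ M Φ V` is the judgment `Ψ ⊢ M ⇓ Φ : V`. It works with raw
expressions, without implicit renaming. A variable is fresh if it occurs nowhere in the heap and
the expressions at hand. -/
inductive Eval : Heap Var → Tm Var → Heap Var → Tm Var → Prop
  | value {Ψ : Heap Var} {V : Tm Var} : IsValue V → Eval Ψ V Ψ V
  | app {Ψ Φ Ψ' : Heap Var} {M₁ M₂ N V : Tm Var} {x x' : Var} :
      Eval Ψ M₁ Φ (.lam x N) →
      x' ∉ Φ.occ → x' ∉ M₂.occ → x' ∉ (Tm.lam x N).occ →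
      Eval (Φ.insert x' M₂) (N.subst x' x) Ψ' V →
      Eval Ψ (.app M₁ M₂) Ψ' V
  | var {Ψ Φ : Heap Var} {x : Var} {M V : Tm Var} :
      Ψ.lookup x = some M →
      Eval (Ψ.insert x .bh) M Φ V →
      Eval Ψ (.var x) (Φ.insert x V) V
  | letrec {Ψ Φ : Heap Var} {D : Defs Var} {N V : Tm Var} {f : Var → Var} :
      Freshening (names D) (Ψ.occ ∪ (Tm.letrec D N).occ) f →
      Eval (Ψ.extend (renameAll f D)) (N.rename f) Φ V →
      Eval Ψ (.letrec D N) Φ V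
  | error_beta {Ψ Φ : Heap Var} {M₁ M₂ : Tm Var} :
      Eval Ψ M₁ Φ .bh →
      Eval Ψ (.app M₁ M₂) Φ .bh

/-- `Θ ::= ε | Θ, let rec D in []`, sequences of `let rec` frames, outermost frame first. -/
abbrev Letrecs (Var : Type u) : Type u := List (Defs Var)

/-- `Θ[M]`. -/
def Letrecs.fill (Θ : Letrecs Var) (M : Tm Var) : Tm Var := Θ.foldr Tm.letrec M

/-- `⌊Θ⌋`, the sequence of all definitions in the frames of `Θ`. -/
def Letrecs.floor (Θ : Letrecs Var) : Defs Var := Θ.flatten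

/-- The identification of a sequence of definitions, of pairwise distinct variables, with a
heap. -/
def IsHeap (D : Defs Var) (Ψ : Heap Var) : Prop :=
  (names D).Nodup ∧ ∀ (x : Var) (M : Tm Var), Ψ.lookup x = some M ↔ (x, M) ∈ D

end Natural

end Letrec

-- Both semantics are compared with a machine whose states consist of a heap, an expression in focus
-- and a stack of frames. Reading a state back (`unload`) gives an ordinary expression: argument
-- frames become applications, `lets` frames become `let rec`s, and an `upd` frame puts the focus
-- back as the right-hand side of its variable. `Focus` steps only change which subexpression is in
-- view; `Fire` singles out the states in which a redex has been found.
--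
-- The machine is deterministic and describes standard reduction in both directions. Evaluation
-- contexts are routes of the machine: loaded with a canonical E[R], it travels to R and fires into
-- E[R'] (`Ctx.runs`, `load_fire`). As α-equivalent closed expressions run in lockstep
-- (`fire_unique`), reduction of closed classes is deterministic (`step_det`). Conversely, the stack
-- of a closed state can be parsed as an evaluation context (`exists_chain`, `exists_seg`), so every
-- firing is a reduction step (`step_of_fire`). These comparisons use a relational α-equivalence
-- `AEq`, in which matched variables are explicit and which can be inverted; it agrees with `Alpha`
-- on well-formed expressions (`Alpha.aeq`, `AEq.alpha`).
--
-- A derivation of the natural semantics is simulated by reduction beneath an arbitrary stack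
-- (`Eval.reduces`). For an application, the argument is lifted into the `let rec`s around the
-- function and then contracted; for a variable, the `let rec`s around the value are flattened into
-- the frame of the variable and the value is copied. With the empty stack this proves the second
-- part, where the remaining `lets` frames form Θ.
--
-- For the first part, an answer is irreducible, so by determinism all reduction from M terminates.
-- Termination yields a derivation (`exists_eval`): the outer induction is on reduction, and between
-- contractions the total size of focus and heap decreases, because entering a variable leaves only
-- • in the heap. The derivation is simulated by a reduction to some Θ[V], and uniqueness of normal
-- forms (`normal_unique`) identifies its class with that of A.

namespace Letrec

universe u

set_option linter.unusedSectionVars false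

-- Variables, binders and renaming of raw expressions.

section Expressions

variable {Var : Type u}

/-- Structural induction on expressions, with one hypothesis for each right-hand side. -/
theorem Tm.ind {P : Tm Var → Prop} (var : ∀ x, P (.var x)) (lam : ∀ x M, P M → P (.lam x M))
    (app : ∀ M N, P M → P N → P (.app M N))
    (letrec : ∀ D M, (∀ b ∈ D, P b.2) → P M → P (.letrec D M)) (bh : P .bh) : ∀ M, P M := by
  intro M
  refine Tm.rec (motive_1 := P) (motive_2 := fun D => ∀ b ∈ D, P b.2) (motive_3 := fun b => P b.2)
    var lam app letrec bh ?_ ?_ ?_ M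
  · simp
  · intro b D hb hD c hc
    rcases List.mem_cons.1 hc with rfl | hc
    · exact hb
    · exact hD c hc
  · intro x M h
    exact h

variable [DecidableEq Var]

theorem mem_names {D : Defs Var} {x : Var} : x ∈ names D ↔ ∃ M, (x, M) ∈ D := by
  simp [names]

theorem mem_names_of_mem {D : Defs Var} {b : Var × Tm Var} (h : b ∈ D) : b.1 ∈ names D :=
  List.mem_map_of_mem h

@[simp] theorem names_nil : names ([] : Defs Var) = [] := rfl

@[simp] theorem names_cons (b : Var × Tm Var) (D : Defs Var) : names (b :: D) = b.1 :: names D := rfl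

@[simp] theorem names_append (D D' : Defs Var) : names (D ++ D') = names D ++ names D' := by
  simp [names]

theorem mem_fvDefs {D : Defs Var} {x : Var} : x ∈ fvDefs D ↔ ∃ b ∈ D, x ∈ b.2.fv := by
  induction D with
  | nil => simp [fvDefs]
  | cons b D ih => obtain ⟨y, M⟩ := b; simp [fvDefs, ih]

theorem mem_occDefs {D : Defs Var} {x : Var} :
    x ∈ occDefs D ↔ ∃ b ∈ D, x = b.1 ∨ x ∈ b.2.occ := by
  induction D with
  | nil => simp [occDefs]
  | cons b D ih => obtain ⟨y, M⟩ := b; simp [occDefs, ih, or_assoc]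

theorem bindersDefs_eq (D : Defs Var) :
    bindersDefs D = D.flatMap fun b => b.1 :: b.2.binders := by
  induction D with
  | nil => simp [bindersDefs]
  | cons b D ih => obtain ⟨y, M⟩ := b; simp [bindersDefs, ih]

theorem renameDefs_eq (f : Var → Var) (D : Defs Var) :
    renameDefs f D = D.map fun b => (b.1, b.2.rename f) := by
  induction D with
  | nil => simp [renameDefs]
  | cons b D ih => obtain ⟨y, M⟩ := b; simp [renameDefs, ih]

theorem mem_fv_letrec {D : Defs Var} {M : Tm Var} {x : Var} :
    x ∈ (Tm.letrec D M).fv ↔ ((∃ b ∈ D, x ∈ b.2.fv) ∨ x ∈ M.fv) ∧ x ∉ names D := by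
  simp [Tm.fv, mem_fvDefs]

theorem mem_binders_letrec {D : Defs Var} {M : Tm Var} {x : Var} :
    x ∈ (Tm.letrec D M).binders ↔
      x ∈ names D ∨ (∃ b ∈ D, x ∈ b.2.binders) ∨ x ∈ M.binders := by
  simp only [Tm.binders, bindersDefs_eq, List.mem_append, List.mem_flatMap, List.mem_cons, names,
    List.mem_map]
  grind

theorem mem_occ_letrec {D : Defs Var} {M : Tm Var} {x : Var} :
    x ∈ (Tm.letrec D M).occ ↔ (∃ b ∈ D, x = b.1 ∨ x ∈ b.2.occ) ∨ x ∈ M.occ := by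
  simp [Tm.occ, mem_occDefs]

theorem mem_occ {M : Tm Var} {x : Var} : x ∈ M.occ ↔ x ∈ M.fv ∨ x ∈ M.binders := by
  induction M using Tm.ind with
  | var y => simp [Tm.occ, Tm.fv, Tm.binders]
  | lam y M ih => simp [Tm.occ, Tm.fv, Tm.binders, ih]; tauto
  | app M N ihM ihN => simp [Tm.occ, Tm.fv, Tm.binders, ihM, ihN]; tauto
  | letrec D M ihD ihM =>
    rw [mem_occ_letrec, mem_fv_letrec, mem_binders_letrec, ihM]
    constructor
    · rintro (⟨b, hb, rfl | h⟩ | h)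
      · exact Or.inr (Or.inl (mem_names_of_mem hb))
      · have := (ihD b hb).1 h
        by_cases hx : x ∈ names D
        · tauto
        · rcases this with h | h
          · exact Or.inl ⟨Or.inl ⟨b, hb, h⟩, hx⟩
          · exact Or.inr (Or.inr (Or.inl ⟨b, hb, h⟩))
      · by_cases hx : x ∈ names D
        · tauto
        · tauto
    · rintro (⟨⟨b, hb, h⟩ | h, -⟩ | h | ⟨b, hb, h⟩ | h)
      · exact Or.inl ⟨b, hb, Or.inr ((ihD b hb).2 (Or.inl h))⟩
      · tauto
      · obtain ⟨N, hN⟩ := mem_names.1 h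
        exact Or.inl ⟨_, hN, Or.inl rfl⟩
      · exact Or.inl ⟨b, hb, Or.inr ((ihD b hb).2 (Or.inr h))⟩
      · tauto
  | bh => simp [Tm.occ, Tm.fv, Tm.binders]

theorem Tm.WF.letrec_iff {D : Defs Var} {M : Tm Var} :
    (Tm.letrec D M).WF ↔ (names D).Nodup ∧ (∀ b ∈ D, b.2.WF) ∧ M.WF :=
  ⟨fun h => by cases h; exact ⟨‹_›, ‹_›, ‹_›⟩, fun h => .letrec h.1 h.2.1 h.2.2⟩

/-- `f` with the values at `xs` replaced by those of `g`. -/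
def override (xs : List Var) (g f : Var → Var) (y : Var) : Var := if y ∈ xs then g y else f y

theorem rename_letrec (f : Var → Var) (D : Defs Var) (M : Tm Var) :
    (Tm.letrec D M).rename f =
      .letrec (D.map fun b => (b.1, b.2.rename (override (names D) id f)))
        (M.rename (override (names D) id f)) := by
  rw [Tm.rename, renameDefs_eq]
  rfl

theorem names_map_snd (D : Defs Var) (g : Var × Tm Var → Tm Var) :
    names (D.map fun b => (b.1, g b)) = names D := by
  simp [names, Function.comp_def]

theorem rename_congr {M : Tm Var} {f g : Var → Var} (h : ∀ a ∈ M.fv, f a = g a) :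
    M.rename f = M.rename g := by
  induction M using Tm.ind generalizing f g with
  | var y => simpa [Tm.rename, Tm.fv] using h
  | lam y M ih =>
    simp only [Tm.rename, Tm.lam.injEq, true_and]
    refine ih fun a ha => ?_
    by_cases hy : a = y
    · simp [hy]
    · simpa [Function.update, hy] using h a (by simp [Tm.fv, hy, ha])
  | app M N ihM ihN =>
    simp only [Tm.rename]
    rw [ihM fun a ha => h a (by simp [Tm.fv, ha]), ihN fun a ha => h a (by simp [Tm.fv, ha])]
  | letrec D M ihD ihM =>
    have key : ∀ a, ((∃ b ∈ D, a ∈ b.2.fv) ∨ a ∈ M.fv) →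
        override (names D) id f a = override (names D) id g a := by
      intro a ha
      unfold override
      split_ifs with hx
      · rfl
      · exact h a (mem_fv_letrec.2 ⟨ha, hx⟩)
    rw [rename_letrec, rename_letrec, ihM fun a ha => key a (Or.inr ha)]
    congr 1
    refine List.map_congr_left fun b hb => ?_
    rw [ihD b hb fun a ha => key a (Or.inl ⟨b, hb, ha⟩)]
  | bh => rfl

theorem binders_rename {M : Tm Var} {f : Var → Var} : (M.rename f).binders = M.binders := by
  induction M using Tm.ind generalizing f with
  | var y => simp [Tm.rename, Tm.binders]
  | lam y M ih => simp [Tm.rename, Tm.binders, ih]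
  | app M N ihM ihN => simp [Tm.rename, Tm.binders, ihM, ihN]
  | letrec D M ihD ihM =>
    rw [rename_letrec, Tm.binders, Tm.binders, bindersDefs_eq, bindersDefs_eq, ihM,
      List.flatMap_map]
    congr 1
    exact List.flatMap_congr fun b hb => by simp [ihD b hb]
  | bh => rfl

theorem wf_rename {M : Tm Var} {f : Var → Var} : (M.rename f).WF ↔ M.WF := by
  induction M using Tm.ind generalizing f with
  | var y => exact ⟨fun _ => .var _, fun _ => .var _⟩
  | lam y M ih =>
    exact ⟨fun h => by cases h with | lam h => exact .lam (ih.1 h),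
      fun h => by cases h with | lam h => exact .lam (ih.2 h)⟩
  | app M N ihM ihN =>
    exact ⟨fun h => by cases h with | app h h' => exact .app (ihM.1 h) (ihN.1 h'),
      fun h => by cases h with | app h h' => exact .app (ihM.2 h) (ihN.2 h')⟩
  | letrec D M ihD ihM =>
    rw [rename_letrec, Tm.WF.letrec_iff, Tm.WF.letrec_iff, ihM, names_map_snd, List.forall_mem_map]
    refine and_congr_right fun _ => and_congr_left fun _ => ?_
    exact forall₂_congr fun b hb => ihD b hb
  | bh => exact ⟨fun _ => .bh, fun _ => .bh⟩

/-- No free variable of `M` that `f` changes becomes bound. -/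
def CaptureFree (f : Var → Var) (M : Tm Var) : Prop := ∀ a ∈ M.fv, f a = a ∨ f a ∉ M.binders

/-- With `z = x` this descends under a binder that is kept; with `z` new it descends while the
binder is renamed to `z`. -/
theorem CaptureFree.of_lam {f : Var → Var} {x : Var} {M : Tm Var}
    (h : CaptureFree f (.lam x M)) (z : Var) (hz : z = x ∨ z ∉ M.binders) :
    CaptureFree (Function.update f x z) M := by
  intro a ha
  by_cases hx : a = x
  · subst hx; simpa using hz
  · have := h a (by simp [Tm.fv, ha, hx])
    simp only [Function.update, hx, Tm.binders, List.mem_cons, not_or] at this ⊢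
    tauto

theorem CaptureFree.ne_of_lam {f : Var → Var} {x : Var} {M : Tm Var}
    (h : CaptureFree f (.lam x M)) {a : Var} (ha : a ∈ M.fv) (hx : a ≠ x) : f a ≠ x := by
  rcases h a (by simp [Tm.fv, ha, hx]) with h | h
  · rwa [h]
  · rintro rfl; simp [Tm.binders] at h

theorem CaptureFree.not_mem_names {f : Var → Var} {D : Defs Var} {M : Tm Var}
    (h : CaptureFree f (.letrec D M)) {a : Var} (ha : (∃ b ∈ D, a ∈ b.2.fv) ∨ a ∈ M.fv)
    (hx : a ∉ names D) : f a ∉ names D := by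
  rcases h a (mem_fv_letrec.2 ⟨ha, hx⟩) with h | h
  · rwa [h]
  · intro h'; exact h (mem_binders_letrec.2 (Or.inl h'))

/-- The function `g` is the identity when the defined variables are kept, and a freshening when they
are renamed. -/
theorem CaptureFree.of_letrec_def {f g : Var → Var} {D : Defs Var} {M : Tm Var}
    (h : CaptureFree f (.letrec D M)) (hg : ∀ a ∈ names D, g a = a ∨ g a ∉ (Tm.letrec D M).binders)
    {b : Var × Tm Var} (hb : b ∈ D) : CaptureFree (override (names D) g f) b.2 := by
  intro a ha
  have key : ∀ c, c ∉ (Tm.letrec D M).binders → c ∉ b.2.binders := fun c hc h' =>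
    hc (mem_binders_letrec.2 (Or.inr (Or.inl ⟨b, hb, h'⟩)))
  unfold override
  split_ifs with hx
  · exact (hg a hx).imp id (key _)
  · exact (h a (mem_fv_letrec.2 ⟨Or.inl ⟨b, hb, ha⟩, hx⟩)).imp id (key _)

theorem CaptureFree.of_letrec_body {f g : Var → Var} {D : Defs Var} {M : Tm Var}
    (h : CaptureFree f (.letrec D M))
    (hg : ∀ a ∈ names D, g a = a ∨ g a ∉ (Tm.letrec D M).binders) :
    CaptureFree (override (names D) g f) M := by
  intro a ha
  have key : ∀ c, c ∉ (Tm.letrec D M).binders → c ∉ M.binders := fun c hc h' =>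
    hc (mem_binders_letrec.2 (Or.inr (Or.inr h')))
  unfold override
  split_ifs with hx
  · exact (hg a hx).imp id (key _)
  · exact (h a (mem_fv_letrec.2 ⟨Or.inr ha, hx⟩)).imp id (key _)

/-- Composition can fail only if `f` moves a free variable under a binder of its new name, where `g`
no longer reaches it. No condition on `g` is needed, since any capture by `g` happens identically on
both sides. -/
theorem rename_rename {M : Tm Var} {f g : Var → Var} (h : CaptureFree f M) :
    (M.rename f).rename g = M.rename (g ∘ f) := by
  induction M using Tm.ind generalizing f g with
  | var y => simp [Tm.rename]
  | lam y M ih =>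
    simp only [Tm.rename, Tm.lam.injEq, true_and]
    rw [ih (h.of_lam y (Or.inl rfl))]
    refine rename_congr fun a ha => ?_
    by_cases hy : a = y
    · simp [hy]
    · simp [Function.update, hy, h.ne_of_lam ha hy]
  | app M N ihM ihN =>
    simp only [Tm.rename]
    rw [ihM, ihN]
    · intro a ha
      have := h a (by simp [Tm.fv, ha])
      simp [Tm.binders] at this; tauto
    · intro a ha
      have := h a (by simp [Tm.fv, ha])
      simp [Tm.binders] at this; tauto
  | letrec D M ihD ihM =>
    rw [rename_letrec, rename_letrec, rename_letrec, names_map_snd, List.map_map]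
    have key : ∀ a, ((∃ b ∈ D, a ∈ b.2.fv) ∨ a ∈ M.fv) →
        (override (names D) id g ∘ override (names D) id f) a = override (names D) id (g ∘ f) a := by
      intro a ha
      simp only [Function.comp, override, id]
      split_ifs with h1 h2
      · rfl
      · exact absurd h2 (h.not_mem_names ha h1)
      · rfl
    congr 1
    · refine List.map_congr_left fun b hb => ?_
      simp only [Function.comp, Prod.mk.injEq, true_and]
      rw [ihD b hb (h.of_letrec_def (g := id) (fun _ _ => Or.inl rfl) hb)]
      exact rename_congr fun a ha => key a (Or.inl ⟨b, hb, ha⟩)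
    · rw [ihM (h.of_letrec_body (g := id) (fun _ _ => Or.inl rfl))]
      exact rename_congr fun a ha => key a (Or.inr ha)
  | bh => rfl

theorem rename_id (M : Tm Var) : M.rename id = M := by
  induction M using Tm.ind with
  | var y => rfl
  | lam y M ih =>
    rw [Tm.rename, show Function.update id y y = (id : Var → Var) from Function.update_eq_self y id,
      ih]
  | app M N ihM ihN => simp [Tm.rename, ihM, ihN]
  | letrec D M ihD ihM =>
    have : override (names D) id id = id := by ext a; simp [override]
    rw [rename_letrec, this, ihM]
    congr 1
    conv_rhs => rw [← List.map_id D]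
    exact List.map_congr_left fun b hb => by simp [ihD b hb]
  | bh => rfl

end Expressions

-- α-equivalence as a relation with explicit matching of variables.

section RelationalAlpha

variable {Var : Type u} [DecidableEq Var]

/-- `B` is (the graph of) a bijection from `xs` onto `ys`. -/
structure IsBij (B : Var → Var → Prop) (xs ys : List Var) : Prop where
  left : ∀ {a b}, B a b → a ∈ xs
  right : ∀ {a b}, B a b → b ∈ ys
  total : ∀ a ∈ xs, ∃ b, B a b
  surj : ∀ b ∈ ys, ∃ a, B a b
  inj : ∀ {a a' b}, B a b → B a' b → a = a'
  func : ∀ {a b b'}, B a b → B a b' → b = b'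

/-- `R` below binders that are matched by `B`. -/
def ext (R B : Var → Var → Prop) (a b : Var) : Prop :=
  B a b ∨ ((∀ c, ¬ B a c) ∧ (∀ c, ¬ B c b) ∧ R a b)

/-- The relation that holds between `x` and `y` only. -/
def pair (x y : Var) (a b : Var) : Prop := a = x ∧ b = y

/-- `M` and `N` agree up to the names of bound variables and the order of definitions, when their
free variables are matched by `R`. -/
inductive AEq : (Var → Var → Prop) → Tm Var → Tm Var → Prop
  | var {R : Var → Var → Prop} {x y : Var} : R x y → AEq R (.var x) (.var y)
  | lam {R : Var → Var → Prop} {x y : Var} {M N : Tm Var} :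
      AEq (ext R (pair x y)) M N → AEq R (.lam x M) (.lam y N)
  | app {R : Var → Var → Prop} {M M' N N' : Tm Var} :
      AEq R M M' → AEq R N N' → AEq R (.app M N) (.app M' N')
  | letrec {R B : Var → Var → Prop} {D D' : Defs Var} {M M' : Tm Var} :
      (names D).Nodup → (names D').Nodup → IsBij B (names D) (names D') →
      (∀ b ∈ D, ∀ b' ∈ D', B b.1 b'.1 → AEq (ext R B) b.2 b'.2) → AEq (ext R B) M M' →
      AEq R (.letrec D M) (.letrec D' M')
  | bh {R : Var → Var → Prop} : AEq R .bh .bh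

theorem IsBij.symm {B : Var → Var → Prop} {xs ys : List Var} (h : IsBij B xs ys) :
    IsBij (flip B) ys xs :=
  ⟨h.right, h.left, h.surj, h.total, h.func, h.inj⟩

theorem IsBij.comp {B C : Var → Var → Prop} {xs ys zs : List Var} (h : IsBij B xs ys)
    (h' : IsBij C ys zs) : IsBij (Relation.Comp B C) xs zs where
  left := fun ⟨_, hb, _⟩ => h.left hb
  right := fun ⟨_, _, hc⟩ => h'.right hc
  total a ha := by
    obtain ⟨b, hb⟩ := h.total a ha
    obtain ⟨c, hc⟩ := h'.total b (h.right hb)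
    exact ⟨c, b, hb, hc⟩
  surj c hc := by
    obtain ⟨b, hb⟩ := h'.surj c hc
    obtain ⟨a, ha⟩ := h.surj b (h'.left hb)
    exact ⟨a, b, ha, hb⟩
  inj := by
    rintro a a' c ⟨b, hb, hc⟩ ⟨b', hb', hc'⟩
    obtain rfl := h'.inj hc hc'
    exact h.inj hb hb'
  func := by
    rintro a c c' ⟨b, hb, hc⟩ ⟨b', hb', hc'⟩
    obtain rfl := h.func hb hb'
    exact h'.func hc hc'

theorem IsBij.not_left {B : Var → Var → Prop} {xs ys : List Var} (h : IsBij B xs ys) {a : Var} :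
    (∀ c, ¬ B a c) ↔ a ∉ xs :=
  ⟨fun h' ha => (h.total a ha).elim h', fun h' _ hc => h' (h.left hc)⟩

theorem IsBij.not_right {B : Var → Var → Prop} {xs ys : List Var} (h : IsBij B xs ys) {a : Var} :
    (∀ c, ¬ B c a) ↔ a ∉ ys :=
  ⟨fun h' ha => (h.surj a ha).elim h', fun h' _ hc => h' (h.right hc)⟩

theorem isBij_pair (x y : Var) : IsBij (pair x y) [x] [y] where
  left h := by simp [h.1]
  right h := by simp [h.2]
  total a ha := ⟨y, by simpa using ha, rfl⟩
  surj b hb := ⟨x, rfl, by simpa using hb⟩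
  inj h h' := h.1.trans h'.1.symm
  func h h' := h.2.trans h'.2.symm

theorem ext_pair {R : Var → Var → Prop} {x y a b : Var} :
    ext R (pair x y) a b ↔ (a = x ∧ b = y) ∨ (a ≠ x ∧ b ≠ y ∧ R a b) := by
  unfold ext
  rw [(isBij_pair x y).not_left, (isBij_pair x y).not_right]
  simp [pair]

/-- Only pairs of free variables are ever looked up in the matching. For closed expressions the
matching is therefore immaterial, which is how relations that arise from runs of the machine become
equality in the end. -/
theorem AEq.mono {R S : Var → Var → Prop} {M N : Tm Var} (h : AEq R M N)
    (hRS : ∀ a ∈ M.fv, ∀ b ∈ N.fv, R a b → S a b) : AEq S M N := by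
  induction h generalizing S with
  | var h => exact .var (hRS _ (by simp [Tm.fv]) _ (by simp [Tm.fv]) h)
  | @lam R x y M N _ ih =>
    refine .lam (ih fun a ha b hb h => ?_)
    rw [ext_pair] at h ⊢
    exact h.imp id fun h => ⟨h.1, h.2.1, hRS a (by simp [Tm.fv, h.1, ha]) b
      (by simp [Tm.fv, h.2.1, hb]) h.2.2⟩
  | app _ _ ih ih' =>
    exact .app (ih fun a ha b hb => hRS a (by simp [Tm.fv, ha]) b (by simp [Tm.fv, hb]))
      (ih' fun a ha b hb => hRS a (by simp [Tm.fv, ha]) b (by simp [Tm.fv, hb]))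
  | @letrec R B D D' M M' hD hD' hB _ _ ihD ihM =>
    have key : ∀ a, ((∃ b ∈ D, a ∈ b.2.fv) ∨ a ∈ M.fv) → ∀ c,
        ((∃ b ∈ D', c ∈ b.2.fv) ∨ c ∈ M'.fv) → ext R B a c → ext S B a c := by
      intro a ha c hc h
      refine h.imp id fun h => ⟨h.1, h.2.1, hRS a (mem_fv_letrec.2 ⟨ha, ?_⟩) c
        (mem_fv_letrec.2 ⟨hc, ?_⟩) h.2.2⟩
      · exact hB.not_left.1 h.1
      · exact hB.not_right.1 h.2.1
    exact .letrec hD hD' hB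
      (fun b hb b' hb' h => ihD b hb b' hb' h fun a ha c hc =>
        key a (Or.inl ⟨b, hb, ha⟩) c (Or.inl ⟨b', hb', hc⟩))
      (ihM fun a ha c hc => key a (Or.inr ha) c (Or.inr hc))
  | bh => exact .bh

theorem AEq.mono' {R S : Var → Var → Prop} {M N : Tm Var} (h : AEq R M N)
    (hRS : ∀ a b, R a b → S a b) : AEq S M N :=
  h.mono fun a _ b _ => hRS a b

theorem AEq.symm {R : Var → Var → Prop} {M N : Tm Var} (h : AEq R M N) : AEq (flip R) N M := by
  induction h with
  | var h => exact .var h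
  | lam _ ih =>
    refine .lam (ih.mono' fun a b h => ?_)
    have := ext_pair.1 h
    exact ext_pair.2 (by tauto)
  | app _ _ ih ih' => exact .app ih ih'
  | @letrec R B D D' M M' hD hD' hB _ _ ihD ihM =>
    have key : ∀ a b, flip (ext R B) a b → ext (flip R) (flip B) a b := fun a b h =>
      h.imp id fun h => ⟨h.2.1, h.1, h.2.2⟩
    exact .letrec hD' hD hB.symm (fun b hb b' hb' h => (ihD b' hb' b hb h).mono' key)
      (ihM.mono' key)
  | bh => exact .bh

/-- The matchings compose binder by binder. The range of the first bijection and the domain of the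
second are the variables of the same `let rec`, so the mixed cases, bound for one and free for the
other, cannot occur. -/
theorem AEq.trans {R S : Var → Var → Prop} {M N P : Tm Var} (h : AEq R M N) (h' : AEq S N P) :
    AEq (Relation.Comp R S) M P := by
  induction h generalizing S P with
  | var h => cases h' with | var h' => exact .var ⟨_, h, h'⟩
  | @lam R x y M N _ ih =>
    cases h' with
    | @lam _ _ z _ _ h' =>
      refine .lam ((ih h').mono' fun a c h => ?_)
      obtain ⟨b, hb, hc⟩ := h
      rw [ext_pair] at hb hc ⊢
      rcases hb with ⟨rfl, rfl⟩ | ⟨h1, h2, h3⟩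
      · simp at hc; tauto
      · simp [h2] at hc
        exact Or.inr ⟨h1, hc.1, _, h3, hc.2⟩
  | app _ _ ih ih' => cases h' with | app h h' => exact .app (ih h) (ih' h')
  | @letrec R B D D' M M' hD hD' hB _ _ ihD ihM =>
    cases h' with
    | @letrec _ C _ D'' _ M'' _ hD'' hC h2 h2' =>
      have key : ∀ a c, Relation.Comp (ext R B) (ext S C) a c →
          ext (Relation.Comp R S) (Relation.Comp B C) a c := by
        rintro a c ⟨b, hb, hc⟩
        rcases hb with hb | ⟨h1, h2, h3⟩
        · rcases hc with hc | ⟨h1', -, -⟩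
          · exact Or.inl ⟨b, hb, hc⟩
          · exact absurd (hB.right hb) (hC.not_left.1 h1')
        · rcases hc with hc | ⟨h1', h2', h3'⟩
          · exact absurd (hC.left hc) (hB.not_right.1 h2)
          · refine Or.inr ⟨(hB.comp hC).not_left.2 (hB.not_left.1 h1),
              (hB.comp hC).not_right.2 (hC.not_right.1 h2'), b, h3, h3'⟩
      refine .letrec hD hD'' (hB.comp hC) (fun b hb b'' hb'' h => ?_) ((ihM h2').mono' key)
      obtain ⟨y, h3, h4⟩ := h
      obtain ⟨N, hN⟩ := mem_names.1 (hB.right h3)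
      exact (ihD b hb (y, N) hN h3 (h2 (y, N) hN b'' hb'' h4)).mono' key
  | bh => cases h' with | bh => exact .bh

theorem eq_of_mem_of_nodup {D : Defs Var} (hD : (names D).Nodup) {b b' : Var × Tm Var}
    (hb : b ∈ D) (hb' : b' ∈ D) (h : b.1 = b'.1) : b = b' :=
  List.inj_on_of_nodup_map hD hb hb' h

theorem AEq.wf_left {R : Var → Var → Prop} {M N : Tm Var} (h : AEq R M N) : M.WF := by
  induction h with
  | var h => exact .var _
  | lam _ ih => exact .lam ih
  | app _ _ ih ih' => exact .app ih ih'
  | @letrec R B D D' M M' hD hD' hB _ _ ihD ihM =>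
    refine .letrec hD (fun b hb => ?_) ihM
    obtain ⟨y, hy⟩ := hB.total b.1 (mem_names_of_mem hb)
    obtain ⟨N, hN⟩ := mem_names.1 (hB.right hy)
    exact ihD b hb (y, N) hN hy
  | bh => exact .bh

/-- Renaming of the free variables, as relational `α`-equivalence. -/
theorem aeq_rename {M : Tm Var} (hM : M.WF) {f : Var → Var} (hf : CaptureFree f M) :
    AEq (fun a b => b = f a) M (M.rename f) := by
  induction M using Tm.ind generalizing f with
  | var y => exact .var rfl
  | lam y M ih =>
    cases hM with
    | lam hM =>
      refine .lam ((ih hM (hf.of_lam y (Or.inl rfl))).mono fun a ha b hb h => ?_)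
      rw [ext_pair]
      by_cases hy : a = y
      · left; simpa [hy] using h
      · right; simp only [Function.update, hy] at h; subst h
        exact ⟨hy, hf.ne_of_lam ha hy, rfl⟩
  | app M N ihM ihN =>
    cases hM with
    | app hM hN =>
      refine .app (ihM hM fun a ha => ?_) (ihN hN fun a ha => ?_)
      · have := hf a (by simp [Tm.fv, ha])
        simp [Tm.binders] at this; tauto
      · have := hf a (by simp [Tm.fv, ha])
        simp [Tm.binders] at this; tauto
  | letrec D M ihD ihM =>
    obtain ⟨hD, hW, hM⟩ := Tm.WF.letrec_iff.1 hM
    rw [rename_letrec]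
    have hid : ∀ a ∈ names D, id a = a ∨ id a ∉ (Tm.letrec D M).binders :=
      fun _ _ => Or.inl rfl
    have key : ∀ a, ((∃ b ∈ D, a ∈ b.2.fv) ∨ a ∈ M.fv) → ∀ c,
        c = override (names D) id f a →
          ext (fun a b => b = f a) (fun a b => a = b ∧ a ∈ names D) a c := by
      intro a ha c hc
      unfold override at hc
      split_ifs at hc with hx
      · exact Or.inl ⟨hc.symm, hx⟩
      · refine Or.inr ⟨fun c h => hx h.2, fun d h => ?_, hc⟩
        obtain ⟨rfl, h⟩ := h
        subst hc
        exact hf.not_mem_names ha hx h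
    refine .letrec (B := fun a b => a = b ∧ a ∈ names D) hD (by rwa [names_map_snd]) ?_ ?_ ?_
    · rw [names_map_snd]
      exact ⟨fun h => h.2, fun h => h.1 ▸ h.2, fun a ha => ⟨a, rfl, ha⟩, fun a ha => ⟨a, rfl, ha⟩,
        fun h h' => h.1.trans h'.1.symm, fun h h' => h.1.symm.trans h'.1⟩
    · rintro b hb b' hb' ⟨h, -⟩
      obtain ⟨b'', hb'', rfl⟩ := List.mem_map.1 hb'
      obtain rfl := eq_of_mem_of_nodup hD hb hb'' h
      exact (ihD b hb (hW b hb) (hf.of_letrec_def hid hb)).mono fun a ha c _ h =>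
        key a (Or.inl ⟨b, hb, ha⟩) c h
    · exact (ihM hM (hf.of_letrec_body hid)).mono fun a ha c _ h => key a (Or.inr ha) c h
  | bh => exact .bh

/-- This is renaming by the identity. Well-formedness cannot be dropped, as `AEq` insists on
distinct names in each `let rec`. -/
theorem AEq.refl {M : Tm Var} (h : M.WF) : AEq Eq M M := by
  have := aeq_rename h (f := id) fun _ _ => Or.inl rfl
  rw [rename_id] at this
  exact this.mono' fun a b h => h.symm

theorem AEq.eq_symm {M N : Tm Var} (h : AEq Eq M N) : AEq Eq N M :=
  h.symm.mono' fun _ _ h => Eq.symm h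

theorem AEq.eq_trans {M N P : Tm Var} (h : AEq Eq M N) (h' : AEq Eq N P) : AEq Eq M P :=
  (h.trans h').mono' fun _ _ ⟨_, h, h'⟩ => h.trans h'

/-- Free variables follow the matching, because `ext` falls back on `R` only for names that are
bound on neither side. -/
theorem AEq.exists_fv {R : Var → Var → Prop} {M N : Tm Var} (h : AEq R M N) {a : Var}
    (ha : a ∈ M.fv) : ∃ b ∈ N.fv, R a b := by
  induction h generalizing a with
  | var h => simp only [Tm.fv, Finset.mem_singleton] at ha ⊢; exact ⟨_, rfl, ha ▸ h⟩
  | lam _ ih =>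
    simp only [Tm.fv, Finset.mem_erase] at ha ⊢
    obtain ⟨b, hb, h⟩ := ih ha.2
    rw [ext_pair] at h
    exact ⟨b, by tauto⟩
  | app _ _ ih ih' =>
    simp only [Tm.fv, Finset.mem_union] at ha ⊢
    rcases ha with ha | ha
    · obtain ⟨b, hb, h⟩ := ih ha; exact ⟨b, Or.inl hb, h⟩
    · obtain ⟨b, hb, h⟩ := ih' ha; exact ⟨b, Or.inr hb, h⟩
  | @letrec R B D D' M M' hD hD' hB _ _ ihD ihM =>
    obtain ⟨ha, hn⟩ := mem_fv_letrec.1 ha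
    have key : ∀ c, ((∃ b ∈ D', c ∈ b.2.fv) ∨ c ∈ M'.fv) → ext R B a c →
        ∃ b ∈ (Tm.letrec D' M').fv, R a b := by
      intro c hc h
      rcases h with h | ⟨-, h, h'⟩
      · exact absurd (hB.left h) hn
      · exact ⟨c, mem_fv_letrec.2 ⟨hc, hB.not_right.1 h⟩, h'⟩
    rcases ha with ⟨b, hb, ha⟩ | ha
    · obtain ⟨y, hy⟩ := hB.total b.1 (mem_names_of_mem hb)
      obtain ⟨N, hN⟩ := mem_names.1 (hB.right hy)
      obtain ⟨c, hc, h⟩ := ihD b hb (y, N) hN hy ha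
      exact key c (Or.inl ⟨_, hN, hc⟩) h
    · obtain ⟨c, hc, h⟩ := ihM ha
      exact key c (Or.inr hc) h
  | bh => simp [Tm.fv] at ha

theorem AEq.fv_eq {M N : Tm Var} (h : AEq Eq M N) : M.fv = N.fv := by
  ext a
  constructor
  · intro ha; obtain ⟨b, hb, rfl⟩ := h.exists_fv ha; exact hb
  · intro ha; obtain ⟨b, hb, rfl⟩ := h.eq_symm.exists_fv ha; exact hb

/-- The free variables of closed expressions impose no condition. -/
theorem AEq.of_closed {R S : Var → Var → Prop} {M N : Tm Var} (h : AEq R M N) (hM : M.fv = ∅) :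
    AEq S M N :=
  h.mono fun a ha => by simp [hM] at ha

theorem AEq.closed_right {R : Var → Var → Prop} {M N : Tm Var} (h : AEq R M N) (hM : M.fv = ∅) :
    N.fv = ∅ := by
  rw [← (h.of_closed (S := Eq) hM).fv_eq, hM]

theorem AEq.isAnswer {R : Var → Var → Prop} {M N : Tm Var} (h : AEq R M N) (hM : IsAnswer M) :
    IsAnswer N := by
  induction h with
  | var h => cases hM with | value h => cases h
  | lam _ ih => exact .value (.lam _ _)
  | app _ _ ih ih' => cases hM with | value h => cases h
  | letrec _ _ _ _ _ _ ih =>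
    cases hM with
    | value h => cases h
    | letrec _ h => exact .letrec _ (ih h)
  | bh => exact .value .bh

/-! ### Comparison with `Alpha` -/

theorem wf_renameAll {D : Defs Var} {M : Tm Var} {f : Var → Var}
    (hf : ∀ x ∈ names D, ∀ y ∈ names D, f x = f y → x = y) :
    (Tm.letrec (renameAll f D) (M.rename f)).WF ↔ (Tm.letrec D M).WF := by
  rw [Tm.WF.letrec_iff, Tm.WF.letrec_iff, wf_rename, renameAll, List.forall_mem_map]
  have : names (D.map fun b => (f b.1, b.2.rename f)) = (names D).map f := by simp [names]
  rw [this]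
  refine and_congr ?_ (and_congr_left fun _ => forall₂_congr fun b hb => wf_rename)
  exact ⟨List.Nodup.of_map f, fun h => h.map_on hf⟩

/-- Stated as an equivalence so that the symmetry rule goes through; `Alpha.aeq` can then assume
well-formedness of one side only. -/
theorem Alpha.wf_iff {M N : Tm Var} (h : Alpha M N) : M.WF ↔ N.WF := by
  induction h with
  | refl M => rfl
  | symm _ ih => exact ih.symm
  | trans _ _ ih ih' => exact ih.trans ih'
  | lam x _ ih =>
    exact ⟨fun h => by cases h with | lam h => exact .lam (ih.1 h),
      fun h => by cases h with | lam h => exact .lam (ih.2 h)⟩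
  | app _ _ ih ih' =>
    exact ⟨fun h => by cases h with | app h h' => exact .app (ih.1 h) (ih'.1 h'),
      fun h => by cases h with | app h h' => exact .app (ih.2 h) (ih'.2 h')⟩
  | letrec_body D _ ih => rw [Tm.WF.letrec_iff, Tm.WF.letrec_iff, ih]
  | letrec_def x D M _ ih => simp [Tm.WF.letrec_iff, ih]
  | letrec_perm M h =>
    rw [Tm.WF.letrec_iff, Tm.WF.letrec_iff]
    refine and_congr (h.map _).nodup_iff (and_congr_left fun _ => ?_)
    exact forall_congr' fun b => imp_congr_left h.mem_iff
  | lam_rename _ =>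
    exact ⟨fun h => by cases h with | lam h => exact .lam (wf_rename.2 h),
      fun h => by cases h with | lam h => exact .lam (wf_rename.1 h)⟩
  | letrec_rename h => exact (wf_renameAll h.1).symm

/-- Equality on a list of variables, as a bijection of the list onto itself. -/
theorem isBij_eq {xs ys : List Var} (h : ∀ a, a ∈ xs ↔ a ∈ ys) :
    IsBij (fun a b => a = b ∧ a ∈ xs) xs ys :=
  ⟨fun h => h.2, fun h' => h'.1 ▸ (h _).1 h'.2, fun a ha => ⟨a, rfl, ha⟩,
    fun a ha => ⟨a, rfl, (h a).2 ha⟩, fun h h' => h.1.trans h'.1.symm,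
    fun h h' => h.1.symm.trans h'.1⟩

theorem ext_eq {xs : List Var} {a b : Var} :
    ext Eq (fun a b => a = b ∧ a ∈ xs) a b ↔ a = b := by
  constructor
  · rintro (h | h)
    · exact h.1
    · exact h.2.2
  · rintro rfl
    by_cases ha : a ∈ xs
    · exact Or.inl ⟨rfl, ha⟩
    · exact Or.inr ⟨fun c h => ha h.2, fun c h => ha (h.1 ▸ h.2), rfl⟩

theorem AEq.letrec_congr {D D' : Defs Var} {M M' : Tm Var} (hD : (names D).Nodup)
    (hD' : (names D').Nodup) (h : ∀ a, a ∈ names D ↔ a ∈ names D')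
    (hb : ∀ b ∈ D, ∀ b' ∈ D', b.1 = b'.1 → AEq Eq b.2 b'.2) (hM : AEq Eq M M') :
    AEq Eq (.letrec D M) (.letrec D' M') :=
  .letrec hD hD' (isBij_eq h)
    (fun b h b' h' hbb => (hb b h b' h' hbb.1).mono' fun _ _ => ext_eq.2)
    (hM.mono' fun _ _ => ext_eq.2)

/-- The two renaming rules are instances of `aeq_rename`, since new names capture nothing.
Well-formedness is needed because `Alpha` is reflexive on all raw expressions, even those with
repeated names in a `let rec`. -/
theorem Alpha.aeq {M N : Tm Var} (h : Alpha M N) (hM : M.WF) : AEq Eq M N := by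
  induction h with
  | refl M => exact .refl hM
  | symm h ih => exact (ih (h.wf_iff.2 hM)).eq_symm
  | trans h _ ih ih' => exact (ih hM).eq_trans (ih' (h.wf_iff.1 hM))
  | lam x _ ih =>
    cases hM with
    | lam hM =>
      refine .lam ((ih hM).mono' ?_)
      rintro a _ rfl
      rw [ext_pair]
      by_cases h : a = x <;> simp [h]
  | app _ _ ih ih' => cases hM with | app h h' => exact .app (ih h) (ih' h')
  | letrec_body D _ ih =>
    obtain ⟨hD, hb, hM⟩ := Tm.WF.letrec_iff.1 hM
    refine .letrec_congr hD hD (fun _ => Iff.rfl) (fun b h b' h' e => ?_) (ih hM)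
    obtain rfl := eq_of_mem_of_nodup hD h h' e
    exact .refl (hb b h)
  | letrec_def x D M _ ih =>
    obtain ⟨hD, hb, hM⟩ := Tm.WF.letrec_iff.1 hM
    refine .letrec_congr hD hD (fun _ => Iff.rfl) (fun b h b' h' e => ?_) (.refl hM)
    simp only [names_cons, List.nodup_cons] at hD
    rcases List.mem_cons.1 h with rfl | h <;> rcases List.mem_cons.1 h' with rfl | h'
    · exact ih (hb _ List.mem_cons_self)
    · replace e : x = b'.1 := e
      exact hD.1.elim (e ▸ mem_names_of_mem h')
    · replace e : b.1 = x := e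
      exact hD.1.elim (e ▸ mem_names_of_mem h)
    · obtain rfl := eq_of_mem_of_nodup hD.2 h h' e
      exact .refl (hb b (by simp [h]))
  | letrec_perm M h =>
    obtain ⟨hD, hb, hM⟩ := Tm.WF.letrec_iff.1 hM
    refine .letrec_congr hD ((h.map _).nodup_iff.1 hD) (fun a => (h.map _).mem_iff)
      (fun b hbD b' h' e => ?_) (.refl hM)
    obtain rfl := eq_of_mem_of_nodup hD hbD (h.mem_iff.2 h') e
    exact .refl (hb b hbD)
  | @lam_rename x x' M h =>
    cases hM with
    | lam hM =>
      have h1 : x' ∉ M.fv ∧ x' ∉ M.binders := by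
        rw [← not_or, ← mem_occ]; intro h'; exact h (by simp [Tm.occ, h'])
      refine .lam ((aeq_rename hM fun a ha => ?_).mono fun a ha b hb h => ?_)
      · by_cases hx : a = x
        · subst hx; simp [h1.2]
        · simp [Function.update, hx]
      · rw [ext_pair]
        by_cases hx : a = x
        · simp_all
        · simp only [Function.update, hx, dite_false, id] at h
          subst h
          exact Or.inr ⟨hx, fun h => h1.1 (h ▸ ha), rfl⟩
  | @letrec_rename D M f h =>
    obtain ⟨hD, hb, hM⟩ := Tm.WF.letrec_iff.1 hM
    obtain ⟨hinj, hfr, hid⟩ := h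
    have hnames : names (renameAll f D) = (names D).map f := by simp [names, renameAll]
    have hfr' : ∀ x ∈ names D, (∀ b ∈ D, f x ∉ b.2.occ) ∧ f x ∉ M.occ := fun x hx =>
      ⟨fun b hb h => hfr x hx (mem_occ_letrec.2 (Or.inl ⟨b, hb, Or.inr h⟩)),
        fun h => hfr x hx (mem_occ_letrec.2 (Or.inr h))⟩
    have hcf : ∀ N : Tm Var, (∀ x ∈ names D, f x ∉ N.occ) → CaptureFree f N := by
      intro N hN a _
      by_cases hx : a ∈ names D
      · exact Or.inr fun h => hN a hx (mem_occ.2 (Or.inr h))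
      · exact Or.inl (hid a hx)
    have key : ∀ N : Tm Var, N.WF → (∀ x ∈ names D, f x ∉ N.occ) →
        AEq (ext Eq fun a b => b = f a ∧ a ∈ names D) N (N.rename f) := by
      intro N hN hNf
      refine (aeq_rename hN (hcf N hNf)).mono fun a ha b _ h => ?_
      by_cases hx : a ∈ names D
      · exact Or.inl ⟨h, hx⟩
      · rw [hid a hx] at h
        subst h
        refine Or.inr ⟨fun c h => hx h.2, fun c h => ?_, rfl⟩
        exact hNf c h.2 (h.1 ▸ mem_occ.2 (Or.inl ha))
    refine .letrec hD (by rw [hnames]; exact hD.map_on hinj)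
      (B := fun a b => b = f a ∧ a ∈ names D) ?_ ?_ ?_
    · rw [hnames]
      exact ⟨fun h => h.2, fun h => h.1 ▸ List.mem_map_of_mem h.2, fun a ha => ⟨_, rfl, ha⟩,
        fun b hb => (List.mem_map.1 hb).imp fun a h => ⟨h.2.symm, h.1⟩,
        fun h h' => hinj _ h.2 _ h'.2 (h.1.symm.trans h'.1), fun h h' => h.1.trans h'.1.symm⟩
    · rintro b hbD b' hb' ⟨h, -⟩
      obtain ⟨b'', hb'', rfl⟩ := List.mem_map.1 hb'
      obtain rfl := eq_of_mem_of_nodup hD hbD hb''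
        (hinj _ (mem_names_of_mem hbD) _ (mem_names_of_mem hb'') h.symm)
      exact key b.2 (hb b hbD) fun x hx => (hfr' x hx).1 b hbD
    · exact key M hM fun x hx => (hfr' x hx).2

end RelationalAlpha

-- Choice of new names; the two notions of α-equivalence agree.

section Fresh

variable {Var : Type u} [DecidableEq Var]

theorem exists_freshening [Infinite Var] (xs : List Var) (S : Finset Var) :
    ∃ f, Freshening xs (S : Set Var) f := by
  induction xs generalizing S with
  | nil => exact ⟨id, by simp [Freshening]⟩
  | cons x xs ih =>
    obtain ⟨f, h1, h2, h3⟩ := ih S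
    obtain ⟨z, hz⟩ := Infinite.exists_notMem_finset (S ∪ xs.toFinset.image f)
    simp only [Finset.mem_union, Finset.mem_image, List.mem_toFinset, not_or, not_exists,
      not_and] at hz
    by_cases hx : x ∈ xs
    · refine ⟨f, fun a ha b hb => h1 a ?_ b ?_, fun a ha => h2 a ?_, fun a ha => h3 a ?_⟩ <;> grind
    · refine ⟨Function.update f x z, fun a ha b hb => ?_, fun a ha => ?_, fun a ha => ?_⟩
      · simp only [Function.update]; grind
      · simp only [Function.update]; grind
      · simp only [Function.update]; grind

/-- The congruence rule reaches only the head of a list, so each definition is permuted to the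
front, changed and put back. The prefix `D₀` collects the definitions already treated. -/
theorem Alpha.letrec_defs {D D' : Defs Var} (M : Tm Var)
    (h : List.Forall₂ (fun b b' => b.1 = b'.1 ∧ Alpha b.2 b'.2) D D') (D₀ : Defs Var) :
    Alpha (.letrec (D₀ ++ D) M) (.letrec (D₀ ++ D') M) := by
  induction h generalizing D₀ with
  | nil => exact .refl _
  | @cons b b' D D' hb _ ih =>
    obtain ⟨x, N⟩ := b
    obtain ⟨x', N'⟩ := b'
    obtain ⟨rfl, hN⟩ := hb
    refine .trans (.letrec_perm _ List.perm_middle) (.trans (.letrec_def _ _ _ hN) ?_)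
    refine .trans (.letrec_perm _ List.perm_middle.symm) ?_
    simpa using ih (D₀ ++ [(x, N')])

theorem nodup_of_nodup_names {D : Defs Var} (h : (names D).Nodup) : D.Nodup := h.of_map _

/-- A `let rec` may be changed definition by definition, in any order. -/
theorem Alpha.letrec_congr {D D' : Defs Var} {M M' : Tm Var} (hD : (names D).Nodup)
    (hD' : (names D').Nodup) (hn : ∀ a, a ∈ names D ↔ a ∈ names D')
    (hb : ∀ b ∈ D, ∀ b' ∈ D', b.1 = b'.1 → Alpha b.2 b'.2) (hM : Alpha M M') :
    Alpha (.letrec D M) (.letrec D' M') := by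
  have hex : ∀ b : Var × Tm Var, ∃ b' : Var × Tm Var, b ∈ D → b' ∈ D' ∧ b.1 = b'.1 := by
    intro b
    by_cases h : b ∈ D
    · obtain ⟨N, hN⟩ := mem_names.1 ((hn b.1).1 (mem_names_of_mem h))
      exact ⟨(b.1, N), fun _ => ⟨hN, rfl⟩⟩
    · exact ⟨b, fun h' => absurd h' h⟩
  choose φ hφ using hex
  have hnm : names (D.map φ) = names D := by
    simp only [names, List.map_map]
    exact List.map_congr_left fun b h => (hφ b h).2.symm
  have hperm : (D.map φ).Perm D' := by
    rw [List.perm_ext_iff_of_nodup (nodup_of_nodup_names (hnm ▸ hD)) (nodup_of_nodup_names hD')]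
    intro c
    constructor
    · intro h
      obtain ⟨b, hbD, rfl⟩ := List.mem_map.1 h
      exact (hφ b hbD).1
    · intro h
      obtain ⟨N, hN⟩ := mem_names.1 ((hn c.1).2 (mem_names_of_mem h))
      have := hφ _ hN
      exact List.mem_map.2 ⟨_, hN, eq_of_mem_of_nodup hD' this.1 h this.2.symm⟩
  refine .trans (.letrec_body D hM) (.trans ?_ (.letrec_perm M' hperm))
  refine Alpha.letrec_defs (D₀ := []) _ ?_
  rw [List.forall₂_map_right_iff, List.forall₂_same]
  exact fun b h => ⟨(hφ b h).2, hb b h _ (hφ b h).1 (hφ b h).2⟩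

/-- Renaming by `f` below the binders and then freshening the binders by `F` is one simultaneous
renaming: capture-freeness keeps the images under `f` out of the reach of `F`. -/
theorem renameAll_map {D : Defs Var} {M : Tm Var} {f F : Var → Var}
    (hf : CaptureFree f (.letrec D M)) (hF : ∀ x ∉ names D, F x = x) :
    renameAll F (D.map fun b => (b.1, b.2.rename (override (names D) id f))) =
        D.map (fun b => (F b.1, b.2.rename (override (names D) F f))) ∧
      (M.rename (override (names D) id f)).rename F = M.rename (override (names D) F f) := by
  have hid : ∀ a ∈ names D, id a = a ∨ id a ∉ (Tm.letrec D M).binders := fun _ _ => Or.inl rfl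
  have key : ∀ a, ((∃ b ∈ D, a ∈ b.2.fv) ∨ a ∈ M.fv) →
      (F ∘ override (names D) id f) a = override (names D) F f a := by
    intro a ha
    simp only [Function.comp, override, id]
    split_ifs with h
    · rfl
    · exact hF _ (hf.not_mem_names ha h)
  constructor
  · rw [renameAll, List.map_map]
    refine List.map_congr_left fun b hb => ?_
    simp only [Function.comp, Prod.mk.injEq, true_and]
    rw [rename_rename (hf.of_letrec_def hid hb)]
    exact rename_congr fun a ha => key a (Or.inl ⟨b, hb, ha⟩)
  · rw [rename_rename (hf.of_letrec_body hid)]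
    exact rename_congr fun a ha => key a (Or.inr ha)

/-- The renamings are part of the induction: at a binder, the bound variables of both sides are sent
to a common new name, and the induction hypothesis then speaks directly of the renamed bodies. -/
theorem AEq.alpha_rename [Infinite Var] {R : Var → Var → Prop} {M N : Tm Var} (h : AEq R M N)
    {f g : Var → Var} (hf : CaptureFree f M) (hg : CaptureFree g N)
    (hfg : ∀ a ∈ M.fv, ∀ b ∈ N.fv, R a b → f a = g b) : Alpha (M.rename f) (N.rename g) := by
  induction h generalizing f g with
  | var h =>
    simp only [Tm.rename]
    rw [hfg _ (by simp [Tm.fv]) _ (by simp [Tm.fv]) h]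
    exact .refl _
  | @lam R x y M N _ ih =>
    simp only [Tm.rename]
    set f' := Function.update f x x
    set g' := Function.update g y y
    obtain ⟨z, hz⟩ := Infinite.exists_notMem_finset ((Tm.lam x (M.rename f')).occ ∪
      (Tm.lam y (N.rename g')).occ)
    simp only [Finset.mem_union, not_or] at hz
    have hzM : z ∉ M.binders := fun h => hz.1 (by simp [Tm.occ, mem_occ, binders_rename, h])
    have hzN : z ∉ N.binders := fun h => hz.2 (by simp [Tm.occ, mem_occ, binders_rename, h])
    refine .trans (.lam_rename hz.1) (.trans ?_ (.symm (.lam_rename hz.2)))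
    have eM : (M.rename f').subst z x = M.rename (Function.update f x z) := by
      rw [Tm.subst, rename_rename (hf.of_lam x (Or.inl rfl))]
      refine rename_congr fun a ha => ?_
      by_cases hx : a = x
      · simp [hx]
      · simp [Function.update, hx, hf.ne_of_lam ha hx]
    have eN : (N.rename g').subst z y = N.rename (Function.update g y z) := by
      rw [Tm.subst, rename_rename (hg.of_lam y (Or.inl rfl))]
      refine rename_congr fun a ha => ?_
      by_cases hx : a = y
      · simp [hx]
      · simp [Function.update, hx, hg.ne_of_lam ha hx]
    rw [eM, eN]
    refine .lam _ (ih (hf.of_lam z (Or.inr hzM)) (hg.of_lam z (Or.inr hzN)) ?_)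
    intro a ha b hb h
    rcases ext_pair.1 h with ⟨rfl, rfl⟩ | ⟨h1, h2, h⟩
    · simp
    · simp only [Function.update, h1, h2, dite_false]
      exact hfg a (by simp [Tm.fv, ha, h1]) b (by simp [Tm.fv, hb, h2]) h
  | app _ _ ih ih' =>
    refine .app (ih ?_ ?_ ?_) (ih' ?_ ?_ ?_)
    any_goals
      intro a ha
      have := hf a (by simp [Tm.fv, ha])
      simp [Tm.binders] at this; tauto
    any_goals
      intro a ha
      have := hg a (by simp [Tm.fv, ha])
      simp [Tm.binders] at this; tauto
    all_goals exact fun a ha b hb => hfg a (by simp [Tm.fv, ha]) b (by simp [Tm.fv, hb])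
  | @letrec R B D D' M M' hD hD' hB _ _ ihD ihM =>
    -- `F` picks the common new names for the left side; transported along the inverse `β` of the
    -- bijection they give `G` on the right side.
    obtain ⟨F, hF1, hF2, hF3⟩ := exists_freshening (names D)
      (((Tm.letrec D M).rename f).occ ∪ ((Tm.letrec D' M').rename g).occ)
    choose! β hβ using hB.surj
    have hβ' : ∀ {a b : Var}, B a b → β b = a := fun h => hB.inj (hβ _ (hB.right h)) h
    have hβn : ∀ b ∈ names D', β b ∈ names D := fun b h => hB.left (hβ b h)
    set G : Var → Var := fun y => if y ∈ names D' then F (β y) else y with hG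
    have hGv : ∀ {y : Var}, y ∈ names D' → G y = F (β y) := fun h => by simp [hG, h]
    have hG3 : ∀ y ∉ names D', G y = y := fun y h => by simp [hG, h]
    have hG1 : ∀ x ∈ names D', ∀ y ∈ names D', G x = G y → x = y := by
      intro x hx y hy h
      rw [hGv hx, hGv hy] at h
      have := hF1 _ (hβn x hx) _ (hβn y hy) h
      exact hB.func (hβ x hx) (this ▸ hβ y hy)
    simp only [Finset.coe_union, Set.mem_union, Finset.mem_coe, not_or] at hF2
    have hG2 : ∀ y ∈ names D', G y ∉ ((Tm.letrec D' M').rename g).occ := fun y hy => by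
      rw [hGv hy]; exact (hF2 _ (hβn y hy)).2
    have hFb : ∀ a ∈ names D, F a = a ∨ F a ∉ (Tm.letrec D M).binders := fun a ha =>
      Or.inr fun h => (hF2 a ha).1 (mem_occ.2 (Or.inr (by rwa [binders_rename])))
    have hGb : ∀ a ∈ names D', G a = a ∨ G a ∉ (Tm.letrec D' M').binders := fun a ha =>
      Or.inr fun h => hG2 a ha (mem_occ.2 (Or.inr (by rwa [binders_rename])))
    obtain ⟨e1, e2⟩ := renameAll_map hf hF3
    obtain ⟨e3, e4⟩ := renameAll_map hg hG3
    have key : ∀ a, ((∃ b ∈ D, a ∈ b.2.fv) ∨ a ∈ M.fv) → ∀ c,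
        ((∃ b ∈ D', c ∈ b.2.fv) ∨ c ∈ M'.fv) → ext R B a c →
          override (names D) F f a = override (names D') G g c := by
      intro a ha c hc h
      rcases h with h | ⟨h1, h2, h3⟩
      · simp only [override, hB.left h, hB.right h, if_true, hGv, hβ' h]
      · have h1 := hB.not_left.1 h1
        have h2 := hB.not_right.1 h2
        simp only [override, h1, h2, if_false]
        exact hfg a (mem_fv_letrec.2 ⟨ha, h1⟩) c (mem_fv_letrec.2 ⟨hc, h2⟩) h3
    rw [rename_letrec] at hF2 hG2 ⊢
    rw [rename_letrec] at hF2 ⊢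
    refine .trans (.letrec_rename (f := F) ⟨?_, ?_, ?_⟩)
      (.trans ?_ (.symm (.letrec_rename (f := G) ⟨?_, ?_, ?_⟩)))
    · rwa [names_map_snd]
    · rw [names_map_snd]; exact fun a ha => (hF2 a ha).1
    · rwa [names_map_snd]
    · rw [e1, e2, e3, e4]
      have n1 : names (D.map fun b => (F b.1, b.2.rename (override (names D) F f))) =
        (names D).map F := by simp [names]
      have n2 : names (D'.map fun b => (G b.1, b.2.rename (override (names D') G g))) =
        (names D').map G := by simp [names]
      refine Alpha.letrec_congr ?_ ?_ ?_ ?_ ?_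
      · rw [n1]; exact hD.map_on hF1
      · rw [n2]; exact hD'.map_on hG1
      · intro a
        rw [n1, n2, List.mem_map, List.mem_map]
        constructor
        · rintro ⟨x, hx, rfl⟩
          obtain ⟨y, hy⟩ := hB.total x hx
          exact ⟨y, hB.right hy, by rw [hGv (hB.right hy), hβ' hy]⟩
        · rintro ⟨y, hy, rfl⟩
          exact ⟨β y, hβn y hy, (hGv hy).symm⟩
      · intro b hb b' hb' h
        obtain ⟨c, hc, rfl⟩ := List.mem_map.1 hb
        obtain ⟨c', hc', rfl⟩ := List.mem_map.1 hb'
        simp only at h ⊢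
        have hn := mem_names_of_mem hc'
        rw [hGv hn] at h
        have hBc : B c.1 c'.1 := by
          rw [hF1 _ (mem_names_of_mem hc) _ (hβn _ hn) h]; exact hβ _ hn
        exact ihD c hc c' hc' hBc (hf.of_letrec_def hFb hc) (hg.of_letrec_def hGb hc')
          fun a ha d hd => key a (Or.inl ⟨c, hc, ha⟩) d (Or.inl ⟨c', hc', hd⟩)
      · exact ihM (hf.of_letrec_body hFb) (hg.of_letrec_body hGb)
          fun a ha d hd => key a (Or.inr ha) d (Or.inr hd)
    · rwa [names_map_snd]
    · rwa [names_map_snd]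
    · rwa [names_map_snd]
  | bh => exact .refl _

theorem AEq.alpha [Infinite Var] {M N : Tm Var} (h : AEq Eq M N) : Alpha M N := by
  have := h.alpha_rename (f := id) (g := id) (fun _ _ => Or.inl rfl) (fun _ _ => Or.inl rfl)
    fun a _ b _ h => h
  rwa [rename_id, rename_id] at this

theorem AEq.cls_eq [Infinite Var] {M N : Tm Var} (h : AEq Eq M N) : M.cls = N.cls :=
  Quotient.sound h.alpha

theorem alpha_of_cls_eq {M N : Tm Var} (h : M.cls = N.cls) : Alpha M N :=
  Quotient.exact h

/-- Every expression has a representative whose binding occurrences are pairwise distinct and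
avoid a given finite set. -/
theorem exists_nodup_binders [Infinite Var] {M : Tm Var} (hM : M.WF) (S : Finset Var) :
    ∃ M', Alpha M M' ∧ M'.binders.Nodup ∧ ∀ x ∈ M'.binders, x ∉ S := by
  induction M using Tm.ind generalizing S with
  | var y => exact ⟨.var y, .refl _, by simp [Tm.binders], by simp [Tm.binders]⟩
  | lam y M ih =>
    cases hM with
    | lam hM =>
      obtain ⟨M', h1, h2, h3⟩ := ih hM S
      obtain ⟨z, hz⟩ := Infinite.exists_notMem_finset ((Tm.lam y M').occ ∪ S)
      simp only [Finset.mem_union, not_or] at hz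
      refine ⟨_, .trans (.lam _ h1) (.lam_rename hz.1), ?_, ?_⟩
      · simp only [Tm.binders, Tm.subst, binders_rename, List.nodup_cons, h2, and_true]
        exact fun h => hz.1 (by simp [Tm.occ, mem_occ, h])
      · simp only [Tm.binders, Tm.subst, binders_rename, List.mem_cons, forall_eq_or_imp]
        exact ⟨hz.2, h3⟩
  | app M N ihM ihN =>
    cases hM with
    | app hM hN =>
      obtain ⟨M', h1, h2, h3⟩ := ihM hM S
      obtain ⟨N', h4, h5, h6⟩ := ihN hN (S ∪ M'.binders.toFinset)
      simp only [Finset.mem_union, not_or, List.mem_toFinset] at h6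
      refine ⟨_, .app h1 h4, ?_, ?_⟩
      · simp only [Tm.binders]
        exact h2.append h5 fun a h h' => (h6 a h').2 h
      · simp only [Tm.binders, List.mem_append]
        rintro x (h | h)
        · exact h3 x h
        · exact (h6 x h).1
  | letrec D M ihD ihM =>
    obtain ⟨hD, hW, hM⟩ := Tm.WF.letrec_iff.1 hM
    obtain ⟨M', h1, h2, h3⟩ := ihM hM S
    -- Right-hand sides are treated one at a time, each avoiding the binders chosen so far. The
    -- defined variables themselves are renamed only at the end.
    have hdefs : ∀ D₀ : Defs Var, (∀ b ∈ D₀, b ∈ D) → ∀ S : Finset Var, ∃ D' : Defs Var,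
        List.Forall₂ (fun b b' => b.1 = b'.1 ∧ Alpha b.2 b'.2) D₀ D' ∧
        (D'.flatMap fun b => b.2.binders).Nodup ∧
        ∀ x ∈ D'.flatMap fun b => b.2.binders, x ∉ S := by
      intro D₀
      induction D₀ with
      | nil => exact fun _ S => ⟨[], .nil, by simp, by simp⟩
      | cons b D₀ ih =>
        intro hsub S
        obtain ⟨D', h1, h2, h3⟩ := ih (fun c hc => hsub c (by simp [hc])) S
        have hb := hsub b (by simp)
        obtain ⟨N, h4, h5, h6⟩ := ihD b hb (hW b hb)
          (S ∪ (D'.flatMap fun b => b.2.binders).toFinset)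
        simp only [Finset.mem_union, not_or, List.mem_toFinset] at h6
        refine ⟨(b.1, N) :: D', .cons ⟨rfl, h4⟩ h1, ?_, ?_⟩
        · rw [List.flatMap_cons]
          exact h5.append h2 fun a h h' => (h6 a h).2 h'
        · rw [List.flatMap_cons]
          simp only [List.mem_append]
          rintro x (h | h)
          · exact (h6 x h).1
          · exact h3 x h
    obtain ⟨D', h4, h5, h6⟩ := hdefs D (fun _ h => h) (S ∪ M'.binders.toFinset)
    simp only [Finset.mem_union, not_or, List.mem_toFinset] at h6
    have hn : names D' = names D := by
      clear * - h4
      induction h4 with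
      | nil => rfl
      | cons h _ ih => simp [h.1, ih]
    obtain ⟨f, hf⟩ := exists_freshening (names D') ((Tm.letrec D' M').occ ∪ S)
    have hfS : ∀ x ∈ names D', f x ∉ S ∧ f x ∉ M'.binders ∧
        f x ∉ D'.flatMap fun b => b.2.binders := by
      intro x hx
      have := hf.2.1 x hx
      simp only [Finset.coe_union, Set.mem_union, Finset.mem_coe, not_or, mem_occ,
        mem_binders_letrec] at this
      simp only [List.mem_flatMap]
      tauto
    have hperm : (Tm.letrec (renameAll f D') (M'.rename f)).binders.Perm
        ((names D').map f ++ (D'.flatMap (fun b => b.2.binders) ++ M'.binders)) := by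
      rw [Tm.binders, binders_rename, ← List.append_assoc]
      refine List.Perm.append_right _ ?_
      clear * -
      rw [bindersDefs_eq, renameAll, List.flatMap_map]
      simp only [binders_rename]
      induction D' with
      | nil => simp
      | cons b D ih =>
        simp only [List.flatMap_cons, names_cons, List.map_cons, List.cons_append]
        refine List.Perm.cons _ ((ih.append_left _).trans ?_)
        rw [← List.append_assoc, ← List.append_assoc]
        exact List.perm_append_comm.append_right _
    have hDD : Alpha (.letrec D M') (.letrec D' M') := Alpha.letrec_defs (D₀ := []) _ h4
    refine ⟨_, .trans (.trans (.letrec_body D h1) hDD)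
      (.letrec_rename (f := f) ⟨hf.1, fun x hx h => hf.2.1 x hx ?_, hf.2.2⟩), ?_, ?_⟩
    · simpa using Or.inl h
    · rw [hperm.nodup_iff]
      refine ((hn ▸ hD).map_on hf.1).append (h5.append h2 fun a h h' => (h6 a h).2 h') ?_
      intro a h h'
      obtain ⟨x, hx, rfl⟩ := List.mem_map.1 h
      have := hfS x hx
      simp only [List.mem_append] at h'
      tauto
    · intro x hx
      rw [hperm.mem_iff, List.mem_append, List.mem_append, List.mem_map] at hx
      rcases hx with ⟨y, hy, rfl⟩ | hx | hx
      · exact (hfS y hy).1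
      · exact (h6 x hx).1
      · exact h3 x hx
  | bh => exact ⟨.bh, .refl _, by simp [Tm.binders], by simp [Tm.binders]⟩

theorem wf_of_nodup_binders {M : Tm Var} (h : M.binders.Nodup) : M.WF := by
  induction M using Tm.ind with
  | var y => exact .var y
  | lam y M ih => exact .lam (ih (List.nodup_cons.1 h).2)
  | app M N ihM ihN =>
    exact .app (ihM (List.Nodup.of_append_left h)) (ihN (List.Nodup.of_append_right h))
  | letrec D M ihD ihM =>
    rw [Tm.binders, bindersDefs_eq] at h
    have hD := List.Nodup.of_append_left h
    refine .letrec ?_ (fun b hb => ihD b hb ?_) (ihM (List.Nodup.of_append_right h))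
    · refine List.Nodup.sublist ?_ hD
      clear * -
      induction D with
      | nil => simp
      | cons b D ih =>
        rw [List.flatMap_cons, names_cons, List.cons_append]
        exact (ih.trans (List.sublist_append_right _ _)).cons_cons _
    · exact (List.nodup_cons.1 ((List.nodup_flatMap.1 hD).1 b hb)).2
  | bh => exact .bh

end Fresh

-- Stacks, and the expressions they represent.

/-- Stack frames: the argument of an application whose function is evaluated, the variables of a
`let rec` whose body has been entered, and a variable whose definition is evaluated. -/
inductive Frame (Var : Type u) : Type u
  | app (N : Tm Var) : Frame Var
  | lets (xs : List Var) : Frame Var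
  | upd (x : Var) : Frame Var

/-- Stacks, innermost frame first. -/
abbrev Stack (Var : Type u) : Type u := List (Frame Var)

section Stacks

variable {Var : Type u} [DecidableEq Var]

/-- The variables defined in a stack. -/
def letsNames : Stack Var → List Var
  | [] => []
  | .app _ :: K => letsNames K
  | .lets xs :: K => xs ++ letsNames K
  | .upd _ :: K => letsNames K

/-- The variables whose definitions are under evaluation. -/
def upds : Stack Var → List Var
  | [] => []
  | .app _ :: K => upds K
  | .lets _ :: K => upds K
  | .upd x :: K => x :: upds K

/-- The definitions of `xs` in the heap `h`. -/
def defsOf (h : Var → Tm Var) (xs : List Var) : Defs Var := xs.map fun x => (x, h x)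

/-- The heap `h` extended by the definitions `D`. -/
def hup (h : Var → Tm Var) (D : Defs Var) : Var → Tm Var :=
  D.foldr (fun b g => Function.update g b.1 b.2) h

/-- The expression that is represented by a heap, a focus and a stack. -/
def unload (h : Var → Tm Var) (t : Tm Var) : Stack Var → Tm Var
  | [] => t
  | .app N :: K => unload h (.app t N) K
  | .lets xs :: K => unload h (.letrec (defsOf h xs) t) K
  | .upd x :: K => unload (Function.update h x t) (.var x) K

/-- Pairwise distinct variables are defined in the stack, and those under evaluation are defined
further out and are pairwise distinct. -/
def StackOK : Stack Var → Prop
  | [] => True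
  | .app _ :: K => StackOK K
  | .lets xs :: K => xs.Nodup ∧ (∀ x ∈ xs, x ∉ letsNames K) ∧ StackOK K
  | .upd x :: K => x ∈ letsNames K ∧ x ∉ upds K ∧ StackOK K

@[simp] theorem letsNames_append (K K' : Stack Var) :
    letsNames (K ++ K') = letsNames K ++ letsNames K' := by
  induction K with
  | nil => rfl
  | cons F K ih => cases F <;> simp [letsNames, ih]

@[simp] theorem upds_append (K K' : Stack Var) : upds (K ++ K') = upds K ++ upds K' := by
  induction K with
  | nil => rfl
  | cons F K ih => cases F <;> simp [upds, ih]

@[simp] theorem names_defsOf (h : Var → Tm Var) (xs : List Var) : names (defsOf h xs) = xs := by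
  simp [names, defsOf, Function.comp_def]

theorem mem_defsOf {h : Var → Tm Var} {xs : List Var} {b : Var × Tm Var} :
    b ∈ defsOf h xs ↔ b.1 ∈ xs ∧ b.2 = h b.1 := by
  obtain ⟨x, M⟩ := b
  simp only [defsOf, List.mem_map, Prod.mk.injEq]
  constructor
  · rintro ⟨y, hy, rfl, rfl⟩; exact ⟨hy, rfl⟩
  · rintro ⟨hx, rfl⟩; exact ⟨x, hx, rfl, rfl⟩

theorem defsOf_congr {h h' : Var → Tm Var} {xs : List Var} (H : ∀ x ∈ xs, h x = h' x) :
    defsOf h xs = defsOf h' xs :=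
  List.map_congr_left fun x hx => by rw [H x hx]

@[simp] theorem hup_nil (h : Var → Tm Var) : hup h [] = h := rfl

@[simp] theorem hup_cons (h : Var → Tm Var) (b : Var × Tm Var) (D : Defs Var) :
    hup h (b :: D) = Function.update (hup h D) b.1 b.2 := rfl

theorem hup_append (h : Var → Tm Var) (D D' : Defs Var) : hup h (D ++ D') = hup (hup h D') D := by
  simp [hup, List.foldr_append]

theorem hup_of_not_mem {h : Var → Tm Var} {D : Defs Var} {x : Var} (hx : x ∉ names D) :
    hup h D x = h x := by
  induction D with
  | nil => rfl
  | cons b D ih =>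
    simp only [names_cons, List.mem_cons, not_or] at hx
    simp [Function.update, hx.1, ih hx.2]

theorem hup_of_mem {h : Var → Tm Var} {D : Defs Var} (hD : (names D).Nodup) {b : Var × Tm Var}
    (hb : b ∈ D) : hup h D b.1 = b.2 := by
  induction D with
  | nil => simp at hb
  | cons c D ih =>
    simp only [names_cons, List.nodup_cons] at hD
    rcases List.mem_cons.1 hb with rfl | hb
    · simp
    · have : b.1 ≠ c.1 := fun h => hD.1 (h ▸ mem_names_of_mem hb)
      simp [Function.update, this, ih hD.2 hb]

theorem defsOf_hup {h : Var → Tm Var} {D : Defs Var} (hD : (names D).Nodup) :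
    defsOf (hup h D) (names D) = D := by
  rw [defsOf, names, List.map_map]
  conv_rhs => rw [← List.map_id D]
  exact List.map_congr_left fun b hb => by
    rw [Function.comp, hup_of_mem hD hb]; rfl

theorem hup_defsOf (h : Var → Tm Var) (xs : List Var) : hup h (defsOf h xs) = h := by
  induction xs with
  | nil => rfl
  | cons x xs ih =>
    show Function.update (hup h (defsOf h xs)) x (h x) = h
    rw [ih, Function.update_eq_self]

theorem hup_congr {h h' : Var → Tm Var} {D : Defs Var} {x : Var} (H : x ∉ names D → h x = h' x) :
    hup h D x = hup h' D x := by
  induction D with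
  | nil => exact H (by simp)
  | cons b D ih =>
    simp only [hup_cons, Function.update]
    split_ifs with hx
    · rfl
    · exact ih fun hn => H (by simp [hx, hn])

theorem hup_update_comm {h : Var → Tm Var} {D : Defs Var} {x : Var} {M : Tm Var}
    (hx : x ∉ names D) : hup (Function.update h x M) D = Function.update (hup h D) x M := by
  funext y
  by_cases hy : y = x
  · subst hy; rw [hup_of_not_mem hx]; simp
  · rw [Function.update_of_ne hy]
    exact hup_congr fun _ => Function.update_of_ne hy _ _

theorem unload_congr {h h' : Var → Tm Var} {t : Tm Var} {K : Stack Var}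
    (H : ∀ x ∈ letsNames K, h x = h' x) : unload h t K = unload h' t K := by
  induction K generalizing h h' t with
  | nil => rfl
  | cons F K ih =>
    cases F with
    | app N => exact ih H
    | lets xs =>
      simp only [letsNames, List.mem_append] at H
      rw [unload, unload, defsOf_congr fun x hx => H x (Or.inl hx)]
      exact ih fun x hx => H x (Or.inr hx)
    | upd x =>
      refine ih fun y hy => ?_
      simp only [Function.update]
      split_ifs
      · rfl
      · exact H y hy

theorem unload_append (h : Var → Tm Var) (t : Tm Var) (xss : List (List Var)) (K : Stack Var) :
    unload h t (xss.map .lets ++ K) = unload h (unload h t (xss.map .lets)) K := by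
  induction xss generalizing t with
  | nil => rfl
  | cons xs xss ih => simp only [List.map_cons, List.cons_append, unload, ih]

theorem StackOK.upds_subset {K : Stack Var} (hK : StackOK K) {x : Var} (hx : x ∈ upds K) :
    x ∈ letsNames K := by
  induction K with
  | nil => simp [upds] at hx
  | cons F K ih =>
    cases F with
    | app N => exact ih hK hx
    | lets xs => exact List.mem_append_right _ (ih hK.2.2 hx)
    | upd y =>
      rcases List.mem_cons.1 hx with rfl | hx
      · exact hK.1
      · exact ih hK.2.2 hx

/-- The binding occurrences that a stack contributes to an unloaded expression. -/
def stackBinders (h : Var → Tm Var) : Stack Var → List Var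
  | [] => []
  | .app N :: K => N.binders ++ stackBinders h K
  | .lets xs :: K => bindersDefs (defsOf h xs) ++ stackBinders h K
  | .upd x :: K => stackBinders (Function.update h x .bh) K

theorem bindersDefs_perm {D D' : Defs Var} (h : D.Perm D') :
    (bindersDefs D).Perm (bindersDefs D') := by
  rw [bindersDefs_eq, bindersDefs_eq]
  exact h.flatMap_right _

theorem stackBinders_congr {h h' : Var → Tm Var} {K : Stack Var}
    (H : ∀ x ∈ letsNames K, h x = h' x) : stackBinders h K = stackBinders h' K := by
  induction K generalizing h h' with
  | nil => rfl
  | cons F K ih =>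
    cases F with
    | app N => rw [stackBinders, stackBinders, ih H]
    | lets xs =>
      simp only [letsNames, List.mem_append] at H
      rw [stackBinders, stackBinders, defsOf_congr fun x hx => H x (Or.inl hx),
        ih fun x hx => H x (Or.inr hx)]
    | upd x =>
      refine ih fun y hy => ?_
      simp only [Function.update]
      split_ifs
      · rfl
      · exact H y hy

theorem mem_stackBinders {h : Var → Tm Var} {K : Stack Var} {x : Var} (hx : x ∈ letsNames K) :
    x ∈ stackBinders h K := by
  induction K generalizing h with
  | nil => simp [letsNames] at hx
  | cons F K ih =>
    cases F with
    | app N => exact List.mem_append_right _ (ih hx)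
    | lets xs =>
      rcases List.mem_append.1 hx with hx | hx
      · refine List.mem_append_left _ ?_
        rw [bindersDefs_eq]
        exact List.mem_flatMap.2 ⟨(x, h x), mem_defsOf.2 ⟨hx, rfl⟩, by simp⟩
      · exact List.mem_append_right _ (ih hx)
    | upd y => exact ih hx

theorem bindersDefs_defsOf_update {h : Var → Tm Var} {xs : List Var} (hxs : xs.Nodup) {x : Var}
    (hx : x ∈ xs) (t : Tm Var) :
    (bindersDefs (defsOf (Function.update h x t) xs)).Perm
      (t.binders ++ bindersDefs (defsOf (Function.update h x .bh) xs)) := by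
  obtain ⟨l, r, rfl⟩ := List.append_of_mem hx
  have hl : x ∉ l ∧ x ∉ r := by
    have h1 := List.nodup_append'.1 hxs
    exact ⟨fun hl => h1.2.2 hl (by simp), (List.nodup_cons.1 h1.2.1).1⟩
  have key : ∀ u ys, x ∉ ys → defsOf (Function.update h x u) ys = defsOf h ys := fun u ys hy =>
    defsOf_congr fun y hy' => Function.update_of_ne (by rintro rfl; exact hy hy') _ _
  have hd : ∀ u, defsOf (Function.update h x u) (l ++ x :: r) =
      defsOf h l ++ (x, u) :: defsOf h r := by
    intro u
    rw [← key u l hl.1, ← key u r hl.2]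
    simp [defsOf]
  rw [hd, hd]
  refine (bindersDefs_perm List.perm_middle).trans
    (List.Perm.trans ?_ ((bindersDefs_perm List.perm_middle.symm).append_left _))
  simp only [bindersDefs, Tm.binders, List.nil_append]
  exact List.perm_middle.symm

/-- The definition of `x` is read exactly once: some frame defines `x`, frames define disjoint sets
of variables, and no `upd` frame overwrites the entry. -/
theorem stackBinders_update {h : Var → Tm Var} {K : Stack Var} (hK : StackOK K) {x : Var}
    (hx : x ∈ letsNames K) (hu : x ∉ upds K) (t : Tm Var) :
    (stackBinders (Function.update h x t) K).Perm
      (t.binders ++ stackBinders (Function.update h x .bh) K) := by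
  induction K generalizing h with
  | nil => simp [letsNames] at hx
  | cons F K ih =>
    cases F with
    | app N =>
      refine ((ih hK hx hu).append_left _).trans ?_
      simp only [stackBinders, ← List.append_assoc]
      exact List.perm_append_comm.append_right _
    | lets xs =>
      rcases List.mem_append.1 hx with hx | hx
      · have hn : x ∉ letsNames K := hK.2.1 x hx
        simp only [stackBinders]
        rw [stackBinders_congr (h' := Function.update h x .bh), ← List.append_assoc]
        · exact (bindersDefs_defsOf_update hK.1 hx t).append_right _
        · intro y hy
          have : y ≠ x := by rintro rfl; exact hn hy
          simp [this]
      · have hn : x ∉ xs := fun h => hK.2.1 x h hx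
        have hd : ∀ u, defsOf (Function.update h x u) xs = defsOf h xs := fun u =>
          defsOf_congr fun y hy => Function.update_of_ne (by rintro rfl; exact hn hy) _ _
        simp only [stackBinders, hd]
        refine ((ih hK.2.2 hx hu).append_left _).trans ?_
        simp only [← List.append_assoc]
        exact List.perm_append_comm.append_right _
    | upd y =>
      simp only [upds, List.mem_cons, not_or] at hu
      simp only [stackBinders]
      rw [Function.update_comm hu.1, Function.update_comm hu.1]
      exact ih hK.2.2 hx hu.2

/-- The contribution of the stack does not depend on the focus, so distinctness of the binders of
the whole expression passes to the focus. Under an `upd` frame the focus replaces the stored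
definition, whence the `•` in `stackBinders`. -/
theorem binders_unload {h : Var → Tm Var} {t : Tm Var} {K : Stack Var} (hK : StackOK K) :
    (unload h t K).binders.Perm (t.binders ++ stackBinders h K) := by
  induction K generalizing h t with
  | nil => simp [unload, stackBinders]
  | cons F K ih =>
    cases F with
    | app N =>
      refine (ih hK).trans ?_
      simp [Tm.binders, stackBinders]
    | lets xs =>
      refine (ih hK.2.2).trans ?_
      simp only [Tm.binders, stackBinders, ← List.append_assoc]
      exact List.perm_append_comm.append_right _
    | upd x =>
      refine (ih hK.2.2).trans ?_
      simp only [Tm.binders, stackBinders, List.nil_append]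
      exact stackBinders_update hK.2.2 hK.1 hK.2.1 t

/-- The binding occurrences in the focus of an unloaded expression avoid its stack. -/
theorem nodup_binders_focus {h : Var → Tm Var} {t : Tm Var} {K : Stack Var} (hK : StackOK K)
    (hn : (unload h t K).binders.Nodup) :
    t.binders.Nodup ∧ ∀ x ∈ t.binders, x ∉ letsNames K := by
  rw [(binders_unload hK).nodup_iff, List.nodup_append'] at hn
  exact ⟨hn.1, fun x hx h => hn.2.2 hx (mem_stackBinders h)⟩

end Stacks

-- Machine states up to α-equivalence.

section States

variable {Var : Type u} [DecidableEq Var]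

/-- Machine states: a heap, the expression in focus, and a stack. -/
structure State (Var : Type u) : Type u where
  heap : Var → Tm Var
  focus : Tm Var
  stack : Stack Var

/-- The expression represented by a state. -/
def State.unload (s : State Var) : Tm Var := Letrec.unload s.heap s.focus s.stack

/-- Frames that agree up to `α`-equivalence. -/
inductive FRel (R : Var → Var → Prop) : Frame Var → Frame Var → Prop
  | app {N N' : Tm Var} : AEq R N N' → FRel R (.app N) (.app N')
  | lets {xs ys : List Var} : (∀ a ∈ xs, ∃ b ∈ ys, R a b) → (∀ b ∈ ys, ∃ a ∈ xs, R a b) →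
      FRel R (.lets xs) (.lets ys)
  | upd {x y : Var} : R x y → FRel R (.upd x) (.upd y)

/-- Partial bijections. -/
def PBij (R : Var → Var → Prop) : Prop :=
  (∀ {a b b'}, R a b → R a b' → b = b') ∧ ∀ {a a' b}, R a b → R a' b → a = a'

theorem FRel.mono {R S : Var → Var → Prop} {F F' : Frame Var} (h : FRel R F F')
    (hRS : ∀ a b, R a b → S a b) : FRel S F F' := by
  cases h with
  | app h => exact .app (h.mono' hRS)
  | lets h h' =>
    exact .lets (fun a ha => (h a ha).imp fun b hb => ⟨hb.1, hRS _ _ hb.2⟩)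
      (fun a ha => (h' a ha).imp fun b hb => ⟨hb.1, hRS _ _ hb.2⟩)
  | upd h => exact .upd (hRS _ _ h)

/-- States that agree up to `α`-equivalence, where `R` matches the variables they define. -/
structure SRel (R : Var → Var → Prop) (s s' : State Var) : Prop where
  pbij : PBij R
  ok : StackOK s.stack
  ok' : StackOK s'.stack
  dom : ∀ {a b}, R a b → a ∈ letsNames s.stack ∧ b ∈ letsNames s'.stack
  focus : AEq R s.focus s'.focus
  heap : ∀ {a b}, R a b → a ∉ upds s.stack → AEq R (s.heap a) (s'.heap b)
  stack : List.Forall₂ (FRel R) s.stack s'.stack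

/-- Heap entries of variables under evaluation need not agree, since unloading their `upd` frames
overwrites them with the focus. -/
theorem aeq_unload {R : Var → Var → Prop} (hR : PBij R) {h h' : Var → Tm Var} {t t' : Tm Var}
    {K K' : Stack Var} (hK : StackOK K) (hK' : StackOK K') (hKK : List.Forall₂ (FRel R) K K')
    (ht : AEq R t t')
    (hh : ∀ {a b}, R a b → a ∈ letsNames K → a ∉ upds K → AEq R (h a) (h' b)) :
    AEq R (unload h t K) (unload h' t' K') := by
  induction hKK generalizing h h' t t' with
  | nil => exact ht
  | @cons F F' K K' hF _ ih =>
    cases hF with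
    | app hN => exact ih hK hK' (.app ht hN) hh
    | @lets xs ys h1 h2 =>
      -- The matching `R` already covers the variables of the frame, so the bijection for this `let
      -- rec` is the restriction of `R` to `xs`.
      have hext : ∀ a b, R a b → ext R (fun a b => R a b ∧ a ∈ xs) a b := by
        intro a b hab
        by_cases ha : a ∈ xs
        · exact Or.inl ⟨hab, ha⟩
        · refine Or.inr ⟨fun c hc => ha hc.2, fun c hc => ha ?_, hab⟩
          rw [hR.2 hab hc.1]; exact hc.2
      refine ih hK.2.2 hK'.2.2 (.letrec (B := fun a b => R a b ∧ a ∈ xs) ?_ ?_ ?_ ?_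
        (ht.mono' hext)) ?_
      · simpa using hK.1
      · simpa using hK'.1
      · rw [names_defsOf, names_defsOf]
        refine ⟨fun h => h.2, fun {a b} h => ?_, fun a ha => ?_, fun b hb => ?_,
          fun h h' => hR.2 h.1 h'.1, fun h h' => hR.1 h.1 h'.1⟩
        · obtain ⟨c, hc, hac⟩ := h1 a h.2
          rwa [hR.1 h.1 hac]
        · obtain ⟨b, _, hb⟩ := h1 a ha; exact ⟨b, hb, ha⟩
        · obtain ⟨a, ha, hab⟩ := h2 b hb; exact ⟨a, hab, ha⟩
      · rintro b hb b' hb' ⟨hab, ha⟩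
        rw [(mem_defsOf.1 hb).2, (mem_defsOf.1 hb').2]
        exact (hh hab (List.mem_append_left _ ha)
          fun hu => hK.2.1 _ ha (hK.2.2.upds_subset hu)).mono' hext
      · exact fun hab ha hu => hh hab (List.mem_append_right _ ha) hu
    | @upd x y hxy =>
      refine ih hK.2.2 hK'.2.2 (.var hxy) fun {a b} hab ha hu => ?_
      by_cases hax : a = x
      · subst hax
        obtain rfl := hR.1 hab hxy
        simpa using ht
      · have hby : b ≠ y := by rintro rfl; exact hax (hR.2 hab hxy)
        rw [Function.update_of_ne hax, Function.update_of_ne hby]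
        exact hh hab ha (by simp [upds, hax, hu])

theorem upds_rel {R : Var → Var → Prop} {K K' : Stack Var} (h : List.Forall₂ (FRel R) K K')
    {y : Var} (hy : y ∈ upds K') : ∃ x ∈ upds K, R x y := by
  induction h with
  | nil => simp [upds] at hy
  | cons hF _ ih =>
    cases hF with
    | app _ => exact ih hy
    | lets _ _ => exact ih hy
    | upd hxy =>
      rcases List.mem_cons.1 hy with rfl | hy
      · exact ⟨_, by simp [upds], hxy⟩
      · obtain ⟨x, hx, h⟩ := ih hy
        exact ⟨x, by simp [upds, hx], h⟩

theorem SRel.upds_iff {R : Var → Var → Prop} {s s' : State Var} (h : SRel R s s') {x y : Var}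
    (hxy : R x y) : x ∈ upds s.stack ↔ y ∈ upds s'.stack := by
  constructor
  · intro hx
    have hs : List.Forall₂ (FRel (flip R)) s'.stack s.stack := by
      refine (List.Forall₂.flip h.stack).imp fun F F' hF => ?_
      cases hF with
      | app h => exact .app h.symm
      | lets h h' => exact .lets h' h
      | upd h => exact .upd h
    obtain ⟨y', hy', h'⟩ := upds_rel hs hx
    rwa [h.pbij.1 hxy h']
  · intro hy
    obtain ⟨x', hx', h'⟩ := upds_rel h.stack hy
    rwa [h.pbij.2 hxy h']

/-- Entering the bodies of related `let rec` expressions. -/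
theorem SRel.enter_letrec {R : Var → Var → Prop} {h h' : Var → Tm Var} {D D' : Defs Var}
    {t t' : Tm Var} {K K' : Stack Var} (H : SRel R ⟨h, .letrec D t, K⟩ ⟨h', .letrec D' t', K'⟩)
    (hD : ∀ x ∈ names D, x ∉ letsNames K) (hD' : ∀ x ∈ names D', x ∉ letsNames K') :
    ∃ R', (∀ a b, R a b → R' a b) ∧ SRel R' ⟨hup h D, t, .lets (names D) :: K⟩
      ⟨hup h' D', t', .lets (names D') :: K'⟩ := by
  obtain ⟨hR, ok, ok', dom, ft, hh, hst⟩ := H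
  cases ft with
  | @letrec _ B _ _ _ _ hn hn' hB hdefs hbody =>
    simp only at dom hh hst
    have hext : ∀ a b, ext R B a b → R a b ∨ B a b := fun a b hab =>
      hab.elim Or.inr fun h => Or.inl h.2.2
    -- The old and the new matching cannot collide: `R` mentions only variables of the stacks, and
    -- the names of `D` and `D'` avoid these.
    refine ⟨fun a b => R a b ∨ B a b, fun a b => Or.inl, ⟨?_, ?_⟩, ⟨hn, hD, ok⟩, ⟨hn', hD', ok'⟩, ?_,
      hbody.mono' hext, ?_, .cons (.lets ?_ ?_) (hst.imp fun F F' hF => hF.mono fun a b => Or.inl)⟩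
    · rintro a b b' (h1 | h1) (h2 | h2)
      · exact hR.1 h1 h2
      · exact absurd (dom h1).1 (hD a (hB.left h2))
      · exact absurd (dom h2).1 (hD a (hB.left h1))
      · exact hB.func h1 h2
    · rintro a b b' (h1 | h1) (h2 | h2)
      · exact hR.2 h1 h2
      · exact absurd (dom h1).2 (hD' _ (hB.right h2))
      · exact absurd (dom h2).2 (hD' _ (hB.right h1))
      · exact hB.inj h1 h2
    · rintro a b (h1 | h1)
      · simp [letsNames, dom h1]
      · simp [letsNames, hB.left h1, hB.right h1]
    · rintro a b (h1 | h1) hu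
      · simp only
        rw [hup_of_not_mem fun h2 => hD a h2 (dom h1).1, hup_of_not_mem fun h2 => hD' b h2 (dom h1).2]
        exact (hh h1 hu).mono' fun _ _ => Or.inl
      · obtain ⟨M, hM⟩ := mem_names.1 (hB.left h1)
        obtain ⟨N, hN⟩ := mem_names.1 (hB.right h1)
        have e1 := hup_of_mem (h := h) hn hM
        have e2 := hup_of_mem (h := h') hn' hN
        simp only at e1 e2 ⊢
        rw [e1, e2]
        exact (hdefs _ hM _ hN h1).mono' hext
    · exact fun a ha => (hB.total a ha).imp fun b hb => ⟨hB.right hb, Or.inr hb⟩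
    · exact fun a ha => (hB.surj a ha).imp fun b hb => ⟨hB.left hb, Or.inr hb⟩

/-- Entering the definitions of related variables. -/
theorem SRel.enter_var {R : Var → Var → Prop} {h h' : Var → Tm Var} {x y : Var} {t : Tm Var}
    {K K' : Stack Var} (H : SRel R ⟨Function.update h x t, .var x, K⟩ ⟨h', .var y, K'⟩)
    (hx : x ∉ upds K) : SRel R ⟨h, t, .upd x :: K⟩ ⟨h', h' y, .upd y :: K'⟩ := by
  have hxy : R x y := by cases H.focus; assumption
  refine ⟨H.pbij, ⟨(H.dom hxy).1, hx, H.ok⟩, ⟨(H.dom hxy).2, fun hy => hx ((H.upds_iff hxy).2 hy), H.ok'⟩,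
    fun hab => H.dom hab, ?_, fun {a b} hab hu => ?_, .cons (.upd hxy) H.stack⟩
  · simpa using H.heap hxy hx
  · simp only [upds, List.mem_cons, not_or] at hu
    have := H.heap hab hu.2
    simpa only [Function.update_of_ne hu.1] using this

theorem unload_enter_letrec {h : Var → Tm Var} {D : Defs Var} (hD : (names D).Nodup) {t : Tm Var}
    {K : Stack Var} (hK : ∀ x ∈ names D, x ∉ letsNames K) :
    unload (hup h D) t (.lets (names D) :: K) = unload h (.letrec D t) K := by
  rw [unload, defsOf_hup hD]
  exact unload_congr fun x hx => hup_of_not_mem fun hn => hK x hn hx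

theorem unload_enter_var {h : Var → Tm Var} {x : Var} {K : Stack Var} :
    unload h (h x) (.upd x :: K) = unload h (.var x) K := by
  rw [unload, Function.update_eq_self]

/-- Every representative, with distinct binding occurrences, of the closed expression of a state
comes from a related state. -/
theorem exists_sRel {h : Var → Tm Var} {t : Tm Var} {K : Stack Var} (hK : StackOK K) {T : Tm Var}
    (hT : T.binders.Nodup) (hc : (unload h t K).fv = ∅) (ha : AEq Eq (unload h t K) T) :
    ∃ (R : Var → Var → Prop) (s' : State Var), SRel R ⟨h, t, K⟩ s' ∧ s'.unload = T := by
  induction K generalizing h t with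
  | nil =>
    -- The whole expression is closed, so the empty matching suffices at the outermost level.
    exact ⟨fun _ _ => False, ⟨h, T, []⟩, ⟨⟨False.elim, False.elim⟩, trivial, trivial, False.elim,
      ha.of_closed hc, False.elim, .nil⟩, rfl⟩
  | cons F K ih =>
    cases F with
    | app N =>
      obtain ⟨R, ⟨h', u, K'⟩, H, rfl⟩ := ih hK hc ha
      have hu : AEq R (.app t N) u := H.focus
      cases hu with
      | @app _ _ t' _ N' h1 h2 =>
        exact ⟨R, ⟨h', t', .app N' :: K'⟩, ⟨H.pbij, H.ok, H.ok', H.dom, h1, H.heap,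
          .cons (.app h2) H.stack⟩, rfl⟩
    | lets xs =>
      obtain ⟨R, ⟨h', u, K'⟩, H, rfl⟩ := ih hK.2.2 hc ha
      have hu : AEq R (.letrec (defsOf h xs) t) u := H.focus
      cases hu with
      | @letrec _ B _ D' _ t' hn hn' hB hdefs hbody =>
        -- Distinctness of the binders of `T` is used here: the new frame must not redefine a
        -- variable of the stack.
        have hD' : ∀ x ∈ names D', x ∉ letsNames K' := fun x hx =>
          (nodup_binders_focus H.ok' hT).2 x (mem_binders_letrec.2 (Or.inl hx))
        obtain ⟨R', -, H'⟩ := H.enter_letrec (by simpa using hK.2.1) hD'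
        rw [hup_defsOf, names_defsOf] at H'
        exact ⟨R', _, H', unload_enter_letrec hn' hD'⟩
    | upd x =>
      obtain ⟨R, ⟨h', u, K'⟩, H, rfl⟩ := ih hK.2.2 hc ha
      have hu : AEq R (.var x) u := H.focus
      cases hu with
      | @var _ _ y hxy =>
        exact ⟨R, _, H.enter_var hK.2.1, unload_enter_var⟩

end States

-- The machine: search for a redex, contraction, determinism.

section Machine

variable {Var : Type u} [DecidableEq Var]

/-- Adds `xs` to the innermost frame that defines `x`. -/
def addTo (x : Var) (xs : List Var) : Stack Var → Stack Var
  | [] => []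
  | .app N :: K => .app N :: addTo x xs K
  | .lets ys :: K => if x ∈ ys then .lets (xs ++ ys) :: K else .lets ys :: addTo x xs K
  | .upd y :: K => .upd y :: addTo x xs K

/-- Steps that move the focus and do not change the represented expression. -/
inductive Focus : State Var → State Var → Prop
  | app (h : Var → Tm Var) (M N : Tm Var) (K : Stack Var) :
      Focus ⟨h, .app M N, K⟩ ⟨h, M, .app N :: K⟩
  | letrec (h : Var → Tm Var) (D : Defs Var) (M : Tm Var) (K : Stack Var) : ¬ IsAnswer M →
      Focus ⟨h, .letrec D M, K⟩ ⟨hup h D, M, .lets (names D) :: K⟩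
  | var (h : Var → Tm Var) (x : Var) (K : Stack Var) : x ∈ letsNames K → x ∉ upds K →
      Focus ⟨h, .var x, K⟩ ⟨h, h x, .upd x :: K⟩

/-- States in which a redex is found, with the expression that results from its contraction. -/
inductive Fire : State Var → Tm Var → Prop
  | beta (h : Var → Tm Var) (x : Var) (M N : Tm Var) (K : Stack Var) : x ∉ letsNames K →
      Fire ⟨h, .lam x M, .app N :: K⟩ (unload h (.letrec [(x, N)] M) K)
  | error_beta (h : Var → Tm Var) (N : Tm Var) (K : Stack Var) :
      Fire ⟨h, .bh, .app N :: K⟩ (unload h .bh K)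
  | lift (h : Var → Tm Var) (D : Defs Var) (A N : Tm Var) (K : Stack Var) : IsAnswer A →
      (∀ x ∈ names D, x ∉ letsNames K) →
      Fire ⟨h, .letrec D A, .app N :: K⟩ (unload h (.letrec D (.app A N)) K)
  | deref (h : Var → Tm Var) (V : Tm Var) (x : Var) (K : Stack Var) : IsValue V →
      Fire ⟨h, V, .upd x :: K⟩ (unload (Function.update h x V) V K)
  | assoc (h : Var → Tm Var) (D : Defs Var) (A : Tm Var) (x : Var) (K : Stack Var) : IsAnswer A →
      (∀ x ∈ names D, x ∉ letsNames K) →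
      Fire ⟨h, .letrec D A, .upd x :: K⟩ (unload (hup h D) A (.upd x :: addTo x (names D) K))
  | error (h : Var → Tm Var) (x : Var) (K : Stack Var) : x ∈ upds K →
      Fire ⟨h, .var x, K⟩ (unload h .bh K)

theorem Focus.det {s t t' : State Var} (h : Focus s t) (h' : Focus s t') : t = t' := by
  cases h <;> cases h' <;> rfl

/-- The side conditions separate the two kinds of step: a `let rec` that is an answer is not
entered, and a variable is entered only while it is not under evaluation. -/
theorem Fire.not_focus {s t : State Var} {r : Tm Var} (h : Fire s r) (h' : Focus s t) : False := by
  cases h with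
  | beta => cases h'
  | error_beta => cases h'
  | lift _ _ _ _ _ hA _ => cases h'; contradiction
  | deref _ _ _ _ hV =>
    cases h' with
    | app => cases hV
    | letrec => cases hV
    | var => cases hV
  | assoc _ _ _ _ _ hA _ => cases h'; contradiction
  | error => cases h'; contradiction

@[simp] theorem upds_addTo (x : Var) (xs : List Var) (K : Stack Var) :
    upds (addTo x xs K) = upds K := by
  induction K with
  | nil => rfl
  | cons F K ih =>
    cases F with
    | app N => simpa [addTo, upds] using ih
    | lets ys =>
      rw [addTo]
      split_ifs
      · rfl
      · simpa [upds] using ih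
    | upd y => simpa [addTo, upds] using ih

theorem mem_letsNames_addTo {x : Var} {xs : List Var} {K : Stack Var} {a : Var} :
    a ∈ letsNames (addTo x xs K) ↔ a ∈ letsNames K ∨ (a ∈ xs ∧ x ∈ letsNames K) := by
  induction K with
  | nil => simp [addTo, letsNames]
  | cons F K ih =>
    cases F with
    | app N => simpa [addTo, letsNames] using ih
    | lets ys =>
      rw [addTo]
      split_ifs with h
      · simp only [letsNames, List.mem_append, h, true_or, and_true]; tauto
      · simp only [letsNames, List.mem_append, h, false_or, ih]; tauto
    | upd y => simpa [addTo, letsNames] using ih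

theorem StackOK.addTo {x : Var} {xs : List Var} {K : Stack Var} (hK : StackOK K) (hxs : xs.Nodup)
    (hd : ∀ y ∈ xs, y ∉ letsNames K) : StackOK (addTo x xs K) := by
  induction K with
  | nil => trivial
  | cons F K ih =>
    cases F with
    | app N => exact ih hK hd
    | lets ys =>
      simp only [letsNames, List.mem_append, not_or] at hd
      rw [Letrec.addTo]
      split_ifs with h
      · refine ⟨hxs.append hK.1 fun a ha h' => (hd a ha).1 h', fun a ha => ?_, hK.2.2⟩
        rcases List.mem_append.1 ha with ha | ha
        · exact (hd a ha).2
        · exact hK.2.1 a ha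
      · refine ⟨hK.1, fun a ha h' => ?_, ih hK.2.2 fun y hy => (hd y hy).2⟩
        rcases mem_letsNames_addTo.1 h' with h' | h'
        · exact hK.2.1 a ha h'
        · exact (hd a h'.1).1 ha
    | upd y =>
      exact ⟨mem_letsNames_addTo.2 (Or.inl hK.1), by simpa using hK.2.1, ih hK.2.2 hd⟩

theorem forall₂_addTo {R S : Var → Var → Prop} (hR : PBij R) {x y : Var} (hxy : R x y)
    {xs ys : List Var} (hRS : ∀ a b, R a b → S a b) (h1 : ∀ a ∈ xs, ∃ b ∈ ys, S a b)
    (h2 : ∀ b ∈ ys, ∃ a ∈ xs, S a b) {K K' : Stack Var} (hK : List.Forall₂ (FRel R) K K') :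
    List.Forall₂ (FRel S) (addTo x xs K) (addTo y ys K') := by
  induction hK with
  | nil => exact .nil
  | cons hF hK ih =>
    cases hF with
    | app hN => exact .cons (.app (hN.mono' hRS)) ih
    | @lets zs ws h3 h4 =>
      have hiff : x ∈ zs ↔ y ∈ ws := by
        constructor
        · intro h
          obtain ⟨b, hb, hxb⟩ := h3 x h
          rwa [hR.1 hxy hxb]
        · intro h
          obtain ⟨a, ha, hay⟩ := h4 y h
          rwa [hR.2 hxy hay]
      simp only [addTo, hiff]
      have h3' : ∀ a ∈ zs, ∃ b ∈ ws, S a b := fun a ha =>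
        (h3 a ha).imp fun b hb => ⟨hb.1, hRS _ _ hb.2⟩
      have h4' : ∀ b ∈ ws, ∃ a ∈ zs, S a b := fun a ha =>
        (h4 a ha).imp fun b hb => ⟨hb.1, hRS _ _ hb.2⟩
      split_ifs with h
      · refine .cons (.lets ?_ ?_) (hK.imp fun F F' hF => hF.mono hRS)
        · intro a ha
          rcases List.mem_append.1 ha with ha | ha
          · obtain ⟨b, hb, h⟩ := h1 a ha; exact ⟨b, by simp [hb], h⟩
          · obtain ⟨b, hb, h⟩ := h3' a ha; exact ⟨b, by simp [hb], h⟩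
        · intro a ha
          rcases List.mem_append.1 ha with ha | ha
          · obtain ⟨b, hb, h⟩ := h2 a ha; exact ⟨b, by simp [hb], h⟩
          · obtain ⟨b, hb, h⟩ := h4' a ha; exact ⟨b, by simp [hb], h⟩
      · exact .cons (.lets h3' h4') ih
    | upd h => exact .cons (.upd (hRS _ _ h)) ih

/-- Contraction respects `α`-equivalence. -/
theorem Fire.rel {R : Var → Var → Prop} {s s' : State Var} {r r' : Tm Var} (H : SRel R s s')
    (hf : Fire s r) (hf' : Fire s' r') : ∃ R', AEq R' r r' := by
  obtain ⟨h₁, t₁, K₁⟩ := s'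
  obtain ⟨hR, ok, ok', dom, ft, hh, hst⟩ := H
  simp only at ok ok' dom ft hh hst
  cases hf with
  | beta h x M N K hx =>
    cases ft with
    | @lam _ _ y _ M' hM =>
    cases hst with
    | cons hF hst =>
    cases hF with
    | @app _ N' hN =>
    cases hf' with
    | beta h' _ _ _ K' hy =>
      refine ⟨R, aeq_unload hR ok ok' hst (.letrec (B := pair x y) (by simp) (by simp)
        (isBij_pair x y) ?_ hM) fun hab _ hu => hh hab hu⟩
      intro b hb b' hb' _
      simp only [List.mem_singleton] at hb hb'
      subst hb hb'
      -- The argument moves into the scope of the new binder. Nothing in it is captured, since `R`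
      -- matches only variables of the stacks.
      refine hN.mono' fun a b hab => ext_pair.2 (Or.inr ⟨?_, ?_, hab⟩)
      · rintro rfl; exact hx (dom hab).1
      · rintro rfl; exact hy (dom hab).2
  | error_beta h N K =>
    cases ft with
    | bh =>
    cases hst with
    | cons hF hst =>
    cases hF with
    | app hN =>
    cases hf' with
    | error_beta => exact ⟨R, aeq_unload hR ok ok' hst .bh fun hab _ hu => hh hab hu⟩
  | lift h D A N K hA hD =>
    cases ft with
    | @letrec _ B _ D' _ A' hn hn' hB hdefs hbody =>
    cases hst with
    | cons hF hst =>
    cases hF with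
    | app hN =>
    cases hf' with
    | lift h' _ _ N' K' hA' hD' =>
      refine ⟨R, aeq_unload hR ok ok' hst (.letrec hn hn' hB hdefs (.app hbody
        (hN.mono' fun a b hab => Or.inr ⟨?_, ?_, hab⟩))) fun hab _ hu => hh hab hu⟩
      · exact hB.not_left.2 fun ha => hD a ha (dom hab).1
      · exact hB.not_right.2 fun ha => hD' b ha (dom hab).2
  | deref h V x K hV =>
    cases hst with
    | cons hF hst =>
    cases hF with
    | @upd _ y hxy =>
    have key : ∀ {a b}, R a b → a ∈ letsNames K → a ∉ upds K →
        AEq R (Function.update h x V a) (Function.update h₁ y t₁ b) := by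
      intro a b hab _ hu
      by_cases hax : a = x
      · subst hax
        obtain rfl := hR.1 hab hxy
        simpa using ft
      · have hby : b ≠ y := by rintro rfl; exact hax (hR.2 hab hxy)
        rw [Function.update_of_ne hax, Function.update_of_ne hby]
        exact hh hab (by simp [upds, hax, hu])
    cases hf' with
    | deref => exact ⟨R, aeq_unload hR ok.2.2 ok'.2.2 hst ft key⟩
    | assoc => cases ft; cases hV
    | error h' z _ hz => cases ft; cases hV
  | assoc h D A x K hA hD =>
    have ft' := ft
    cases ft with
    | @letrec _ B _ D' _ A' hn hn' hB hdefs hbody =>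
    cases hst with
    | @cons _ _ _ K' hF hst =>
    cases hF with
    | @upd _ y hxy =>
    cases hf' with
    | deref _ _ _ _ hV => cases hV
    | assoc _ _ _ _ _ hA' hD' =>
      -- Entering the bodies extends the matching to the definitions of `D`. The resulting states
      -- have the right heaps and focuses; only the stacks differ, because the new variables have to
      -- join the frame of `x` instead of forming a frame of their own.
      obtain ⟨R', hRR', H'⟩ := SRel.enter_letrec
        (K := .upd x :: K) (K' := .upd y :: K')
        ⟨hR, ok, ok', dom, ft', hh, .cons (.upd hxy) hst⟩ hD hD'
      have hl := H'.stack
      simp only at hl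
      cases hl with
      | cons hF _ =>
      cases hF with
      | lets h1 h2 =>
      refine ⟨R', aeq_unload H'.pbij ?_ ?_ (.cons (.upd (hRR' _ _ hxy))
        (forall₂_addTo hR hxy hRR' h1 h2 hst)) H'.focus
        fun {a b} hab _ hu => H'.heap hab (by simpa [upds] using hu)⟩
      · exact ⟨mem_letsNames_addTo.2 (Or.inl ok.1), by simpa using ok.2.1, ok.2.2.addTo hn hD⟩
      · exact ⟨mem_letsNames_addTo.2 (Or.inl ok'.1), by simpa using ok'.2.1, ok'.2.2.addTo hn' hD'⟩
  | error h x K hx =>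
    cases ft with
    | @var _ _ y hxy =>
    cases hf' with
    | deref _ _ _ _ hV => cases hV
    | error => exact ⟨R, aeq_unload hR ok ok' hst .bh fun hab _ hu => hh hab hu⟩

theorem AEq.isValue {R : Var → Var → Prop} {M N : Tm Var} (h : AEq R M N) (hM : IsValue M) :
    IsValue N := by
  cases hM with
  | lam => cases h; exact .lam _ _
  | bh => cases h; exact .bh

/-- Firing depends on shapes, which `AEq` preserves, and on hygiene, which is assumed for `s'`. -/
theorem Fire.transport {R : Var → Var → Prop} {s s' : State Var} {r : Tm Var} (H : SRel R s s')
    (hf : Fire s r) (hb : ∀ x ∈ s'.focus.binders, x ∉ letsNames s'.stack) :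
    ∃ r', Fire s' r' := by
  obtain ⟨h', t', K'⟩ := s'
  have ft := H.focus
  have hst := H.stack
  cases hf with
  | beta h x M N K hx =>
    cases ft with
    | lam hM =>
    cases hst with
    | cons hF hst =>
    cases hF with
    | app hN => exact ⟨_, .beta _ _ _ _ _ (hb _ (by simp [Tm.binders]))⟩
  | error_beta h N K =>
    cases ft with
    | bh =>
    cases hst with
    | cons hF hst =>
    cases hF with
    | app hN => exact ⟨_, .error_beta _ _ _⟩
  | lift h D A N K hA hD =>
    cases ft with
    | letrec hn hn' hB hdefs hbody =>
    cases hst with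
    | cons hF hst =>
    cases hF with
    | app hN =>
      exact ⟨_, .lift _ _ _ _ _ (hbody.isAnswer hA)
        fun x hx => hb x (mem_binders_letrec.2 (Or.inl hx))⟩
  | deref h V x K hV =>
    cases hst with
    | cons hF hst =>
    cases hF with
    | upd hxy => exact ⟨_, .deref _ _ _ _ (ft.isValue hV)⟩
  | assoc h D A x K hA hD =>
    cases ft with
    | letrec hn hn' hB hdefs hbody =>
    cases hst with
    | cons hF hst =>
    cases hF with
    | upd hxy =>
      exact ⟨_, .assoc _ _ _ _ _ (hbody.isAnswer hA)
        fun x hx => hb x (mem_binders_letrec.2 (Or.inl hx))⟩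
  | error h x K hx =>
    cases ft with
    | var hxy => exact ⟨_, .error _ _ _ ((H.upds_iff hxy).1 hx)⟩

/-- States that represent an expression with distinct binding occurrences. -/
def State.Canonical (s : State Var) : Prop := StackOK s.stack ∧ s.unload.binders.Nodup

theorem State.Canonical.focus {s : State Var} (h : s.Canonical) :
    s.focus.binders.Nodup ∧ ∀ x ∈ s.focus.binders, x ∉ letsNames s.stack :=
  nodup_binders_focus h.1 h.2

theorem nodup_names_of_binders {D : Defs Var} {M : Tm Var} (h : (Tm.letrec D M).binders.Nodup) :
    (names D).Nodup :=
  (Tm.WF.letrec_iff.1 (wf_of_nodup_binders h)).1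

theorem Focus.unload {s t : State Var} (h : Focus s t) (hs : s.Canonical) :
    t.unload = s.unload := by
  have hf := hs.focus
  cases h with
  | app => rfl
  | letrec h D M K =>
    exact unload_enter_letrec (nodup_names_of_binders hf.1)
      fun x hx => hf.2 x (mem_binders_letrec.2 (Or.inl hx))
  | var => exact unload_enter_var

theorem Focus.canonical {s t : State Var} (h : Focus s t) (hs : s.Canonical) : t.Canonical := by
  refine ⟨?_, (h.unload hs).symm ▸ hs.2⟩
  have hf := hs.focus
  have hok := hs.1
  cases h with
  | app => exact hok
  | letrec h D M K =>
    exact ⟨nodup_names_of_binders hf.1, fun x hx => hf.2 x (mem_binders_letrec.2 (Or.inl hx)), hok⟩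
  | var h x K hx hu => exact ⟨hx, hu, hok⟩

theorem Focus.canonical_star {s t : State Var} (h : Relation.ReflTransGen Focus s t)
    (hs : s.Canonical) : t.Canonical ∧ t.unload = s.unload := by
  induction h with
  | refl => exact ⟨hs, rfl⟩
  | tail _ h ih => exact ⟨h.canonical ih.1, (h.unload ih.1).trans ih.2⟩

/-- Related states move in lockstep. -/
theorem Focus.lockstep {R : Var → Var → Prop} {s s' t : State Var} (H : SRel R s s')
    (h : Focus s t) (hs : s.Canonical) (hs' : s'.Canonical) :
    ∃ R' t', Focus s' t' ∧ SRel R' t t' := by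
  obtain ⟨h', u, K'⟩ := s'
  have ft := H.focus
  cases h with
  | app h M N K =>
    cases ft with
    | app hM hN =>
      exact ⟨R, _, .app _ _ _ _, ⟨H.pbij, H.ok, H.ok', H.dom, hM, H.heap, .cons (.app hN) H.stack⟩⟩
  | letrec h D M K hA =>
    cases ft with
    | letrec hn hn' hB hdefs hbody =>
      obtain ⟨R', -, H'⟩ := H.enter_letrec
        (fun x hx => hs.focus.2 x (mem_binders_letrec.2 (Or.inl hx)))
        (fun x hx => hs'.focus.2 x (mem_binders_letrec.2 (Or.inl hx)))
      exact ⟨R', _, .letrec _ _ _ _ fun h => hA (hbody.symm.isAnswer h), H'⟩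
  | var h x K hx hu =>
    cases ft with
    | @var _ _ y hxy =>
      refine ⟨R, _, .var _ _ _ (H.dom hxy).2 (mt (H.upds_iff hxy).2 hu), ?_⟩
      exact SRel.enter_var (by rwa [Function.update_eq_self]) hu

theorem Focus.lockstep_star {R : Var → Var → Prop} {s s' t : State Var} (H : SRel R s s')
    (h : Relation.ReflTransGen Focus s t) (hs : s.Canonical) (hs' : s'.Canonical) :
    ∃ R' t', Relation.ReflTransGen Focus s' t' ∧ SRel R' t t' := by
  induction h with
  | refl => exact ⟨R, s', .refl, H⟩
  | tail h1 h2 ih =>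
    obtain ⟨R', t', h3, H'⟩ := ih
    obtain ⟨R'', t'', h4, H''⟩ := h2.lockstep H' (Focus.canonical_star h1 hs).1
      (Focus.canonical_star h3 hs').1
    exact ⟨R'', t'', h3.tail h4, H''⟩

/-- Of two runs of a deterministic machine one is a prefix of the other, and a state that fires
cannot move on. -/
theorem Focus.star_det {s t t' : State Var} {r r' : Tm Var} (h : Relation.ReflTransGen Focus s t)
    (h' : Relation.ReflTransGen Focus s t') (hr : Fire t r) (hr' : Fire t' r') : t = t' := by
  induction h using Relation.ReflTransGen.head_induction_on with
  | refl =>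
    rcases h'.cases_head with h | ⟨c, hc, -⟩
    · exact h
    · exact (hr.not_focus hc).elim
  | head hc _ ih =>
    rcases h'.cases_head with rfl | ⟨c', hc', h'⟩
    · exact (hr'.not_focus hc).elim
    · obtain rfl := hc.det hc'
      exact ih h'

/-- The initial state of an expression. -/
def load (T : Tm Var) : State Var := ⟨fun _ => .bh, T, []⟩

theorem load_canonical {T : Tm Var} (h : T.binders.Nodup) : (load T).Canonical := ⟨trivial, h⟩

/-- The first contraction is determined up to `α`-equivalence. -/
theorem fire_unique {T T' : Tm Var} {s s' : State Var} {r r' : Tm Var} (hT : T.binders.Nodup)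
    (hT' : T'.binders.Nodup) (hc : T.fv = ∅) (ha : AEq Eq T T')
    (h : Relation.ReflTransGen Focus (load T) s) (h' : Relation.ReflTransGen Focus (load T') s')
    (hr : Fire s r) (hr' : Fire s' r') : ∃ R, AEq R r r' := by
  have H : SRel (fun _ _ => False) (load T) (load T') :=
    ⟨⟨False.elim, False.elim⟩, trivial, trivial, False.elim, ha.of_closed hc, False.elim, .nil⟩
  -- `T'` imitates the run of `T` and ends in a state that fires as well; by determinism this state
  -- is `s'`.
  obtain ⟨R, t, ht, H'⟩ := Focus.lockstep_star H h (load_canonical hT) (load_canonical hT')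
  obtain ⟨r₁, hr₁⟩ := hr.transport H' (Focus.canonical_star ht (load_canonical hT')).1.focus.2
  obtain rfl := Focus.star_det ht h' hr₁ hr'
  exact hr.rel H' hr'

end Machine

-- The machine follows evaluation contexts.

section Traversal

variable {Var : Type u} [DecidableEq Var]

/-- The binding occurrences inside the right-hand sides of `D`. -/
def inner (D : Defs Var) : List Var := D.flatMap fun b => b.2.binders

@[simp] theorem inner_nil : inner ([] : Defs Var) = [] := rfl

@[simp] theorem inner_cons (b : Var × Tm Var) (D : Defs Var) :
    inner (b :: D) = b.2.binders ++ inner D := by simp [inner]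

@[simp] theorem inner_append (D D' : Defs Var) : inner (D ++ D') = inner D ++ inner D' := by
  simp [inner]

theorem bindersDefs_perm_inner (D : Defs Var) : (bindersDefs D).Perm (names D ++ inner D) := by
  rw [bindersDefs_eq]
  induction D with
  | nil => simp
  | cons b D ih =>
    simp only [List.flatMap_cons, names_cons, inner_cons, List.cons_append]
    refine List.Perm.cons _ ((ih.append_left _).trans ?_)
    rw [← List.append_assoc, ← List.append_assoc]
    exact List.perm_append_comm.append_right _

theorem binders_letrec_perm (D : Defs Var) (M : Tm Var) :
    (Tm.letrec D M).binders.Perm (names D ++ (inner D ++ M.binders)) := by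
  rw [← List.append_assoc]
  exact (bindersDefs_perm_inner D).append_right _

theorem not_isAnswer_var {x : Var} : ¬ IsAnswer (.var x) := by
  intro h; cases h with | value h => cases h

/-- An answer has no application and no variable in evaluation position, so a context inside one
consists of `letBody` layers only. Hence answers are irreducible, and the machine may enter every
`let rec` on its way to a redex. -/
theorem isAnswer_of_fill : ∀ (E : Ctx Var) {s : Tm Var}, IsAnswer (E.fill s) → IsAnswer s
  | .hole, _, h => h
  | .app E N, _, h => by
    rw [Ctx.fill] at h
    cases h with | value h => cases h
  | .letBody D E, _, h => by
    rw [Ctx.fill] at h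
    cases h with
    | value h => cases h
    | letrec _ h => exact isAnswer_of_fill E h
  | .letDef x E D E', _, h => by
    rw [Ctx.fill] at h
    cases h with
    | value h => cases h
    | letrec _ h => exact absurd (isAnswer_of_fill E' h) not_isAnswer_var
  | .letDep x E Δ D E', _, h => by
    rw [Ctx.fill] at h
    cases h with
    | value h => cases h
    | letrec _ h => exact absurd (isAnswer_of_fill E' h) not_isAnswer_var

/-- The variables defined by a dependency. -/
def Deps.vars : Deps Var → List Var
  | .single x _ => [x]
  | .snoc Δ x _ => Δ.vars ++ [x]

theorem Deps.names_fill (Δ : Deps Var) (s : Tm Var) : names (Δ.fill s) = Δ.vars := by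
  cases Δ with
  | single x E => simp [Deps.fill, Deps.vars]
  | snoc Δ x E => simp [Deps.fill, Deps.vars, Deps.names_fill Δ]

theorem Deps.start_mem_vars (Δ : Deps Var) : Δ.start ∈ Δ.vars := by
  cases Δ with
  | single x E => simp [Deps.start, Deps.vars]
  | snoc Δ x E => simp [Deps.start, Deps.vars, Deps.start_mem_vars Δ]

/-- Ways in which the body of a `let rec` demands an expression: immediately, or through a
dependency. -/
inductive Path (Var : Type u) : Type u
  | body (E : Ctx Var) : Path Var
  | dep (Δ : Deps Var) (E : Ctx Var) : Path Var

/-- The definitions in a path. -/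
def Path.defs : Path Var → Tm Var → Defs Var
  | .body _, _ => []
  | .dep Δ _, s => Δ.fill s

/-- The body of a path. -/
def Path.fill : Path Var → Tm Var → Tm Var
  | .body E, s => E.fill s
  | .dep Δ E, _ => E.fill (.var Δ.start)

/-- The variables defined in a path. -/
def Path.vars : Path Var → List Var
  | .body _ => []
  | .dep Δ _ => Δ.vars

theorem Path.names_defs (P : Path Var) (s : Tm Var) : names (P.defs s) = P.vars := by
  cases P with
  | body E => rfl
  | dep Δ E => exact Δ.names_fill s

theorem Path.not_isAnswer_fill (P : Path Var) {s : Tm Var} (h : ¬ IsAnswer s) :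
    ¬ IsAnswer (P.fill s) := by
  cases P with
  | body E => exact fun h' => h (isAnswer_of_fill E h')
  | dep Δ E => exact fun h' => not_isAnswer_var (isAnswer_of_fill E h')

/-- Starting from `body s`, in a heap that contains `defs s`, the machine reaches `s`; it then has
added `De` to the heap and `Ke` to the stack. -/
structure Runs (vars inn : List Var) (defs : Tm Var → Defs Var) (body : Tm Var → Tm Var)
    (s : Tm Var) (De : Defs Var) (Ke : Stack Var) : Prop where
  names_mem : ∀ x ∈ names De, x ∈ inn
  lets_mem : ∀ x ∈ letsNames Ke, x ∈ inn
  upds_mem : ∀ x ∈ upds Ke, x ∈ letsNames Ke ∨ x ∈ vars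
  vars_mem : ∀ x ∈ vars, x ∈ upds Ke
  run : ∀ (h : Var → Tm Var) (K : Stack Var), (∀ b ∈ defs s, h b.1 = b.2) →
    (∀ x ∈ vars, x ∈ letsNames K ∧ x ∉ upds K) → (∀ x ∈ inn, x ∉ letsNames K) →
    (∀ x ∈ upds K, x ∈ letsNames K) →
    Relation.ReflTransGen Focus ⟨h, body s, K⟩ ⟨hup h De, s, Ke ++ K⟩
  unload : ∀ (g : Var → Tm Var) (s' : Tm Var) (K : Stack Var),
    (∀ x ∈ names De, x ∉ letsNames K) →
    Letrec.unload (hup g De) s' (Ke ++ K) = Letrec.unload (hup g (defs s')) (body s') K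

theorem Runs.hole (s : Tm Var) : Runs [] [] (fun _ => []) (fun t => t) s [] [] where
  names_mem := by simp
  lets_mem := by simp [letsNames]
  upds_mem := by simp [upds]
  vars_mem := by simp
  run _ _ _ _ _ _ := .refl
  unload _ _ _ _ := rfl

theorem Runs.mono {vars inn inn' : List Var} {defs : Tm Var → Defs Var} {body : Tm Var → Tm Var}
    {s : Tm Var} {De : Defs Var} {Ke : Stack Var} (H : Runs vars inn defs body s De Ke)
    (hi : ∀ x ∈ inn, x ∈ inn') : Runs vars inn' defs body s De Ke :=
  { H with
    names_mem := fun x hx => hi x (H.names_mem x hx)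
    lets_mem := fun x hx => hi x (H.lets_mem x hx)
    run := fun h K h1 h2 h3 h4 => H.run h K h1 h2 (fun x hx => h3 x (hi x hx)) h4 }

theorem Runs.app {inn : List Var} {body : Tm Var → Tm Var} {s : Tm Var} {De : Defs Var}
    {Ke : Stack Var} (H : Runs [] inn (fun _ => []) body s De Ke) (N : Tm Var) :
    Runs [] inn (fun _ => []) (fun t => .app (body t) N) s De (Ke ++ [.app N]) where
  names_mem := H.names_mem
  lets_mem := by simpa [letsNames] using H.lets_mem
  upds_mem := by simpa [letsNames, upds] using H.upds_mem
  vars_mem := by simp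
  run h K h1 h2 h3 h4 := by
    refine .head (.app _ _ _ _) ?_
    rw [List.append_assoc]
    exact H.run h (.app N :: K) h1 h2 h3 h4
  unload g s' K hK := by
    rw [List.append_assoc]
    exact H.unload g s' (.app N :: K) hK

/-- Continue inside the definition of a variable that is reached. -/
theorem Runs.extend {vars i₁ i₂ : List Var} {defs : Tm Var → Defs Var}
    {body E : Tm Var → Tm Var} {x : Var} {s : Tm Var} {D₁ D₂ : Defs Var} {K₁ K₂ : Stack Var}
    (H₁ : Runs vars i₁ defs body (.var x) D₁ K₁) (H₂ : Runs [] i₂ (fun _ => []) E s D₂ K₂)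
    (hxv : x ∉ vars) (hx : x ∉ i₁) (hd : ∀ y ∈ i₁, y ∉ i₂) :
    Runs (vars ++ [x]) (i₁ ++ i₂) (fun t => defs (.var x) ++ [(x, E t)]) (fun _ => body (.var x)) s
      (D₂ ++ D₁) (K₂ ++ .upd x :: K₁) where
  names_mem := by
    intro y hy
    rw [names_append, List.mem_append] at hy
    rw [List.mem_append]
    exact hy.elim (fun h => Or.inr (H₂.names_mem y h)) fun h => Or.inl (H₁.names_mem y h)
  lets_mem := by
    intro y hy
    simp only [letsNames_append, letsNames, List.mem_append] at hy ⊢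
    exact hy.elim (fun h => Or.inr (H₂.lets_mem y h)) fun h => Or.inl (H₁.lets_mem y h)
  upds_mem := by
    intro y hy
    simp only [upds_append, upds, letsNames_append, letsNames, List.mem_append, List.mem_cons,
      List.not_mem_nil, or_false] at hy ⊢
    rcases hy with h | h | h
    · rcases H₂.upds_mem y h with h | h
      · tauto
      · simp at h
    · tauto
    · rcases H₁.upds_mem y h with h | h <;> tauto
  vars_mem := by
    intro y hy
    simp only [upds_append, upds, List.mem_append, List.mem_cons, List.not_mem_nil, or_false]
      at hy ⊢
    rcases hy with h | h
    · exact Or.inr (Or.inr (H₁.vars_mem y h))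
    · tauto
  run h K h1 h2 h3 h4 := by
    simp only [List.mem_append, List.mem_singleton] at h1 h2 h3
    have r1 := H₁.run h K (fun b hb => h1 b (Or.inl hb)) (fun y hy => h2 y (Or.inl hy))
      (fun y hy => h3 y (Or.inl hy)) h4
    refine r1.trans (.head (.var _ _ _ ?_ ?_) ?_)
    · simp [(h2 x (Or.inr rfl)).1]
    · simp only [upds_append, List.mem_append, not_or]
      refine ⟨fun h => ?_, (h2 x (Or.inr rfl)).2⟩
      rcases H₁.upds_mem x h with h | h
      · exact hx (H₁.lets_mem x h)
      · exact hxv h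
    · have e : hup h D₁ x = E s := by
        rw [hup_of_not_mem fun h => hx (H₁.names_mem x h)]
        exact h1 (x, E s) (Or.inr rfl)
      rw [e, hup_append, List.append_assoc]
      refine H₂.run (hup h D₁) (.upd x :: (K₁ ++ K)) (by simp) (by simp) ?_ ?_
      · intro y hy
        simp only [letsNames, letsNames_append, List.mem_append, not_or]
        exact ⟨fun h => hd y (H₁.lets_mem y h) hy, h3 y (Or.inr hy)⟩
      · intro y hy
        simp only [letsNames, letsNames_append, upds, upds_append, List.mem_append,
          List.mem_cons] at hy ⊢
        rcases hy with rfl | h | h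
        · exact Or.inr (h2 _ (Or.inr rfl)).1
        · rcases H₁.upds_mem y h with h | h
          · exact Or.inl h
          · exact Or.inr (h2 y (Or.inl h)).1
        · exact Or.inr (h4 y h)
  unload g s' K hK := by
    simp only [names_append, List.mem_append] at hK
    rw [List.append_assoc, hup_append, H₂.unload, hup_nil, List.cons_append, Letrec.unload,
      ← hup_update_comm fun h => hx (H₁.names_mem x h), H₁.unload, hup_append]
    · rfl
    · exact fun y hy => hK y (Or.inr hy)
    · intro y hy
      simp only [letsNames, List.cons_append, letsNames_append, List.mem_append, not_or]
      exact ⟨fun h => hd y (H₁.lets_mem y h) (H₂.names_mem y hy), hK y (Or.inl hy)⟩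

theorem hup_comm {h : Var → Tm Var} {D D' : Defs Var} (hd : ∀ x ∈ names D, x ∉ names D') :
    hup (hup h D) D' = hup (hup h D') D := by
  funext y
  by_cases hy : y ∈ names D
  · rw [hup_of_not_mem (hd y hy)]
    exact hup_congr fun h => absurd hy h
  · rw [hup_of_not_mem (D := D) hy]
    exact hup_congr fun _ => hup_of_not_mem hy

/-- Put a context around the variable from which a dependency starts. -/
theorem Runs.comp {vars i₁ i₂ : List Var} {defs : Tm Var → Defs Var} {E : Tm Var → Tm Var}
    {u s : Tm Var} {D₁ D₂ : Defs Var} {K₁ K₂ : Stack Var}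
    (H₁ : Runs vars i₁ defs (fun _ => u) s D₁ K₁) (H₂ : Runs [] i₂ (fun _ => []) E u D₂ K₂)
    (hn : ∀ t, names (defs t) = vars) (hv : ∀ y ∈ vars, y ∉ i₂) (hd : ∀ y ∈ i₁, y ∉ i₂) :
    Runs vars (i₁ ++ i₂) defs (fun _ => E u) s (D₁ ++ D₂) (K₁ ++ K₂) where
  names_mem := by
    intro y hy
    rw [names_append, List.mem_append] at hy
    rw [List.mem_append]
    exact hy.imp (H₁.names_mem y) (H₂.names_mem y)
  lets_mem := by
    intro y hy
    simp only [letsNames_append, List.mem_append] at hy ⊢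
    exact hy.imp (H₁.lets_mem y) (H₂.lets_mem y)
  upds_mem := by
    intro y hy
    simp only [upds_append, letsNames_append, List.mem_append] at hy ⊢
    rcases hy with h | h
    · rcases H₁.upds_mem y h with h | h <;> tauto
    · rcases H₂.upds_mem y h with h | h
      · tauto
      · simp at h
  vars_mem := fun y hy => by simp [H₁.vars_mem y hy]
  run h K h1 h2 h3 h4 := by
    simp only [List.mem_append] at h3
    have r2 := H₂.run h K (by simp) (by simp) (fun y hy => h3 y (Or.inr hy)) h4
    refine r2.trans ?_
    rw [hup_append, List.append_assoc]
    refine H₁.run _ _ ?_ ?_ ?_ ?_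
    · intro b hb
      rw [← h1 b hb]
      refine hup_of_not_mem fun h => hv b.1 ?_ (H₂.names_mem _ h)
      rw [← hn s]
      exact mem_names_of_mem hb
    · intro y hy
      simp only [letsNames_append, upds_append, List.mem_append, not_or]
      refine ⟨Or.inr (h2 y hy).1, fun h => ?_, (h2 y hy).2⟩
      rcases H₂.upds_mem y h with h | h
      · exact hv y hy (H₂.lets_mem y h)
      · simp at h
    · intro y hy
      simp only [letsNames_append, List.mem_append, not_or]
      exact ⟨fun h => hd y hy (H₂.lets_mem y h), h3 y (Or.inl hy)⟩
    · intro y hy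
      simp only [letsNames_append, upds_append, List.mem_append] at hy ⊢
      rcases hy with h | h
      · rcases H₂.upds_mem y h with h | h
        · exact Or.inl h
        · simp at h
      · exact Or.inr (h4 y h)
  unload g s' K hK := by
    simp only [names_append, List.mem_append] at hK
    rw [List.append_assoc, hup_append, H₁.unload, hup_comm, H₂.unload, hup_nil]
    · exact fun y hy => hK y (Or.inr hy)
    · intro y hy h
      exact hv y (hn s' ▸ h) (H₂.names_mem y hy)
    · intro y hy
      simp only [letsNames_append, List.mem_append, not_or]
      exact ⟨fun h => hd y (H₁.names_mem y hy) (H₂.lets_mem y h), hK y (Or.inl hy)⟩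

theorem names_perm {D D' : Defs Var} (h : D.Perm D') : (names D).Perm (names D') := h.map _

/-- Unloading with a changed focus starts from a heap that holds the old right-hand sides `A` of a
path and overwrites them with the new ones `B` through `upd` frames. The result is the heap of the
changed `let rec`, as the remaining definitions `D` are the same. -/
theorem hup_overwrite {g : Var → Tm Var} {D D₁ D₂ A B : Defs Var} (h₁ : D₁.Perm (A ++ D))
    (h₂ : D₂.Perm (B ++ D)) (hn : (names D₁).Nodup) (hAB : names A = names B) :
    hup (hup g D₁) B = hup g D₂ := by
  have hp₁ : (names D₁).Perm (names A ++ names D) := names_append A D ▸ names_perm h₁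
  have hp₂ : (names D₂).Perm (names B ++ names D) := names_append B D ▸ names_perm h₂
  have hn₂ : (names D₂).Nodup := by
    rw [hp₂.nodup_iff, ← hAB, ← hp₁.nodup_iff]; exact hn
  have hnB : (names B).Nodup := (hp₂.nodup_iff.1 hn₂).of_append_left
  funext y
  by_cases hy : y ∈ names D₂
  · obtain ⟨M, hM⟩ := mem_names.1 hy
    have e := hup_of_mem (h := g) hn₂ hM
    simp only at e
    rw [e]
    rcases List.mem_append.1 (h₂.mem_iff.1 hM) with hB | hD
    · exact hup_of_mem (b := (y, M)) hnB hB
    · have : y ∉ names B := fun h =>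
        (List.nodup_append'.1 (hp₂.nodup_iff.1 hn₂)).2.2 h (mem_names_of_mem hD)
      rw [hup_of_not_mem this]
      exact hup_of_mem (b := (y, M)) hn (h₁.mem_iff.2 (List.mem_append_right _ hD))
  · have hy' : y ∉ names B ∧ y ∉ names D := by
      rw [hp₂.mem_iff, List.mem_append, not_or] at hy; exact hy
    rw [hup_of_not_mem hy, hup_of_not_mem hy'.1, hup_of_not_mem]
    rw [hp₁.mem_iff, List.mem_append, hAB]
    tauto

/-- Enter a `let rec` whose body demands an expression through a path. -/
theorem Runs.enter {vars inn n : List Var} {defs D' : Tm Var → Defs Var} {body : Tm Var → Tm Var}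
    {s : Tm Var} {De D : Defs Var} {Ke : Stack Var} (H : Runs vars inn defs body s De Ke)
    (hs : ¬ IsAnswer (body s)) (hperm : ∀ t, (D' t).Perm (defs t ++ D))
    (hn : ∀ t, names (D' t) = n) (hv : ∀ t, names (defs t) = vars) (hnd : n.Nodup)
    (hd : ∀ x ∈ n, x ∉ inn) :
    (∀ (h : Var → Tm Var) (K : Stack Var), (∀ x ∈ n, x ∉ letsNames K) →
      (∀ x ∈ inn, x ∉ letsNames K) → (∀ x ∈ upds K, x ∈ letsNames K) →
      Relation.ReflTransGen Focus ⟨h, .letrec (D' s) (body s), K⟩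
        ⟨hup (hup h (D' s)) De, s, Ke ++ .lets n :: K⟩) ∧
    ∀ (g : Var → Tm Var) (s' : Tm Var) (K : Stack Var), (∀ x ∈ names De, x ∉ letsNames K) →
      (∀ x ∈ n, x ∉ letsNames K) →
      Letrec.unload (hup (hup g (D' s)) De) s' (Ke ++ .lets n :: K) =
        Letrec.unload g (.letrec (D' s') (body s')) K := by
  have hvn : ∀ x ∈ vars, x ∈ n := by
    intro x hx
    rw [← hn s, (names_perm (hperm s)).mem_iff, names_append, List.mem_append]
    exact Or.inl (hv s ▸ hx)
  constructor
  · intro h K h1 h2 h3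
    refine .head (.letrec _ _ _ _ hs) ?_
    rw [hn s]
    refine H.run _ _ ?_ ?_ ?_ ?_
    · exact fun b hb => hup_of_mem (by rwa [hn s]) ((hperm s).mem_iff.2 (List.mem_append_left _ hb))
    · intro x hx
      refine ⟨List.mem_append_left _ (hvn x hx), fun hu => h1 x (hvn x hx) (h3 x hu)⟩
    · intro x hx
      simp only [letsNames, List.mem_append, not_or]
      exact ⟨fun h => hd x h hx, h2 x hx⟩
    · exact fun x hx => List.mem_append_right _ (h3 x hx)
  · intro g s' K h1 h2
    rw [H.unload, hup_overwrite (hperm s) (hperm s') (by rwa [hn s]) (by rw [hv, hv])]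
    · rw [← hn s']
      exact unload_enter_letrec (by rwa [hn s']) (by rwa [hn s'])
    · intro x hx
      simp only [letsNames, List.mem_append, not_or]
      exact ⟨fun h => hd x h (H.names_mem x hx), h1 x hx⟩

/-- After the `let rec` is closed, the variables of its path belong to a frame of the added stack,
so the surrounding heap no longer has to provide any definitions. -/
theorem Runs.close {vars inn n : List Var} {defs D' : Tm Var → Defs Var} {body : Tm Var → Tm Var}
    {s : Tm Var} {De D : Defs Var} {Ke : Stack Var} (H : Runs vars inn defs body s De Ke)
    (hs : ¬ IsAnswer (body s)) (hperm : ∀ t, (D' t).Perm (defs t ++ D))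
    (hn : ∀ t, names (D' t) = n) (hv : ∀ t, names (defs t) = vars) (hnd : n.Nodup)
    (hd : ∀ x ∈ n, x ∉ inn) :
    Runs [] (n ++ inn) (fun _ => []) (fun t => .letrec (D' t) (body t)) s (De ++ D' s)
      (Ke ++ [.lets n]) where
  names_mem := by
    intro x hx
    rw [names_append, List.mem_append, hn] at hx
    rw [List.mem_append]
    exact hx.elim (fun h => Or.inr (H.names_mem x h)) Or.inl
  lets_mem := by
    intro x hx
    simp only [letsNames_append, letsNames, List.mem_append, List.not_mem_nil, or_false] at hx ⊢
    exact hx.elim (fun h => Or.inr (H.lets_mem x h)) Or.inl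
  upds_mem := by
    intro x hx
    simp only [upds_append, upds, letsNames_append, letsNames, List.mem_append, List.not_mem_nil,
      or_false] at hx ⊢
    refine (H.upds_mem x hx).imp id fun h => ?_
    rw [← hn s, (names_perm (hperm s)).mem_iff, names_append, List.mem_append]
    exact Or.inl (hv s ▸ h)
  vars_mem := by simp
  run h K _ _ h3 h4 := by
    simp only [List.mem_append] at h3
    have := (H.enter hs hperm hn hv hnd hd).1 h K (fun x hx => h3 x (Or.inl hx))
      (fun x hx => h3 x (Or.inr hx)) h4
    rwa [hup_append, List.append_assoc]
  unload g s' K hK := by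
    simp only [names_append, List.mem_append, hn] at hK
    rw [List.append_assoc, hup_append, hup_nil]
    exact (H.enter hs hperm hn hv hnd hd).2 g s' K (fun x hx => hK x (Or.inl hx))
      fun x hx => hK x (Or.inr hx)

/-- The facts about distinctness that follow from distinct binding occurrences in a `let rec`. -/
theorem nodup_letrec {D : Defs Var} {M : Tm Var} (h : (Tm.letrec D M).binders.Nodup) :
    (names D).Nodup ∧ (inner D).Nodup ∧ M.binders.Nodup ∧ (∀ x ∈ names D, x ∉ inner D) ∧
      (∀ x ∈ names D, x ∉ M.binders) ∧ ∀ x ∈ inner D, x ∉ M.binders := by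
  rw [(binders_letrec_perm D M).nodup_iff, List.nodup_append', List.nodup_append'] at h
  obtain ⟨h1, ⟨h2, h3, h4⟩, h5⟩ := h
  exact ⟨h1, h2, h3, fun x hx h => h5 hx (by simp [h]), fun x hx h => h5 hx (by simp [h]),
    fun x hx h => h4 hx h⟩

theorem mem_binders_letrec' {D : Defs Var} {M : Tm Var} {x : Var} :
    x ∈ (Tm.letrec D M).binders ↔ x ∈ names D ∨ x ∈ inner D ∨ x ∈ M.binders := by
  rw [(binders_letrec_perm D M).mem_iff, List.mem_append, List.mem_append]

/-- The facts about contexts and dependencies enter as hypotheses, so that the lemma can be used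
within the mutual recursion that proves them. -/
theorem Path.runs_of {P : Path Var} {s : Tm Var} (hs : ¬ IsAnswer s)
    (hE : ∀ E : Ctx Var, (P = .body E ∨ ∃ Δ, P = .dep Δ E) → ∀ s, ¬ IsAnswer s →
      (E.fill s).binders.Nodup →
      ∃ De Ke, Runs [] (E.fill s).binders (fun _ => []) E.fill s De Ke)
    (hΔ : ∀ (Δ : Deps Var) (E : Ctx Var), P = .dep Δ E → ∀ s, ¬ IsAnswer s →
      (Δ.vars ++ inner (Δ.fill s)).Nodup →
      ∃ De Ke, Runs Δ.vars (inner (Δ.fill s)) Δ.fill (fun _ => .var Δ.start) s De Ke)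
    (hn : (P.vars ++ (inner (P.defs s) ++ (P.fill s).binders)).Nodup) :
    ∃ De Ke, Runs P.vars (inner (P.defs s) ++ (P.fill s).binders) P.defs P.fill s De Ke := by
  cases P with
  | body E => exact hE E (Or.inl rfl) s hs (by simpa [Path.vars, Path.defs, Path.fill] using hn)
  | dep Δ E =>
    simp only [Path.vars, Path.defs, Path.fill] at hn ⊢
    have hn' : (Δ.vars ++ inner (Δ.fill s)).Nodup := by
      rw [← List.append_assoc] at hn; exact hn.of_append_left
    obtain ⟨D₁, K₁, H₁⟩ := hΔ Δ E rfl s hs hn'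
    obtain ⟨D₂, K₂, H₂⟩ := hE E (Or.inr ⟨Δ, rfl⟩) (.var Δ.start) not_isAnswer_var
      hn.of_append_right.of_append_right
    rw [List.nodup_append', List.nodup_append'] at hn
    exact ⟨_, _, H₁.comp H₂ Δ.names_fill (fun y hy h => hn.2.2 hy (by simp [h]))
      fun y hy h => hn.2.1.2.2 hy h⟩

/-- The context `let rec x be E, P, D in P`. -/
theorem runs_letPath {P : Path Var} {x : Var} {E : Ctx Var} {D : Defs Var} {s : Tm Var}
    (hP : (P.vars ++ (inner (P.defs (.var x)) ++ (P.fill (.var x)).binders)).Nodup →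
      ∃ De Ke, Runs P.vars (inner (P.defs (.var x)) ++ (P.fill (.var x)).binders) P.defs P.fill
        (.var x) De Ke)
    (hE : (E.fill s).binders.Nodup →
      ∃ De Ke, Runs [] (E.fill s).binders (fun _ => []) E.fill s De Ke)
    (hn : (Tm.letrec ((x, E.fill s) :: (P.defs (.var x) ++ D)) (P.fill (.var x))).binders.Nodup) :
    ∃ De Ke, Runs []
      (Tm.letrec ((x, E.fill s) :: (P.defs (.var x) ++ D)) (P.fill (.var x))).binders (fun _ => [])
      (fun t => .letrec ((x, E.fill t) :: (P.defs (.var x) ++ D)) (P.fill (.var x))) s De Ke := by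
  obtain ⟨h1, h2, h3, h4, h5, h6⟩ := nodup_letrec hn
  simp only [names_cons, names_append, P.names_defs, inner_cons, inner_append, List.nodup_cons,
    List.mem_append, List.mem_cons, not_or, List.nodup_append] at h1 h2 h4 h5 h6
  obtain ⟨D₁, K₁, H₁⟩ := hP (by
    simp only [List.nodup_append, List.mem_append]
    grind)
  obtain ⟨D₂, K₂, H₂⟩ := hE h2.1
  have H₃ := H₁.extend H₂ h1.1.1 (by simp only [List.mem_append]; grind)
    (by simp only [List.mem_append]; grind)
  have H₄ := H₃.close (D := D) (n := x :: (P.vars ++ names D))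
    (D' := fun t => (x, E.fill t) :: (P.defs (.var x) ++ D))
    (P.not_isAnswer_fill not_isAnswer_var)
    (fun t => by
      simp only [List.append_assoc, List.singleton_append]
      exact List.perm_middle.symm)
    (fun t => by simp [P.names_defs]) (fun t => by simp [P.names_defs])
    (by simp only [List.nodup_cons, List.mem_append, not_or, List.nodup_append]; grind)
    (by simp only [List.mem_cons, List.mem_append]; grind)
  refine ⟨_, _, H₄.mono fun y hy => ?_⟩
  rw [mem_binders_letrec']
  simp only [List.mem_cons, List.mem_append, names_cons, names_append, P.names_defs, inner_cons,
    inner_append] at hy ⊢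
  tauto

mutual
-- Each clause of the grammar of contexts is a sequence of `Focus` steps, where a dependency is
-- traversed from the variable demanded by the body through a chain of `upd` frames. Distinct
-- binders ensure that every variable met belongs to the intended frame. Neither `s` nor a demanded
-- variable is an answer, so every `let rec` on the way can be entered.
theorem Ctx.runs : ∀ (E : Ctx Var) (s : Tm Var), ¬ IsAnswer s → (E.fill s).binders.Nodup →
    ∃ De Ke, Runs [] (E.fill s).binders (fun _ => []) E.fill s De Ke
  | .hole, s, _, _ => by
    simp only [show (Ctx.hole : Ctx Var).fill = fun t => t from by funext t; rw [Ctx.fill]]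
    exact ⟨_, _, (Runs.hole s).mono (by simp)⟩
  | .app E N, s, hs, hn => by
    simp only [show (Ctx.app E N).fill = fun t => .app (E.fill t) N from by
      funext t; rw [Ctx.fill]] at hn ⊢
    obtain ⟨De, Ke, H⟩ := Ctx.runs E s hs hn.of_append_left
    exact ⟨_, _, (H.app N).mono fun x hx => by simp [Tm.binders, hx]⟩
  | .letBody D E, s, hs, hn => by
    simp only [show (Ctx.letBody D E).fill = fun t => .letrec D (E.fill t) from by
      funext t; rw [Ctx.fill]] at hn ⊢
    obtain ⟨h1, h2, h3, h4, h5, h6⟩ := nodup_letrec hn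
    obtain ⟨De, Ke, H⟩ := Ctx.runs E s hs h3
    refine ⟨_, _, (H.close (D := D) (D' := fun _ => D) (n := names D)
      (fun h => hs (isAnswer_of_fill E h)) (fun t => by simp) (fun _ => rfl) (fun _ => rfl) h1
      h5).mono fun x hx => ?_⟩
    rw [mem_binders_letrec']
    simp only [List.mem_append] at hx
    tauto
  | .letDef x E D E', s, hs, hn => by
    simp only [show (Ctx.letDef x E D E').fill = fun t => .letrec
      ((x, E.fill t) :: ((Path.body E').defs (.var x) ++ D)) ((Path.body E').fill (.var x)) from by
      funext t; rw [Ctx.fill]; rfl] at hn ⊢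
    refine runs_letPath (fun h => ?_) (Ctx.runs E s hs) hn
    exact Ctx.runs E' (.var x) not_isAnswer_var
      (by simpa [Path.vars, Path.defs, Path.fill] using h)
  | .letDep x E Δ D E', s, hs, hn => by
    simp only [show (Ctx.letDep x E Δ D E').fill = fun t => .letrec
      ((x, E.fill t) :: ((Path.dep Δ E').defs (.var x) ++ D)) ((Path.dep Δ E').fill (.var x)) from by
      funext t; rw [Ctx.fill]; rfl] at hn ⊢
    refine runs_letPath (fun h => ?_) (Ctx.runs E s hs) hn
    refine Path.runs_of not_isAnswer_var ?_ ?_ h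
    · rintro F (h | ⟨Δ', h⟩) t
      · cases h
      · cases h; exact Ctx.runs E' t
    · rintro Δ' F h t
      cases h; exact Deps.runs Δ t
theorem Deps.runs : ∀ (Δ : Deps Var) (s : Tm Var), ¬ IsAnswer s →
    (Δ.vars ++ inner (Δ.fill s)).Nodup →
    ∃ De Ke, Runs Δ.vars (inner (Δ.fill s)) Δ.fill (fun _ => .var Δ.start) s De Ke
  | .single x E, s, hs, hn => by
    simp only [show (Deps.single x E).fill = fun t => [(x, E.fill t)] from by
      funext t; rw [Deps.fill], Deps.vars, Deps.start] at hn ⊢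
    obtain ⟨De, Ke, H⟩ := Ctx.runs E s hs (by simpa using hn.of_append_right)
    exact ⟨_, _, ((Runs.hole (.var x)).extend H (by simp) (by simp) (by simp)).mono (by simp)⟩
  | .snoc Δ x E, s, hs, hn => by
    simp only [show (Deps.snoc Δ x E).fill = fun t => Δ.fill (.var x) ++ [(x, E.fill t)] from by
      funext t; rw [Deps.fill], Deps.vars, Deps.start] at hn ⊢
    simp only [inner_append, inner_cons, inner_nil, List.append_nil, List.nodup_append,
      List.mem_append] at hn ⊢
    obtain ⟨D₁, K₁, H₁⟩ := Deps.runs Δ (.var x) not_isAnswer_var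
      (by simp only [List.nodup_append]; grind)
    obtain ⟨D₂, K₂, H₂⟩ := Ctx.runs E s hs hn.2.1.2.1
    exact ⟨_, _, H₁.extend H₂ (by grind) (by grind) (by grind)⟩
end

theorem Path.runs (P : Path Var) {s : Tm Var} (hs : ¬ IsAnswer s)
    (hn : (P.vars ++ (inner (P.defs s) ++ (P.fill s).binders)).Nodup) :
    ∃ De Ke, Runs P.vars (inner (P.defs s) ++ (P.fill s).binders) P.defs P.fill s De Ke :=
  P.runs_of hs (fun E _ => E.runs) (fun Δ _ _ => Δ.runs) hn

end Traversal

-- Redexes are found by the machine; reduction is deterministic.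

section Determinism

variable {Var : Type u} [DecidableEq Var]

/-- Concatenation of dependencies. -/
def Deps.append (Δ : Deps Var) : Deps Var → Deps Var
  | .single x E => .snoc Δ x E
  | .snoc Δ' x E => .snoc (Δ.append Δ') x E

theorem Deps.fill_append (Δ Δ' : Deps Var) (s : Tm Var) :
    (Δ.append Δ').fill s = Δ.fill (.var Δ'.start) ++ Δ'.fill s := by
  cases Δ' with
  | single x E => simp [Deps.append, Deps.fill, Deps.start]
  | snoc Δ' x E => simp [Deps.append, Deps.fill, Deps.start, Deps.fill_append Δ Δ']

theorem Deps.start_append (Δ Δ' : Deps Var) : (Δ.append Δ').start = Δ.start := by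
  cases Δ' with
  | single x E => simp [Deps.append, Deps.start]
  | snoc Δ' x E => simp [Deps.append, Deps.start, Deps.start_append Δ Δ']

theorem Deps.vars_append (Δ Δ' : Deps Var) : (Δ.append Δ').vars = Δ.vars ++ Δ'.vars := by
  cases Δ' with
  | single x E => simp [Deps.append, Deps.vars]
  | snoc Δ' x E => simp [Deps.append, Deps.vars, Deps.vars_append Δ Δ']

/-- A path that ends in the first variable of a dependency, extended by the dependency. -/
def Path.ext (P : Path Var) (Δ : Deps Var) : Path Var :=
  match P with
  | .body E => .dep Δ E
  | .dep Δ' E => .dep (Δ'.append Δ) E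

theorem Path.defs_ext (P : Path Var) (Δ : Deps Var) (s : Tm Var) :
    (P.ext Δ).defs s = P.defs (.var Δ.start) ++ Δ.fill s := by
  cases P with
  | body E => rfl
  | dep Δ' E => exact Δ'.fill_append Δ s

theorem Path.fill_ext (P : Path Var) (Δ : Deps Var) (s : Tm Var) :
    (P.ext Δ).fill s = P.fill (.var Δ.start) := by
  cases P with
  | body E => rfl
  | dep Δ' E => simp [Path.ext, Path.fill, Deps.start_append]

theorem Path.vars_ext (P : Path Var) (Δ : Deps Var) : (P.ext Δ).vars = P.vars ++ Δ.vars := by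
  cases P with
  | body E => rfl
  | dep Δ' E => exact Δ'.vars_append Δ

theorem addTo_append {x : Var} {zs n : List Var} {K₁ K₂ : Stack Var} (hx : x ∉ letsNames K₁)
    (hn : x ∈ n) : addTo x zs (K₁ ++ .lets n :: K₂) = K₁ ++ .lets (zs ++ n) :: K₂ := by
  induction K₁ with
  | nil => simp [addTo, hn]
  | cons F K ih =>
    cases F with
    | app N => simpa [addTo] using ih hx
    | lets ys =>
      simp only [letsNames, List.mem_append, not_or] at hx
      simpa [addTo, hx.1] using ih hx.2
    | upd y => simpa [addTo] using ih hx

/-- The body and dependency versions of the rule differ only in the path `P`. The machine follows it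
to `x`, enters the definition and meets a value under an `upd` frame. -/
theorem fire_deref {P : Path Var} {x : Var} {V : Tm Var} {D : Defs Var} {h : Var → Tm Var}
    {K : Stack Var} (hV : IsValue V)
    (hc : (⟨h, .letrec (P.defs (.var x) ++ (x, V) :: D) (P.fill (.var x)), K⟩ :
      State Var).Canonical) :
    ∃ st, Relation.ReflTransGen Focus
        ⟨h, .letrec (P.defs (.var x) ++ (x, V) :: D) (P.fill (.var x)), K⟩ st ∧
      Fire st (unload h (.letrec (P.defs V ++ (x, V) :: D) (P.fill V)) K) := by
  obtain ⟨hn, hK⟩ := hc.focus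
  obtain ⟨h1, h2, h3, h4, h5, h6⟩ := nodup_letrec hn
  simp only [mem_binders_letrec', names_append, names_cons, inner_append, inner_cons,
    P.names_defs, List.mem_append, List.mem_cons, List.nodup_append, List.nodup_cons]
    at h1 h2 h4 h5 h6 hK
  obtain ⟨De, Ke, H⟩ := P.runs (s := .var x) not_isAnswer_var
    (by simp only [List.nodup_append, List.mem_append]; grind)
  obtain ⟨r, u⟩ := H.enter (D := (x, V) :: D) (D' := fun t => P.defs t ++ (x, V) :: D)
    (n := P.vars ++ x :: names D) (P.not_isAnswer_fill not_isAnswer_var) (fun _ => .refl _)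
    (by simp [P.names_defs]) P.names_defs
    (by simp only [List.nodup_append, List.nodup_cons, List.mem_cons]; grind)
    (by simp only [List.mem_append, List.mem_cons]; grind)
  have hxi : x ∉ inner (P.defs (.var x)) ++ (P.fill (.var x)).binders := by
    simp only [List.mem_append]; grind
  have hxd : x ∉ names De := fun hd => hxi (H.names_mem x hd)
  have hKn : ∀ y ∈ P.vars ++ x :: names D, y ∉ letsNames K := by
    simp only [List.mem_append, List.mem_cons]; grind
  have hKi : ∀ y ∈ inner (P.defs (.var x)) ++ (P.fill (.var x)).binders, y ∉ letsNames K := by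
    simp only [List.mem_append]; grind
  have e : hup (hup h (P.defs (.var x) ++ (x, V) :: D)) De x = V := by
    rw [hup_of_not_mem hxd]
    exact hup_of_mem (b := (x, V)) (nodup_names_of_binders hn) (by simp)
  refine ⟨_, (r h K hKn hKi fun y => hc.1.upds_subset).tail (.var _ _ _ ?_ ?_), ?_⟩
  · simp [letsNames]
  · simp only [upds_append, upds, List.mem_append, not_or]
    refine ⟨fun hu => ?_, fun hu => hKn x (by simp) (hc.1.upds_subset hu)⟩
    rcases H.upds_mem x hu with h' | h'
    · exact hxi (H.lets_mem x h')
    · exact h1.2.2 x h' x (Or.inl rfl) rfl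
  · rw [e]
    have := Fire.deref (hup (hup h (P.defs (.var x) ++ (x, V) :: D)) De) V x
      (Ke ++ .lets (P.vars ++ x :: names D) :: K) hV
    -- The update made by `Fire.deref` is void here, since the heap already holds `V` at `x`.
    have e' := Function.update_eq_self x (hup (hup h (P.defs (.var x) ++ (x, V) :: D)) De)
    rw [e] at e'
    rwa [e', u h V K (fun y hy => hKi y (H.names_mem y hy)) hKn] at this

/-- A cycle is a dependency that returns to its start. Appended to the path that leads there, it
takes the machine to a variable that is already under evaluation. -/
theorem fire_error {P : Path Var} {Δ : Deps Var} {D : Defs Var} {h : Var → Tm Var}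
    {K : Stack Var}
    (hc : (⟨h, .letrec (Δ.fill (.var Δ.start) ++ (P.defs (.var Δ.start) ++ D))
      (P.fill (.var Δ.start)), K⟩ : State Var).Canonical) :
    ∃ st, Relation.ReflTransGen Focus
        ⟨h, .letrec (Δ.fill (.var Δ.start) ++ (P.defs (.var Δ.start) ++ D))
          (P.fill (.var Δ.start)), K⟩ st ∧
      Fire st (unload h (.letrec (Δ.fill .bh ++ (P.defs (.var Δ.start) ++ D))
        (P.fill (.var Δ.start))) K) := by
  obtain ⟨hn, hK⟩ := hc.focus
  obtain ⟨h1, h2, h3, h4, h5, h6⟩ := nodup_letrec hn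
  simp only [mem_binders_letrec', names_append, inner_append, P.names_defs, Δ.names_fill,
    List.mem_append, List.nodup_append] at h1 h2 h4 h5 h6 hK
  obtain ⟨De, Ke, H⟩ := (P.ext Δ).runs (s := .var Δ.start) not_isAnswer_var
    (by
      rw [P.vars_ext, P.defs_ext, P.fill_ext]
      simp only [List.nodup_append, List.mem_append, inner_append]; grind)
  have hvars := H.vars_mem Δ.start (by rw [P.vars_ext]; simp [Δ.start_mem_vars])
  obtain ⟨r, u⟩ := H.enter (D := D) (D' := fun t => Δ.fill t ++ (P.defs (.var Δ.start) ++ D))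
    (n := Δ.vars ++ (P.vars ++ names D)) ((P.ext Δ).not_isAnswer_fill not_isAnswer_var)
    (fun t => by
      rw [P.defs_ext, ← List.append_assoc]
      exact List.perm_append_comm.append_right _)
    (by simp [P.names_defs, Δ.names_fill]) (P.ext Δ).names_defs
    (by simp only [List.nodup_append, List.mem_append]; grind)
    (by
      rw [P.defs_ext, P.fill_ext]
      simp only [List.mem_append, inner_append]; grind)
  have hKn : ∀ y ∈ Δ.vars ++ (P.vars ++ names D), y ∉ letsNames K := by
    simp only [List.mem_append]; grind
  have hKi : ∀ y ∈ inner ((P.ext Δ).defs (.var Δ.start)) ++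
      ((P.ext Δ).fill (.var Δ.start)).binders, y ∉ letsNames K := by
    rw [P.defs_ext, P.fill_ext]
    simp only [List.mem_append, inner_append]; grind
  have r' := r h K hKn hKi fun y => hc.1.upds_subset
  rw [P.fill_ext] at r'
  refine ⟨_, r', ?_⟩
  have hF := Fire.error (hup (hup h (Δ.fill (.var Δ.start) ++ (P.defs (.var Δ.start) ++ D))) De)
    Δ.start (Ke ++ .lets (Δ.vars ++ (P.vars ++ names D)) :: K) (by simp [hvars])
  rwa [u h .bh K (fun y hy => hKi y (H.names_mem y hy)) hKn, P.fill_ext] at hF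

/-- The machine stops at the inner `let rec`, because its body is an answer. Its definitions then
join the frame that defines `x`, which is that of the outer `let rec`. -/
theorem fire_assoc {P : Path Var} {x : Var} {D D' : Defs Var} {A : Tm Var} {h : Var → Tm Var}
    {K : Stack Var} (hA : IsAnswer A)
    (hc : (⟨h, .letrec ((x, .letrec D A) :: (P.defs (.var x) ++ D')) (P.fill (.var x)), K⟩ :
      State Var).Canonical) :
    ∃ st, Relation.ReflTransGen Focus
        ⟨h, .letrec ((x, .letrec D A) :: (P.defs (.var x) ++ D')) (P.fill (.var x)), K⟩ st ∧
      Fire st (unload h (.letrec (D ++ (x, A) :: (P.defs (.var x) ++ D')) (P.fill (.var x)))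
        K) := by
  obtain ⟨hn, hK⟩ := hc.focus
  obtain ⟨h1, h2, h3, h4, h5, h6⟩ := nodup_letrec hn
  have hDn : (names D).Nodup := by
    rw [inner_cons] at h2
    exact nodup_names_of_binders h2.of_append_left
  simp only [mem_binders_letrec', names_append, names_cons, inner_append, inner_cons,
    P.names_defs, List.mem_append, List.mem_cons, List.nodup_append, List.nodup_cons]
    at h1 h2 h4 h5 h6 hK
  obtain ⟨De, Ke, H⟩ := P.runs (s := .var x) not_isAnswer_var
    (by simp only [List.nodup_append, List.mem_append]; grind)
  set n := x :: (P.vars ++ names D') with hndef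
  have hxi : x ∉ inner (P.defs (.var x)) ++ (P.fill (.var x)).binders := by
    simp only [List.mem_append]; grind
  have hxd : x ∉ names De := fun hd => hxi (H.names_mem x hd)
  have hKn : ∀ y ∈ n, y ∉ letsNames K := by
    simp only [n, List.mem_append, List.mem_cons]; grind
  have hKi : ∀ y ∈ inner (P.defs (.var x)) ++ (P.fill (.var x)).binders, y ∉ letsNames K := by
    simp only [List.mem_append]; grind
  have hni : ∀ y ∈ n, y ∉ inner (P.defs (.var x)) ++ (P.fill (.var x)).binders := by
    simp only [n, List.mem_append, List.mem_cons]; grind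
  have hDi : ∀ y ∈ names D, y ∉ inner (P.defs (.var x)) ++ (P.fill (.var x)).binders := by
    simp only [List.mem_append]; grind
  have hDx : ∀ y ∈ names D, y ∉ n := by
    simp only [n, List.mem_append, List.mem_cons]; grind
  have hDK : ∀ y ∈ names D, y ∉ letsNames K := by grind
  have hnn : n.Nodup := by
    simp only [n, List.nodup_append, List.nodup_cons, List.mem_append]; grind
  clear_value n
  obtain ⟨r, -⟩ := H.enter (D := (x, .letrec D A) :: D')
    (D' := fun t => (x, .letrec D A) :: (P.defs t ++ D'))
    (n := n) (P.not_isAnswer_fill not_isAnswer_var) (fun _ => List.perm_middle.symm)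
    (by simp [P.names_defs, hndef]) P.names_defs hnn hni
  set D₁ : Defs Var := (x, .letrec D A) :: (P.defs (.var x) ++ D')
  have e : hup (hup h D₁) De x = .letrec D A := by
    rw [hup_of_not_mem hxd]; simp [D₁]
  refine ⟨_, (r h K hKn hKi fun y => hc.1.upds_subset).tail (.var _ _ _ ?_ ?_), ?_⟩
  · simp [letsNames, hndef]
  · simp only [upds_append, upds, List.mem_append, not_or]
    refine ⟨fun hu => ?_, fun hu => hKn x (by simp [hndef]) (hc.1.upds_subset hu)⟩
    rcases H.upds_mem x hu with h' | h'
    · exact hxi (H.lets_mem x h')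
    · exact h1.1 (Or.inl h')
  · rw [e]
    have hF := Fire.assoc (hup (hup h D₁) De) D A x (Ke ++ .lets n :: K) hA (by
      intro y hy
      simp only [letsNames_append, letsNames, List.mem_append, not_or]
      exact ⟨fun h' => hDi y hy (H.lets_mem y h'), hDx y hy, hDK y hy⟩)
    rw [addTo_append (fun h' => hxi (H.lets_mem x h')) (by simp [hndef]), unload] at hF
    have hDe : ∀ y ∈ names De, y ∉ names D := fun y hy h' => hDi y h' (H.names_mem y hy)
    have hxD : x ∉ names D := fun h' => hDx x h' (by simp [hndef])
    -- The definitions collected on the way are disjoint from `D`, so the heap is the one that would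
    -- arise had `D` belonged to the outer `let rec` from the start.
    have hheap : Function.update (hup (hup (hup h D₁) De) D) x A =
        hup (hup h (D ++ (x, A) :: (P.defs (.var x) ++ D'))) De := by
      rw [hup_comm hDe, ← hup_update_comm hxd, hup_append]
      simp only [D₁, hup_cons]
      rw [hup_update_comm hxD, hup_update_comm hxD, Function.update_idem]
    have hn₂ : names (D ++ (x, A) :: (P.defs (.var x) ++ D')) = names D ++ n := by
      simp [P.names_defs, hndef]
    have hnn₂ : (names D ++ n).Nodup := hDn.append hnn fun y hy => hDx y hy
    have hperm : (D ++ (x, A) :: (P.defs (.var x) ++ D')).Perm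
        (P.defs (.var x) ++ (D ++ (x, A) :: D')) := by
      rw [← List.append_assoc]
      refine List.Perm.trans ?_ (List.perm_append_comm.append_right _)
      rw [List.append_assoc]
      exact List.perm_middle.symm.append_left _
    have key : unload (Function.update (hup (hup (hup h D₁) De) D) x A) (.var x)
        (Ke ++ .lets (names D ++ n) :: K) =
        unload h (.letrec (D ++ (x, A) :: (P.defs (.var x) ++ D')) (P.fill (.var x))) K := by
      rw [hheap, H.unload, hup_overwrite hperm hperm (by rwa [hn₂]) rfl, ← hn₂,
        unload_enter_letrec (by rwa [hn₂])]
      · rw [hn₂]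
        intro y hy
        rcases List.mem_append.1 hy with hy | hy
        · exact hDK y hy
        · exact hKn y hy
      · intro y hy
        simp only [letsNames, List.mem_append, not_or]
        exact ⟨⟨hDe y hy, fun h' => hni y h' (H.names_mem y hy)⟩, hKi y (H.names_mem y hy)⟩
    rwa [key] at hF

/-- In a canonical state whose focus is a redex, the machine fires that redex. -/
theorem fire_of_redex {R R' : Tm Var} (hr : Redex R R') {h : Var → Tm Var} {K : Stack Var}
    (hc : (⟨h, R, K⟩ : State Var).Canonical) :
    ∃ st, Relation.ReflTransGen Focus ⟨h, R, K⟩ st ∧ Fire st (unload h R' K) := by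
  obtain ⟨hn, hK⟩ := hc.focus
  cases hr with
  | beta_need x M N =>
    exact ⟨_, .single (.app _ _ _ _), .beta _ _ _ _ _ (hK x (by simp [Tm.binders]))⟩
  | lift D A N hA =>
    refine ⟨_, .single (.app _ _ _ _), .lift _ _ _ _ _ hA fun x hx => hK x ?_⟩
    simp only [Tm.binders, List.mem_append]
    exact Or.inl (List.mem_append.1 (mem_binders_letrec.2 (Or.inl hx)))
  | deref x V D E hV => exact fire_deref (P := .body E) hV hc
  | deref_env Δ x V D E hV => exact fire_deref (P := .dep Δ E) hV hc
  | assoc x D A D' E hA => exact fire_assoc (P := .body E) hA hc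
  | assoc_env x D A Δ D' E hA => exact fire_assoc (P := .dep Δ E) hA hc
  | error Δ D E => exact fire_error (P := .body E) hc
  | error_env Δ Δ' D E => exact fire_error (P := .dep Δ' E) hc
  | error_beta M => exact ⟨_, .single (.app _ _ _ _), .error_beta _ _ _⟩

theorem not_isAnswer_redex {R R' : Tm Var} (hr : Redex R R') : ¬ IsAnswer R := by
  intro h
  have key : ∀ {D : Defs Var} {E : Ctx Var} {x : Var},
      ¬ IsAnswer (.letrec D (E.fill (.var x))) := by
    intro D E x h
    cases h with
    | value h => cases h
    | letrec _ h => exact not_isAnswer_var (isAnswer_of_fill E h)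
  cases hr with
  | beta_need | lift | error_beta => cases h with | value h => cases h
  | _ => exact key h

/-- Two traversals are chained: through the context up to the redex, then through the redex up to
the firing state. `Runs.unload` puts the contractum back under the same context. -/
theorem load_fire {E : Ctx Var} {R R' : Tm Var} (hr : Redex R R')
    (hc : (E.fill R).binders.Nodup) :
    ∃ st, Relation.ReflTransGen Focus (load (E.fill R)) st ∧ Fire st (E.fill R') := by
  obtain ⟨De, Ke, H⟩ := E.runs R (not_isAnswer_redex hr) hc
  have r := H.run (fun _ => .bh) [] (by simp) (by simp) (by simp [letsNames]) (by simp [upds])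
  obtain ⟨st, h1, h2⟩ := fire_of_redex hr (Focus.canonical_star r (load_canonical hc)).1
  refine ⟨st, Relation.ReflTransGen.trans r h1, ?_⟩
  rwa [H.unload _ _ _ (by simp [letsNames])] at h2

/-- Classes of closed, well-formed expressions. -/
def ClosedCls (c : Cls Var) : Prop := ∃ M : Tm Var, M.cls = c ∧ M.WF ∧ M.fv = ∅

theorem ClosedCls.fv_eq {c : Cls Var} (h : ClosedCls c) {N : Tm Var} (hN : N.cls = c) :
    N.WF ∧ N.fv = ∅ := by
  obtain ⟨M, rfl, hM, hf⟩ := h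
  have ha := alpha_of_cls_eq hN
  have hNw := ha.wf_iff.2 hM
  exact ⟨hNw, by rw [(ha.aeq hNw).fv_eq, hf]⟩

/-- Two decompositions need not be compared syntactically: the machine follows each of them, and its
run is unique up to α-equivalence. -/
theorem step_aeq {E₁ E₂ : Ctx Var} {R₁ R₂ R₁' R₂' : Tm Var} (h₁ : Redex R₁ R₁')
    (h₂ : Redex R₂ R₂') (hc₁ : (E₁.fill R₁).Canonical) (hc₂ : (E₂.fill R₂).Canonical)
    (hcls : (E₁.fill R₁).cls = (E₂.fill R₂).cls) (hcl : (E₁.fill R₁).fv = ∅) :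
    ∃ S, AEq S (E₁.fill R₁') (E₂.fill R₂') := by
  obtain ⟨s₁, r₁, f₁⟩ := load_fire h₁ hc₁.1
  obtain ⟨s₂, r₂, f₂⟩ := load_fire h₂ hc₂.1
  exact fire_unique hc₁.1 hc₂.1 hcl
    ((alpha_of_cls_eq hcls).aeq (wf_of_nodup_binders hc₁.1)) r₁ r₂ f₁ f₂

/-! ### Contraction does not create free variables -/

theorem mem_fv_letrec_cons {x : Var} {N : Tm Var} {D : Defs Var} {M : Tm Var} {a : Var} :
    a ∈ (Tm.letrec ((x, N) :: D) M).fv ↔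
      (a ∈ N.fv ∨ a ∈ fvDefs D ∨ a ∈ M.fv) ∧ a ≠ x ∧ a ∉ names D := by
  simp only [Tm.fv, fvDefs, names_cons, Finset.mem_sdiff, Finset.mem_union, List.mem_toFinset,
    List.mem_cons, not_or, or_assoc]

theorem mem_fvDefs_append {D D' : Defs Var} {a : Var} :
    a ∈ fvDefs (D ++ D') ↔ a ∈ fvDefs D ∨ a ∈ fvDefs D' := by
  simp only [mem_fvDefs, List.mem_append, or_and_right, exists_or]

theorem mem_fv_letrec_iff {D : Defs Var} {M : Tm Var} {a : Var} :
    a ∈ (Tm.letrec D M).fv ↔ (a ∈ fvDefs D ∨ a ∈ M.fv) ∧ a ∉ names D := by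
  rw [mem_fv_letrec, mem_fvDefs]

theorem mem_fvDefs_cons {x : Var} {N : Tm Var} {D : Defs Var} {a : Var} :
    a ∈ fvDefs ((x, N) :: D) ↔ a ∈ N.fv ∨ a ∈ fvDefs D := by
  simp [fvDefs]

theorem Ctx.fv_fill_mono : ∀ (E : Ctx Var) {s t : Tm Var}, s.fv ⊆ t.fv →
    (E.fill s).fv ⊆ (E.fill t).fv
  | .hole, s, t, h => by simpa [Ctx.fill] using h
  | .app E N, s, t, h => by
    intro a
    have := @Ctx.fv_fill_mono E s t h a
    simp only [Ctx.fill, Tm.fv, Finset.mem_union]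
    tauto
  | .letBody D E, s, t, h => by
    intro a
    have := @Ctx.fv_fill_mono E s t h a
    simp only [Ctx.fill, mem_fv_letrec_iff]
    tauto
  | .letDef x E D E', s, t, h => by
    intro a
    have := @Ctx.fv_fill_mono E s t h a
    simp only [Ctx.fill, mem_fv_letrec_cons]
    tauto
  | .letDep x E Δ D E', s, t, h => by
    intro a
    have := @Ctx.fv_fill_mono E s t h a
    simp only [Ctx.fill, mem_fv_letrec_cons]
    tauto

/-- Filling is textual and may capture, so the free variables of the result are bounded instead of
computed. -/
theorem Ctx.mem_fv_fill : ∀ (E : Ctx Var) (s t : Tm Var) {a : Var},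
    a ∈ (E.fill s).fv → a ∈ (E.fill t).fv ∨ a ∈ s.fv
  | .hole, s, t, a => by simp only [Ctx.fill]; tauto
  | .app E N, s, t, a => by
    have := @Ctx.mem_fv_fill E s t a
    simp only [Ctx.fill, Tm.fv, Finset.mem_union]
    tauto
  | .letBody D E, s, t, a => by
    have := @Ctx.mem_fv_fill E s t a
    simp only [Ctx.fill, mem_fv_letrec_iff]
    tauto
  | .letDef x E D E', s, t, a => by
    have := @Ctx.mem_fv_fill E s t a
    simp only [Ctx.fill, mem_fv_letrec_cons]
    tauto
  | .letDep x E Δ D E', s, t, a => by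
    have := @Ctx.mem_fv_fill E s t a
    simp only [Ctx.fill, mem_fv_letrec_cons]
    tauto

theorem Deps.mem_fv_fill (Δ : Deps Var) (s t : Tm Var) {a : Var} (h : a ∈ fvDefs (Δ.fill s)) :
    a ∈ fvDefs (Δ.fill t) ∨ a ∈ s.fv := by
  cases Δ with
  | single x E =>
    have := @Ctx.mem_fv_fill _ _ E s t a
    simp only [Deps.fill, mem_fvDefs_cons] at h ⊢
    tauto
  | snoc Δ x E =>
    have := @Ctx.mem_fv_fill _ _ E s t a
    simp only [Deps.fill, mem_fvDefs_append, mem_fvDefs_cons] at h ⊢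
    tauto

theorem Redex.fv_subset {R R' : Tm Var} (h : Redex R R') : R'.fv ⊆ R.fv := by
  intro a
  cases h with
  | beta_need x M N => simp [Tm.fv, fvDefs]; tauto
  | lift D A N hA =>
    simp only [Tm.fv, Finset.mem_union, Finset.mem_sdiff, List.mem_toFinset]; tauto
  | deref x V D E hV =>
    have := @Ctx.mem_fv_fill _ _ E V (.var x) a
    simp only [mem_fv_letrec_cons]; tauto
  | deref_env Δ x V D E hV =>
    have := @Deps.mem_fv_fill _ _ Δ V (.var x) a
    simp only [mem_fv_letrec_iff, mem_fvDefs_append, mem_fvDefs_cons, names_append,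
      Deps.names_fill]
    tauto
  | assoc x D A D' E hA =>
    simp only [mem_fv_letrec_iff, mem_fvDefs_append, mem_fvDefs_cons, names_append, names_cons,
      List.mem_append, List.mem_cons]
    tauto
  | assoc_env x D A Δ D' E hA =>
    simp only [mem_fv_letrec_iff, mem_fvDefs_append, mem_fvDefs_cons, names_append, names_cons,
      List.mem_append, List.mem_cons]
    tauto
  | error Δ D E =>
    have := @Deps.mem_fv_fill _ _ Δ .bh (.var Δ.start) a
    simp only [mem_fv_letrec_iff, mem_fvDefs_append, names_append, Deps.names_fill]
    simp only [show a ∉ (Tm.bh : Tm Var).fv from by simp [Tm.fv]] at this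
    tauto
  | error_env Δ Δ' D E =>
    have := @Deps.mem_fv_fill _ _ Δ .bh (.var Δ.start) a
    simp only [mem_fv_letrec_iff, mem_fvDefs_append, names_append, Deps.names_fill]
    simp only [show a ∉ (Tm.bh : Tm Var).fv from by simp [Tm.fv]] at this
    tauto
  | error_beta M => simp [Tm.fv]

theorem ClosedCls.step {c c' : Cls Var} (hc : ClosedCls c) (h : Step c c') : ClosedCls c' := by
  obtain ⟨E, R, R', hr, hcan, rfl, rfl⟩ := h
  have hcl := (hc.fv_eq rfl).2
  -- Copying a value destroys distinctness of binders, so well-formedness of the contractum needs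
  -- another source. A derivation of `AEq` certifies it, hence the step is compared with itself.
  obtain ⟨S, hS⟩ := step_aeq hr hr hcan hcan rfl hcl
  refine ⟨_, rfl, hS.wf_left, ?_⟩
  have := E.fv_fill_mono hr.fv_subset
  rw [hcl] at this
  exact Finset.subset_empty.1 this

/-- Reduction is deterministic on closed expressions. -/
theorem step_det [Infinite Var] {c c₁ c₂ : Cls Var} (hc : ClosedCls c) (h₁ : Step c c₁)
    (h₂ : Step c c₂) : c₁ = c₂ := by
  have hc₁ := hc.step h₁
  obtain ⟨E₁, R₁, R₁', hr₁, hcan₁, rfl, rfl⟩ := h₁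
  obtain ⟨E₂, R₂, R₂', hr₂, hcan₂, hcls, rfl⟩ := h₂
  obtain ⟨S, hS⟩ := step_aeq hr₁ hr₂ hcan₁ hcan₂ hcls.symm (hc.fv_eq rfl).2
  exact (hS.of_closed (hc₁.fv_eq rfl).2).cls_eq

/-- Answers are irreducible. -/
theorem not_step_of_isAnswer {A : Tm Var} (hA : IsAnswer A) (hc : ClosedCls A.cls) {c : Cls Var} :
    ¬ Step A.cls c := by
  rintro ⟨E, R, R', hr, hcan, hcls, -⟩
  have ha := (alpha_of_cls_eq hcls.symm).aeq (hc.fv_eq rfl).1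
  exact not_isAnswer_redex hr (isAnswer_of_fill E (ha.isAnswer hA))

end Determinism

-- Stacks of closed states, parsed as evaluation contexts.

section Decomposition

variable {Var : Type u} [DecidableEq Var]

/-- `α`-equivalence that keeps the binding occurrences, up to their order. -/
def PEq (M N : Tm Var) : Prop := Alpha M N ∧ M.binders.Perm N.binders

theorem PEq.refl (M : Tm Var) : PEq M M := ⟨.refl _, .refl _⟩

theorem PEq.trans {M N P : Tm Var} (h : PEq M N) (h' : PEq N P) : PEq M P :=
  ⟨h.1.trans h'.1, h.2.trans h'.2⟩

theorem PEq.letrec_perm {D D' : Defs Var} (h : D.Perm D') (M : Tm Var) :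
    PEq (.letrec D M) (.letrec D' M) :=
  ⟨.letrec_perm M h, (bindersDefs_perm h).append_right _⟩

theorem PEq.app {M M' : Tm Var} (h : PEq M M') (N : Tm Var) : PEq (.app M N) (.app M' N) :=
  ⟨.app h.1 (.refl _), h.2.append_right _⟩

theorem PEq.letrec_body {M M' : Tm Var} (h : PEq M M') (D : Defs Var) :
    PEq (.letrec D M) (.letrec D M') :=
  ⟨.letrec_body D h.1, h.2.append_left _⟩

theorem PEq.letrec_def {N N' : Tm Var} (h : PEq N N') (x : Var) (D : Defs Var) (M : Tm Var) :
    PEq (.letrec ((x, N) :: D) M) (.letrec ((x, N') :: D) M) := by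
  refine ⟨.letrec_def x D M h.1, ?_⟩
  simp only [Tm.binders, bindersDefs, List.cons_append]
  exact ((h.2.append_right _).append_right _).cons _

theorem PEq.letrec_defsOf {h h' : Var → Tm Var} (H : ∀ x, PEq (h x) (h' x)) (xs : List Var)
    (M : Tm Var) : PEq (.letrec (defsOf h xs) M) (.letrec (defsOf h' xs) M) := by
  constructor
  · refine Alpha.letrec_defs M ?_ []
    rw [List.forall₂_map_left_iff, List.forall₂_map_right_iff]
    exact List.forall₂_same.2 fun x _ => ⟨rfl, (H x).1⟩
  · simp only [Tm.binders, bindersDefs_eq, defsOf, List.flatMap_map]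
    exact (List.Perm.flatMap_left _ fun x _ => (H x).2.cons x).append_right _

theorem PEq.unload {h h' : Var → Tm Var} {t t' : Tm Var} (H : ∀ x, PEq (h x) (h' x))
    (ht : PEq t t') (K : Stack Var) : PEq (unload h t K) (unload h' t' K) := by
  induction K generalizing h h' t t' with
  | nil => exact ht
  | cons F K ih =>
    cases F with
    | app N => exact ih H (ht.app N)
    | lets xs => exact ih H ((PEq.letrec_defsOf H xs t).trans (ht.letrec_body _))
    | upd x =>
      refine ih (fun y => ?_) (.refl _)
      simp only [Function.update]
      split_ifs with hy
      · subst hy; exact ht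
      · exact H y

theorem PEq.unload' {h : Var → Tm Var} {t t' : Tm Var} (ht : PEq t t') (K : Stack Var) :
    PEq (Letrec.unload h t K) (Letrec.unload h t' K) := PEq.unload (fun _ => .refl _) ht K

theorem PEq.fill : ∀ (E : Ctx Var) {s t : Tm Var}, PEq s t → PEq (E.fill s) (E.fill t)
  | .hole, s, t, h => by simpa [Ctx.fill] using h
  | .app E N, s, t, h => by
    rw [Ctx.fill, Ctx.fill]; exact (PEq.fill E h).app N
  | .letBody D E, s, t, h => by
    rw [Ctx.fill, Ctx.fill]; exact (PEq.fill E h).letrec_body D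
  | .letDef x E D E', s, t, h => by
    rw [Ctx.fill, Ctx.fill]; exact (PEq.fill E h).letrec_def x _ _
  | .letDep x E Δ D E', s, t, h => by
    rw [Ctx.fill, Ctx.fill]; exact (PEq.fill E h).letrec_def x _ _

/-- Composition of contexts. -/
def Ctx.comp : Ctx Var → Ctx Var → Ctx Var
  | .hole, F => F
  | .app E N, F => .app (E.comp F) N
  | .letBody D E, F => .letBody D (E.comp F)
  | .letDef x E D E', F => .letDef x (E.comp F) D E'
  | .letDep x E Δ D E', F => .letDep x (E.comp F) Δ D E'

theorem Ctx.fill_comp : ∀ (E F : Ctx Var) (s : Tm Var), (E.comp F).fill s = E.fill (F.fill s)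
  | .hole, F, s => by simp [Ctx.comp, Ctx.fill]
  | .app E N, F, s => by simp [Ctx.comp, Ctx.fill, Ctx.fill_comp E]
  | .letBody D E, F, s => by simp [Ctx.comp, Ctx.fill, Ctx.fill_comp E]
  | .letDef x E D E', F, s => by simp [Ctx.comp, Ctx.fill, Ctx.fill_comp E]
  | .letDep x E Δ D E', F, s => by simp [Ctx.comp, Ctx.fill, Ctx.fill_comp E]

/-- A path whose open end is filled with a context. -/
def Path.comp : Path Var → Ctx Var → Path Var
  | .body E, F => .body (E.comp F)
  | .dep (.single x E) E', F => .dep (.single x (E.comp F)) E'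
  | .dep (.snoc Δ x E) E', F => .dep (.snoc Δ x (E.comp F)) E'

theorem Path.defs_comp (P : Path Var) (F : Ctx Var) (s : Tm Var) :
    (P.comp F).defs s = P.defs (F.fill s) := by
  rcases P with E | ⟨⟨x, E⟩ | ⟨Δ, x, E⟩, E'⟩ <;>
    simp [Path.comp, Path.defs, Deps.fill, Ctx.fill_comp]

theorem Path.fill_comp (P : Path Var) (F : Ctx Var) (s : Tm Var) :
    (P.comp F).fill s = P.fill (F.fill s) := by
  rcases P with E | ⟨⟨x, E⟩ | ⟨Δ, x, E⟩, E'⟩ <;>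
    simp [Path.comp, Path.fill, Deps.start, Ctx.fill_comp]

theorem Path.vars_comp (P : Path Var) (F : Ctx Var) : (P.comp F).vars = P.vars := by
  rcases P with E | ⟨⟨x, E⟩ | ⟨Δ, x, E⟩, E'⟩ <;>
    simp [Path.comp, Path.vars, Deps.vars]

theorem Deps.split {Δ : Deps Var} {x : Var} (hx : x ∈ Δ.vars) :
    Δ.start = x ∨ ∃ Δ₁ Δ₂ : Deps Var, Δ = Δ₁.append Δ₂ ∧ Δ₂.start = x := by
  cases Δ with
  | single y E => simp [Deps.vars] at hx; exact Or.inl (by simp [Deps.start, hx])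
  | snoc Δ y E =>
    simp only [Deps.vars, List.mem_append, List.mem_singleton] at hx
    rcases hx with hx | rfl
    · rcases Deps.split hx with h | ⟨Δ₁, Δ₂, h, h'⟩
      · exact Or.inl (by simpa [Deps.start] using h)
      · exact Or.inr ⟨Δ₁, .snoc Δ₂ y E, by rw [Deps.append, h], by simpa [Deps.start] using h'⟩
    · exact Or.inr ⟨Δ, .single x E, by rw [Deps.append], by rw [Deps.start]⟩

/-- Cuts a path at a variable it visits; for a variable that is demanded again, the part after the
cut is the cycle needed by the error rules. -/
theorem Path.split {P : Path Var} {x : Var} (hx : x ∈ P.vars) :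
    ∃ (Q : Path Var) (Δ : Deps Var), P = Q.ext Δ ∧ Δ.start = x := by
  cases P with
  | body E => simp [Path.vars] at hx
  | dep Δ E =>
    rcases Deps.split hx with h | ⟨Δ₁, Δ₂, rfl, h⟩
    · exact ⟨.body E, Δ, rfl, h⟩
    · exact ⟨.dep Δ₁ E, Δ₂, rfl, h⟩

/-- The context `let rec x be [], P, D in P`. -/
def Path.ctx (P : Path Var) (x : Var) (D : Defs Var) : Ctx Var :=
  match P with
  | .body E => .letDef x .hole D E
  | .dep Δ E => .letDep x .hole Δ D E

theorem Path.fill_ctx (P : Path Var) (x : Var) (D : Defs Var) (s : Tm Var) :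
    (P.ctx x D).fill s = .letrec ((x, s) :: (P.defs (.var x) ++ D)) (P.fill (.var x)) := by
  cases P <;> simp [Path.ctx, Path.defs, Path.fill, Ctx.fill]

/-! ### Scopes -/

mutual
/-- The variables that are in scope at the focus of a state with the given stack. -/
def scope : Stack Var → List Var
  | [] => []
  | .app _ :: K => scope K
  | .lets xs :: K => xs ++ scope K
  | .upd x :: K => scopeAt x K
/-- The variables that are in scope in the definition of `x`. -/
def scopeAt (x : Var) : Stack Var → List Var
  | [] => []
  | .app _ :: K => scopeAt x K
  | .lets xs :: K => if x ∈ xs then xs ++ scope K else scopeAt x K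
  | .upd _ :: K => scopeAt x K
end

/-- Every variable whose definition is under evaluation was in scope. -/
def Scoped : Stack Var → Prop
  | [] => True
  | .app _ :: K => Scoped K
  | .lets _ :: K => Scoped K
  | .upd x :: K => x ∈ scope K ∧ Scoped K

theorem scopeAt_append {x : Var} {ys : List Var} {K₁ K₂ : Stack Var} (h : x ∉ letsNames K₁)
    (hx : x ∈ ys) : scopeAt x (K₁ ++ .lets ys :: K₂) = ys ++ scope K₂ := by
  induction K₁ with
  | nil => simp [scopeAt, hx]
  | cons F K ih =>
    cases F with
    | app N => simpa [scopeAt] using ih h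
    | lets xs =>
      simp only [letsNames, List.mem_append, not_or] at h
      simpa [scopeAt, h.1] using ih h.2
    | upd y => simpa [scopeAt] using ih h

/-- A free variable of the focus that is not in scope would remain free in the whole expression. The
clause on stored definitions is what the case of an `upd` frame consumes, where the focus is the
right-hand side of a variable. -/
theorem scoped_of_closed {h : Var → Tm Var} {t : Tm Var} {K : Stack Var} (hK : StackOK K)
    (hc : (unload h t K).fv = ∅) :
    (∀ a ∈ t.fv, a ∈ scope K) ∧ Scoped K ∧
      ∀ x ∈ letsNames K, x ∉ upds K → ∀ a ∈ (h x).fv, a ∈ scopeAt x K := by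
  induction K generalizing h t with
  | nil =>
    have : t.fv = ∅ := hc
    exact ⟨by simp [this], trivial, by simp [letsNames]⟩
  | cons F K ih =>
    cases F with
    | app N =>
      obtain ⟨h1, h2, h3⟩ := ih hK hc
      refine ⟨fun a ha => ?_, h2, by simpa [letsNames, upds, scopeAt] using h3⟩
      rw [scope]
      exact h1 a (by simp [Tm.fv, ha])
    | lets xs =>
      obtain ⟨h1, h2, h3⟩ := ih hK.2.2 hc
      have key : ∀ a, ((∃ b ∈ defsOf h xs, a ∈ b.2.fv) ∨ a ∈ t.fv) → a ∈ xs ++ scope K := by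
        intro a ha
        by_cases hx : a ∈ xs
        · exact List.mem_append_left _ hx
        · exact List.mem_append_right _ (h1 a (mem_fv_letrec.2 ⟨ha, by simpa using hx⟩))
      refine ⟨fun a ha => ?_, h2, fun x hx hu a ha => ?_⟩
      · rw [scope]; exact key a (Or.inr ha)
      · rw [scopeAt]
        split_ifs with hxs
        · exact key a (Or.inl ⟨(x, h x), mem_defsOf.2 ⟨hxs, rfl⟩, ha⟩)
        · exact h3 x ((List.mem_append.1 hx).resolve_left hxs) hu a ha
    | upd x =>
      obtain ⟨h1, h2, h3⟩ := ih hK.2.2 hc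
      refine ⟨fun a ha => ?_, ⟨h1 x (by simp [Tm.fv]), h2⟩, fun y hy hu a ha => ?_⟩
      · rw [scope]
        exact h3 x hK.1 hK.2.1 a (by simpa using ha)
      · simp only [upds, List.mem_cons, not_or] at hu
        rw [scopeAt]
        exact h3 y hy hu.2 a (by simpa [hu.1] using ha)

theorem StackOK.of_append {K K' : Stack Var} (h : StackOK (K ++ K')) : StackOK K' := by
  induction K with
  | nil => exact h
  | cons F K ih =>
    cases F with
    | app N => exact ih h
    | lets xs => exact ih h.2.2
    | upd x => exact ih h.2.2

theorem Scoped.of_append {K K' : Stack Var} (h : Scoped (K ++ K')) : Scoped K' := by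
  induction K with
  | nil => exact h
  | cons F K ih =>
    cases F with
    | app N => exact ih h
    | lets xs => exact ih h
    | upd x => exact ih h.2

theorem StackOK.nodup {K : Stack Var} (h : StackOK K) : (letsNames K).Nodup := by
  induction K with
  | nil => simp [letsNames]
  | cons F K ih =>
    cases F with
    | app N => exact ih h
    | lets xs => exact h.1.append (ih h.2.2) fun x hx => h.2.1 x hx
    | upd x => exact ih h.2.2

/-! ### Stacks as contexts -/

/-- The stack segment `K` acts like the context `E`. -/
structure Seg (h : Var → Tm Var) (K : Stack Var) (E : Ctx Var) : Prop where
  upds_mem : ∀ x ∈ upds K, x ∈ letsNames K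
  unload : ∀ (g : Var → Tm Var) (s : Tm Var) (K' : Stack Var),
    (∀ x ∈ letsNames K, g x = h x) → (∀ x ∈ letsNames K, x ∉ letsNames K') →
    PEq (Letrec.unload g s (K ++ K')) (Letrec.unload g (E.fill s) K')

/-- The stack segment `K` acts like the path `P` in a `let rec` that defines `ys`. -/
structure Chain (h : Var → Tm Var) (ys : List Var) (K : Stack Var) (P : Path Var) : Prop where
  mem : ∀ x ∈ P.vars, x ∈ ys
  upds_iff : ∀ x ∈ ys, x ∈ upds K ↔ x ∈ P.vars
  nodup : P.vars.Nodup
  unload : ∀ (g : Var → Tm Var) (s : Tm Var) (K' : Stack Var),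
    (∀ x ∈ letsNames K, g x = h x) → (∀ x ∈ letsNames K, x ∉ letsNames K') →
    PEq (Letrec.unload g s (K ++ K')) (Letrec.unload (hup g (P.defs s)) (P.fill s) K')

theorem Seg.nil (h : Var → Tm Var) : Seg h [] .hole where
  upds_mem := by simp [upds]
  unload g s K' _ _ := by simpa [Ctx.fill] using PEq.refl _

theorem Seg.app (h : Var → Tm Var) (N : Tm Var) : Seg h [.app N] (.app .hole N) where
  upds_mem := by simp [upds]
  unload g s K' _ _ := by simpa [Ctx.fill, Letrec.unload] using PEq.refl _

theorem Seg.lets (h : Var → Tm Var) (xs : List Var) :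
    Seg h [.lets xs] (.letBody (defsOf h xs) .hole) where
  upds_mem := by simp [upds]
  unload g s K' hg _ := by
    rw [← defsOf_congr (h := g) fun x hx => hg x (by simp [letsNames, hx])]
    simpa [Ctx.fill, Letrec.unload] using PEq.refl _

theorem Seg.comp {h : Var → Tm Var} {K₁ K₂ : Stack Var} {E₁ E₂ : Ctx Var} (H₁ : Seg h K₁ E₁)
    (H₂ : Seg h K₂ E₂) (hd : ∀ x ∈ letsNames K₁, x ∉ letsNames K₂) :
    Seg h (K₁ ++ K₂) (E₂.comp E₁) where
  upds_mem := by
    simp only [upds_append, letsNames_append, List.mem_append]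
    exact fun x hx => hx.imp (H₁.upds_mem x) (H₂.upds_mem x)
  unload g s K' hg hK := by
    simp only [letsNames_append, List.mem_append] at hg hK
    rw [List.append_assoc, Ctx.fill_comp]
    refine (H₁.unload g s (K₂ ++ K') (fun x hx => hg x (Or.inl hx)) fun x hx => ?_).trans
      (H₂.unload g _ K' (fun x hx => hg x (Or.inr hx)) fun x hx => hK x (Or.inr hx))
    simp only [letsNames_append, List.mem_append, not_or]
    exact ⟨hd x hx, hK x (Or.inl hx)⟩

theorem Chain.nil (h : Var → Tm Var) (ys : List Var) : Chain h ys [] (.body .hole) where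
  mem := by simp [Path.vars]
  upds_iff := by simp [Path.vars, upds]
  nodup := by simp [Path.vars]
  unload g s K' _ _ := by simpa [Path.defs, Path.fill, Ctx.fill] using PEq.refl _

theorem Chain.comp {h : Var → Tm Var} {ys : List Var} {K₁ K₂ : Stack Var} {E : Ctx Var}
    {P : Path Var} (H₁ : Seg h K₁ E) (H₂ : Chain h ys K₂ P)
    (hd : ∀ x ∈ letsNames K₁, x ∉ letsNames K₂) (hy : ∀ x ∈ letsNames K₁, x ∉ ys) :
    Chain h ys (K₁ ++ K₂) (P.comp E) where
  mem := by rw [P.vars_comp]; exact H₂.mem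
  upds_iff x hx := by
    rw [P.vars_comp, upds_append, List.mem_append, ← H₂.upds_iff x hx]
    exact ⟨fun h => h.resolve_left fun h => hy x (H₁.upds_mem x h) hx, Or.inr⟩
  nodup := by rw [P.vars_comp]; exact H₂.nodup
  unload g s K' hg hK := by
    simp only [letsNames_append, List.mem_append] at hg hK
    rw [List.append_assoc, Path.fill_comp, Path.defs_comp]
    refine (H₁.unload g s (K₂ ++ K') (fun x hx => hg x (Or.inl hx)) fun x hx => ?_).trans
      (H₂.unload g _ K' (fun x hx => hg x (Or.inr hx)) fun x hx => hK x (Or.inr hx))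
    simp only [letsNames_append, List.mem_append, not_or]
    exact ⟨hd x hx, hK x (Or.inl hx)⟩

/-- When the focus becomes the definition of `x`, the path that ended in a demand for `x` gains a
link whose open end is the new focus. -/
theorem Chain.upd {h : Var → Tm Var} {ys : List Var} {K : Stack Var} {P : Path Var}
    (H : Chain h ys K P) {x : Var} (hx : x ∈ ys) (hK : x ∉ letsNames K) (hu : x ∉ upds K) :
    Chain h ys (.upd x :: K) (P.ext (.single x .hole)) where
  mem := by
    rw [P.vars_ext]
    simp only [Deps.vars, List.mem_append, List.mem_singleton]
    rintro y (hy | rfl)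
    · exact H.mem y hy
    · exact hx
  upds_iff y hy := by
    rw [P.vars_ext]
    simp only [Deps.vars, upds, List.mem_append, List.mem_cons, List.not_mem_nil, or_false,
      ← H.upds_iff y hy]
    tauto
  nodup := by
    rw [P.vars_ext]
    refine H.nodup.append (by simp [Deps.vars]) ?_
    intro y hy hy'
    simp only [Deps.vars, List.mem_singleton] at hy'
    subst hy'
    exact hu ((H.upds_iff y hx).2 hy)
  unload g s K' hg hd := by
    rw [P.defs_ext, P.fill_ext, List.cons_append, Letrec.unload, hup_append]
    simp only [Deps.start, Deps.fill, Ctx.fill]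
    refine H.unload _ (.var x) K' (fun y hy => ?_) hd
    rw [Function.update_of_ne (by rintro rfl; exact hK hy)]
    exact hg y hy

/-- The variables of a `let rec` outside a path. -/
def Path.rest (P : Path Var) (ys : List Var) : List Var := ys.filter (· ∉ P.vars)

theorem Path.mem_rest {P : Path Var} {ys : List Var} {x : Var} :
    x ∈ P.rest ys ↔ x ∈ ys ∧ x ∉ P.vars := by simp [Path.rest]

/-- The frame may define variables `zs` other than the `ys` of the chain, as long as the path is
covered. This is needed because `Fire.assoc` enlarges a frame. -/
theorem Chain.unload_lets {h : Var → Tm Var} {ys : List Var} {K : Stack Var} {P : Path Var}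
    (H : Chain h ys K P) {g : Var → Tm Var} {s : Tm Var} {zs : List Var} {K' : Stack Var}
    (hz : zs.Nodup) (hP : ∀ x ∈ P.vars, x ∈ zs) (hg : ∀ x ∈ letsNames K, g x = h x)
    (hd : ∀ x ∈ letsNames K, x ∉ zs ∧ x ∉ letsNames K') (hzK : ∀ x ∈ zs, x ∉ letsNames K') :
    PEq (Letrec.unload g s (K ++ .lets zs :: K'))
      (Letrec.unload g (.letrec (P.defs s ++ defsOf g (P.rest zs)) (P.fill s)) K') := by
  refine (H.unload g s (.lets zs :: K') hg fun x hx => ?_).trans ?_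
  · simpa [letsNames] using hd x hx
  rw [Letrec.unload, unload_congr (h' := g) (K := K')]
  · refine PEq.unload' (PEq.letrec_perm ?_ _) _
    rw [List.perm_ext_iff_of_nodup]
    · rintro ⟨x, M⟩
      rw [List.mem_append, mem_defsOf, mem_defsOf, Path.mem_rest]
      simp only
      have hPn : (names (P.defs s)).Nodup := by rw [P.names_defs]; exact H.nodup
      constructor
      · rintro ⟨hx, rfl⟩
        by_cases hv : x ∈ P.vars
        · obtain ⟨M, hM⟩ := mem_names.1 ((P.names_defs s).symm ▸ hv)
          have := hup_of_mem (h := g) hPn hM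
          simp only at this
          rw [this]; exact Or.inl hM
        · exact Or.inr ⟨⟨hx, hv⟩, hup_of_not_mem (by rwa [P.names_defs])⟩
      · rintro (hM | ⟨⟨hx, hv⟩, rfl⟩)
        · refine ⟨hP x ?_, (hup_of_mem (h := g) hPn hM).symm⟩
          rw [← P.names_defs s]; exact mem_names_of_mem hM
        · exact ⟨hx, (hup_of_not_mem (by rwa [P.names_defs])).symm⟩
    · exact nodup_of_nodup_names (by simpa using hz)
    · refine nodup_of_nodup_names ?_
      rw [names_append, P.names_defs, names_defsOf]
      exact H.nodup.append (hz.filter _) fun x hx hx' => (Path.mem_rest.1 hx').2 hx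
  · intro x hx
    refine hup_of_not_mem fun hn => hzK x (hP x ?_) hx
    rwa [P.names_defs] at hn

theorem defsOf_perm {h : Var → Tm Var} {xs ys : List Var} (H : xs.Perm ys) :
    (defsOf h xs).Perm (defsOf h ys) := H.map _

theorem defsOf_update_perm {h : Var → Tm Var} {xs : List Var} (hxs : xs.Nodup) {x : Var}
    (hx : x ∈ xs) (M : Tm Var) :
    (defsOf (Function.update h x M) xs).Perm ((x, M) :: defsOf h (xs.erase x)) := by
  refine (defsOf_perm (List.perm_cons_erase hx)).trans ?_
  have : defsOf (Function.update h x M) (xs.erase x) = defsOf h (xs.erase x) :=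
    defsOf_congr fun y hy => Function.update_of_ne (hxs.mem_erase_iff.1 hy).1 _ _
  rw [← this]
  simp [defsOf]

/-- Once the frame that defines the whole chain is included, the segment is complete and is given by
the context clause whose hole is the definition of `x`. -/
theorem Chain.seg {h : Var → Tm Var} {ys : List Var} {K : Stack Var} {P : Path Var}
    (H : Chain h ys K P) (hy : ys.Nodup) {x : Var} (hx : x ∈ ys) (hu : x ∉ upds K)
    (hd : ∀ a ∈ letsNames K, a ∉ ys) (hK : ∀ a ∈ upds K, a ∈ letsNames K ∨ a ∈ ys) :
    Seg h (.upd x :: (K ++ [.lets ys])) (P.ctx x (defsOf h ((P.rest ys).erase x))) where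
  upds_mem := by
    simp only [upds, letsNames, upds_append, letsNames_append, List.mem_append, List.mem_cons,
      List.not_mem_nil, or_false]
    rintro a (rfl | ha)
    · exact Or.inr hx
    · exact hK a ha
  unload g s K' hg hK' := by
    simp only [letsNames, letsNames_append, List.mem_append, List.not_mem_nil, or_false] at hg hK'
    have hxK : x ∉ letsNames K' := hK' x (Or.inr hx)
    have hxn : x ∉ letsNames K := fun h => hd x h hx
    rw [P.fill_ctx, List.cons_append, Letrec.unload, List.append_assoc, List.singleton_append]
    refine (H.unload_lets hy H.mem (fun a ha => ?_) (fun a ha => ⟨hd a ha, hK' a (Or.inl ha)⟩)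
      fun a ha => hK' a (Or.inr ha)).trans ?_
    · rw [Function.update_of_ne (by rintro rfl; exact hxn ha)]
      exact hg a (Or.inl ha)
    rw [unload_congr (h' := g) (K := K')]
    · refine PEq.unload' (PEq.letrec_perm ?_ _) _
      have hr : (P.rest ys).Nodup := hy.filter _
      refine ((defsOf_update_perm hr (Path.mem_rest.2 ⟨hx, fun h => hu ((H.upds_iff x hx).2 h)⟩)
        s).append_left _).trans ?_
      rw [defsOf_congr (h := g) (h' := h)]
      · exact List.perm_middle
      · intro a ha
        exact hg a (Or.inr (Path.mem_rest.1 (List.mem_of_mem_erase ha)).1)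
    · intro a ha
      exact Function.update_of_ne (by rintro rfl; exact hxK ha) _ _

theorem StackOK.append_lets {K₁ K₂ : Stack Var} {ys : List Var}
    (hK : StackOK (K₁ ++ .lets ys :: K₂)) :
    ys.Nodup ∧ (∀ a ∈ letsNames K₁, a ∉ ys) ∧ (∀ a ∈ letsNames K₁, a ∉ letsNames K₂) ∧
      (∀ a ∈ ys, a ∉ letsNames K₂) := by
  have := hK.nodup
  simp only [letsNames_append, letsNames, List.nodup_append', List.disjoint_append_right] at this
  exact ⟨this.2.1.1, fun a ha h => this.2.2.1 ha h, fun a ha h => this.2.2.2 ha h,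
    fun a ha h => this.2.1.2.2 ha h⟩

/-- A variable in scope is defined in a frame that is reached by a path. -/
theorem exists_chain (h : Var → Tm Var) {K : Stack Var} (hK : StackOK K) (hS : Scoped K) {x : Var}
    (hx : x ∈ scope K) :
    ∃ K₁ ys K₂ P, K = K₁ ++ .lets ys :: K₂ ∧ x ∈ ys ∧ Chain h ys K₁ P ∧
      ∀ a ∈ upds K₁, a ∈ letsNames K₁ ∨ a ∈ ys := by
  induction hn : K.length using Nat.strong_induction_on generalizing K x with
  | _ n ih =>
  subst hn
  cases K with
  | nil => simp [scope] at hx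
  | cons F K =>
    cases F with
    | app N =>
      rw [scope] at hx
      obtain ⟨K₁, ys, K₂, P, rfl, hy, H, hu⟩ := ih K.length (by simp) (K := K) hK hS hx rfl
      exact ⟨.app N :: K₁, ys, K₂, _, rfl, hy,
        Chain.comp (Seg.app h N) H (by simp [letsNames]) (by simp [letsNames]), hu⟩
    | lets xs =>
      rw [scope, List.mem_append] at hx
      by_cases hxs : x ∈ xs
      · exact ⟨[], xs, K, _, rfl, hxs, Chain.nil h xs, by simp [upds]⟩
      obtain ⟨K₁, ys, K₂, P, rfl, hy, H, hu⟩ :=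
        ih K.length (by simp) hK.2.2 hS (hx.resolve_left hxs) rfl
      have hd := hK.2.1
      simp only [letsNames_append, letsNames, List.mem_append, not_or] at hd
      refine ⟨.lets xs :: K₁, ys, K₂, _, rfl, hy, Chain.comp (Seg.lets h xs) H ?_ ?_, ?_⟩
      · simpa [letsNames] using fun a ha => (hd a ha).1
      · simpa [letsNames] using fun a ha => (hd a ha).2.1
      · intro a ha
        simp only [letsNames, List.mem_append]
        exact (hu a ha).imp Or.inr id
    | upd z =>
      obtain ⟨hz, hSK⟩ := hS
      obtain ⟨J₁, zs, J₂, P, rfl, hzs, H, hu⟩ := ih K.length (by simp) hK.2.2 hSK hz rfl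
      obtain ⟨hzn, d1, d2, d3⟩ := hK.2.2.append_lets
      have hzJ : z ∉ letsNames J₁ := fun h => d1 z h hzs
      have hzu : z ∉ upds J₁ := fun h => hK.2.1 (by simp [h])
      -- The definition of `z` sees its own `let rec` and what lies outside. In the first case the
      -- path gains the link `z`. In the second the segment up to the frame of `z` is a context, and
      -- the search continues in `J₂`, for which induction on the length is needed.
      rw [scope, scopeAt_append hzJ hzs, List.mem_append] at hx
      rcases hx with hx | hx
      · refine ⟨.upd z :: J₁, zs, J₂, _, rfl, hx, H.upd hzs hzJ hzu, ?_⟩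
        simp only [upds, List.mem_cons]
        rintro a (rfl | ha)
        · exact Or.inr hzs
        · exact hu a ha
      · have hJ₂ : StackOK J₂ := (hK.2.2.of_append).2.2
        obtain ⟨L₁, ys, L₂, Q, rfl, hy, H', hu'⟩ := ih J₂.length (by simp; omega) hJ₂
          (Scoped.of_append (K := J₁) (K' := .lets zs :: J₂) hSK) hx rfl
        have hseg := H.seg hzn hzs hzu d1 hu
        simp only [letsNames_append, letsNames, List.mem_append, not_or] at d2 d3
        have hc := Chain.comp hseg H'
          (by
            simp only [letsNames_append, letsNames, List.mem_append, List.not_mem_nil, or_false]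
            rintro a (ha | ha)
            · exact (d2 a ha).1
            · exact (d3 a ha).1)
          (by
            simp only [letsNames_append, letsNames, List.mem_append, List.not_mem_nil, or_false]
            rintro a (ha | ha)
            · exact (d2 a ha).2.1
            · exact (d3 a ha).2.1)
        refine ⟨.upd z :: (J₁ ++ .lets zs :: L₁), ys, L₂, _, by simp, hy, by simpa using hc, ?_⟩
        simp only [upds, letsNames, upds_append, letsNames_append, List.mem_append, List.mem_cons]
        rintro a (rfl | ha | ha)
        · tauto
        · have := hu a ha; tauto
        · have := hu' a ha; tauto

/-- Every stack acts like a context. -/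
theorem exists_seg (h : Var → Tm Var) {K : Stack Var} (hK : StackOK K) (hS : Scoped K) :
    ∃ E, Seg h K E := by
  induction hn : K.length using Nat.strong_induction_on generalizing K with
  | _ n ih =>
  subst hn
  cases K with
  | nil => exact ⟨_, Seg.nil h⟩
  | cons F K =>
    cases F with
    | app N =>
      obtain ⟨E, H⟩ := ih K.length (by simp) (K := K) hK hS rfl
      exact ⟨_, (Seg.app h N).comp H (by simp [letsNames])⟩
    | lets xs =>
      obtain ⟨E, H⟩ := ih K.length (by simp) hK.2.2 hS rfl
      exact ⟨_, (Seg.lets h xs).comp H (by simpa [letsNames] using hK.2.1)⟩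
    | upd z =>
      obtain ⟨hz, hSK⟩ := hS
      obtain ⟨J₁, zs, J₂, P, rfl, hzs, H, hu⟩ := exists_chain h hK.2.2 hSK hz
      obtain ⟨hzn, d1, d2, d3⟩ := hK.2.2.append_lets
      have hzu : z ∉ upds J₁ := fun h => hK.2.1 (by simp [h])
      obtain ⟨E, H'⟩ := ih J₂.length (by simp; omega) (hK.2.2.of_append).2.2
        (Scoped.of_append (K := J₁) (K' := .lets zs :: J₂) hSK) rfl
      have hc := (H.seg hzn hzs hzu d1 hu).comp H' (by
        simp only [letsNames_append, letsNames, List.mem_append, List.not_mem_nil, or_false]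
        rintro a (ha | ha)
        · exact d2 a ha
        · exact d3 a ha)
      exact ⟨_, by simpa using hc⟩

theorem Seg.unload_nil {h : Var → Tm Var} {K : Stack Var} {E : Ctx Var} (H : Seg h K E)
    {g : Var → Tm Var} (s : Tm Var) (hg : ∀ x ∈ letsNames K, g x = h x) :
    PEq (Letrec.unload g s K) (E.fill s) := by
  simpa [Letrec.unload] using H.unload g s [] hg (by simp [letsNames])

/-- A stack, split at the frame that defines a variable in scope. -/
theorem exists_decomposition (h : Var → Tm Var) {K : Stack Var} (hK : StackOK K) (hS : Scoped K)
    {x : Var} (hx : x ∈ scope K) :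
    ∃ (K₁ : Stack Var) (ys : List Var) (K₂ : Stack Var) (P : Path Var) (E : Ctx Var), K = K₁ ++ .lets ys :: K₂ ∧ x ∈ ys ∧
      (∀ a ∈ P.vars, a ∈ ys) ∧ (∀ a ∈ ys, a ∈ upds K₁ ↔ a ∈ P.vars) ∧
      ∀ (g : Var → Tm Var) (s : Tm Var) (zs : List Var), zs.Nodup → (∀ a ∈ P.vars, a ∈ zs) →
        (∀ a ∈ letsNames K₁, g a = h a) → (∀ a ∈ letsNames K₂, g a = h a) →
        (∀ a ∈ zs, a ∉ letsNames K₁ ∧ a ∉ letsNames K₂) →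
        PEq (unload g s (K₁ ++ .lets zs :: K₂))
          (E.fill (.letrec (P.defs s ++ defsOf g (P.rest zs)) (P.fill s))) := by
  obtain ⟨K₁, ys, K₂, P, rfl, hy, H, hu⟩ := exists_chain h hK hS hx
  obtain ⟨hyn, d1, d2, d3⟩ := hK.append_lets
  obtain ⟨E, H'⟩ := exists_seg h (hK.of_append).2.2 (Scoped.of_append (K := K₁) (K' := .lets ys :: K₂) hS)
  refine ⟨K₁, ys, K₂, P, E, rfl, hy, H.mem, H.upds_iff, fun g s zs hz hP h1 h2 hd => ?_⟩
  refine (H.unload_lets hz hP h1 (fun a ha => ⟨fun h => (hd a h).1 ha, d2 a ha⟩)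
    fun a ha => (hd a ha).2).trans (H'.unload_nil _ h2)

end Decomposition

-- Firing states perform reduction steps.

section Contraction

variable {Var : Type u} [DecidableEq Var]

/-- `PEq` replaces plain α-equivalence so that the decomposed expression inherits distinct binders
from the state. -/
theorem exists_redex_of_fire {s : State Var} {r : Tm Var} (hs : s.Canonical)
    (hc : s.unload.fv = ∅) (hf : Fire s r) :
    ∃ (E : Ctx Var) (R R' : Tm Var), Redex R R' ∧ PEq s.unload (E.fill R) ∧ PEq r (E.fill R') := by
  obtain ⟨hn, hb⟩ := hs.focus
  obtain ⟨hK, -⟩ := hs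
  obtain ⟨hfv, hS, -⟩ := scoped_of_closed hK hc
  cases hf with
  | beta h x M N K hx =>
    obtain ⟨E, H⟩ := exists_seg h (K := K) hK hS
    exact ⟨E, _, _, .beta_need x M N, H.unload_nil _ fun _ _ => rfl, H.unload_nil _ fun _ _ => rfl⟩
  | error_beta h N K =>
    obtain ⟨E, H⟩ := exists_seg h (K := K) hK hS
    exact ⟨E, _, _, .error_beta N, H.unload_nil _ fun _ _ => rfl, H.unload_nil _ fun _ _ => rfl⟩
  | lift h D A N K hA hD =>
    obtain ⟨E, H⟩ := exists_seg h (K := K) hK hS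
    exact ⟨E, _, _, .lift D A N hA, H.unload_nil _ fun _ _ => rfl, H.unload_nil _ fun _ _ => rfl⟩
  | deref h V x K hV =>
    obtain ⟨hxK, hxu, hK⟩ := hK
    obtain ⟨K₁, ys, K₂, P, E, rfl, hxy, hP, hPu, H⟩ := exists_decomposition h hK hS.2 hS.1
    obtain ⟨hyn, d1, d2, d3⟩ := hK.append_lets
    have hxP : x ∉ P.vars := fun h => hxu (by simp [(hPu x hxy).2 h])
    -- The decomposition is uniform in the focus `s`, so one context and one path serve both the
    -- redex, with `.var x`, and the contractum, with `V`.
    have key := fun s => H (Function.update h x V) s ys hyn hP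
      (fun a ha => Function.update_of_ne (by rintro rfl; exact d1 a ha hxy) _ _)
      (fun a ha => Function.update_of_ne (by rintro rfl; exact d3 a hxy ha) _ _)
      fun a ha => ⟨fun h => d1 a h ha, d3 a ha⟩
    have hp := defsOf_update_perm (h := h) (hyn.filter _) (Path.mem_rest.2 ⟨hxy, hxP⟩) V
    have key' := fun s => (key s).trans
      (PEq.fill E (PEq.letrec_perm (hp.append_left (P.defs s)) (P.fill s)))
    refine ⟨E, _, _, ?_, key' (.var x), key' V⟩
    generalize defsOf h _ = D
    cases P with
    | body F => exact .deref x V D F hV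
    | dep Δ F => exact .deref_env Δ x V D F hV
  | assoc h D A x K hA hD =>
    obtain ⟨hxK, hxu, hK⟩ := hK
    obtain ⟨K₁, ys, K₂, P, E, rfl, hxy, hP, hPu, H⟩ := exists_decomposition h hK hS.2 hS.1
    obtain ⟨hyn, d1, d2, d3⟩ := hK.append_lets
    have hxP : x ∉ P.vars := fun h => hxu (by simp [(hPu x hxy).2 h])
    have hDn : (names D).Nodup := nodup_names_of_binders hn
    simp only [letsNames_append, letsNames, List.mem_append, not_or] at hD
    have hxD : x ∉ names D := fun h => (hD x h).2.1 hxy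
    have key := H (Function.update h x (.letrec D A)) (.var x) ys hyn hP
      (fun a ha => Function.update_of_ne (by rintro rfl; exact d1 a ha hxy) _ _)
      (fun a ha => Function.update_of_ne (by rintro rfl; exact d3 a hxy ha) _ _)
      fun a ha => ⟨fun h => d1 a h ha, d3 a ha⟩
    have hp := defsOf_update_perm (h := h) (hyn.filter _) (Path.mem_rest.2 ⟨hxy, hxP⟩) (.letrec D A)
    have key₁ := key.trans
      (PEq.fill E (PEq.letrec_perm ((hp.append_left (P.defs (.var x))).trans List.perm_middle)
        (P.fill (.var x))))
    -- This reads back the contractum: the frame of `x` is enlarged by the variables of `D`, whose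
    -- definitions come from the extended heap, and the rest of the decomposition is unchanged.
    have key₂ := H (Function.update (hup h D) x A) (.var x) (names D ++ ys)
      (hDn.append hyn fun a ha h => (hD a ha).2.1 h)
      (fun a ha => List.mem_append_right _ (hP a ha))
      (fun a ha => by
        rw [Function.update_of_ne (by rintro rfl; exact d1 a ha hxy)]
        exact hup_of_not_mem fun h => (hD a h).1 ha)
      (fun a ha => by
        rw [Function.update_of_ne (by rintro rfl; exact d3 a hxy ha)]
        exact hup_of_not_mem fun h => (hD a h).2.2 ha)
      (fun a ha => by
        rcases List.mem_append.1 ha with ha | ha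
        · exact ⟨(hD a ha).1, (hD a ha).2.2⟩
        · exact ⟨fun h => d1 a h ha, d3 a ha⟩)
    have hrest : P.rest (names D ++ ys) = names D ++ P.rest ys := by
      rw [Path.rest, List.filter_append, Path.rest, List.filter_eq_self.2]
      intro a ha
      simpa using fun h => (hD a ha).2.1 (hP a h)
    have hp₂ : (defsOf (Function.update (hup h D) x A) (P.rest (names D ++ ys))).Perm
        (D ++ (x, A) :: defsOf h ((P.rest ys).erase x)) := by
      rw [hrest, defsOf, List.map_append]
      refine List.Perm.append (List.Perm.of_eq ?_) ?_
      · have e := defsOf_hup (h := Function.update h x A) hDn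
        rwa [hup_update_comm hxD] at e
      · have e := defsOf_update_perm (h := hup h D) (hyn.filter _)
          (Path.mem_rest.2 ⟨hxy, hxP⟩) A
        rwa [defsOf_congr (h := hup h D) (h' := h)] at e
        intro a ha
        exact hup_of_not_mem fun h => (hD a h).2.1
          (Path.mem_rest.1 (List.mem_of_mem_erase ha)).1
    have hp₃ : ∀ D₁ D₂ : Defs Var, (D₁ ++ (D ++ (x, A) :: D₂)).Perm (D ++ (x, A) :: (D₁ ++ D₂)) := by
      intro D₁ D₂
      rw [← List.append_assoc]
      refine (List.perm_append_comm.append_right _).trans ?_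
      rw [List.append_assoc]
      exact List.Perm.append_left D List.perm_middle
    have key₃ := key₂.trans (PEq.fill E (PEq.letrec_perm ((hp₂.append_left (P.defs (.var x))).trans
      (hp₃ _ _)) (P.fill (.var x))))
    have hadd : addTo x (names D) (K₁ ++ .lets ys :: K₂) = K₁ ++ .lets (names D ++ ys) :: K₂ :=
      addTo_append (fun h => d1 x h hxy) hxy
    rw [hadd]
    refine ⟨E, _, _, ?_, key₁, key₃⟩
    rw [Path.rest]
    generalize defsOf h _ = D'
    cases P with
    | body F => exact .assoc x D A D' F hA
    | dep Δ F => exact .assoc_env x D A Δ D' F hA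
  | error h x K hxu =>
    have hx := hfv x (by simp [Tm.fv])
    obtain ⟨K₁, ys, K₂, P, E, rfl, hxy, hP, hPu, H⟩ := exists_decomposition h hK hS hx
    obtain ⟨hyn, d1, d2, d3⟩ := hK.append_lets
    have hxP : x ∈ P.vars := by
      rw [← hPu x hxy]
      simp only [upds_append, upds, List.mem_append] at hxu
      exact hxu.resolve_right fun h =>
        d3 x hxy ((StackOK.of_append (K := K₁) (K' := .lets ys :: K₂) hK).2.2.upds_subset h)
    have key := fun s => H h s ys hyn hP (fun _ _ => rfl) (fun _ _ => rfl)
      fun a ha => ⟨fun h => d1 a h ha, d3 a ha⟩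
    generalize defsOf h _ = D at key
    -- The demanded variable already lies on the path; cutting there exhibits the cycle `Δ`.
    obtain ⟨Q, Δ, rfl, rfl⟩ := Path.split hxP
    simp only [Path.defs_ext, Path.fill_ext] at key
    have hp : ∀ D₁ D₂ : Defs Var, (D₁ ++ D₂ ++ D).Perm (D₂ ++ (D₁ ++ D)) := by
      intro D₁ D₂
      rw [← List.append_assoc]
      exact List.perm_append_comm.append_right _
    have key' := fun s => (key s).trans
      (PEq.fill E (PEq.letrec_perm (hp _ (Δ.fill s)) (Q.fill (.var Δ.start))))
    refine ⟨E, _, _, ?_, key' (.var Δ.start), key' .bh⟩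
    cases Q with
    | body F => exact .error Δ D F
    | dep Δ' F => exact .error_env Δ Δ' D F

/-- Contractions of closed states are reduction steps. -/
theorem step_of_fire [Infinite Var] {s : State Var} {r : Tm Var} (hK : StackOK s.stack)
    (hw : s.unload.WF) (hc : s.unload.fv = ∅) (hf : Fire s r) :
    Step s.unload.cls r.cls ∧ r.fv = ∅ ∧ r.WF := by
  -- Reduction asks for a canonical representative, but states may share binder names after values
  -- have been copied. A representative with distinct binders is chosen, pulled back to a related
  -- state and decomposed there; its contractum is then compared with `r`.
  obtain ⟨T, hT, hTn, -⟩ := exists_nodup_binders hw ∅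
  have ha := hT.aeq hw
  obtain ⟨R, s', H, rfl⟩ := exists_sRel (h := s.heap) (t := s.focus) hK hTn hc ha
  have hs' : s'.Canonical := ⟨H.ok', hTn⟩
  have hc' : s'.unload.fv = ∅ := by rw [← ha.fv_eq, hc]
  obtain ⟨r', hf'⟩ := hf.transport H hs'.focus.2
  obtain ⟨E, Q, Q', hQ, h1, h2⟩ := exists_redex_of_fire hs' hc' hf'
  obtain ⟨R', hR'⟩ := hf.rel H hf'
  have hstep : Step s.unload.cls (E.fill Q').cls := by
    have hn : (E.fill Q).binders.Nodup := h1.2.nodup_iff.1 hTn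
    have he : (E.fill Q).cls = s.unload.cls := Quotient.sound (h1.1.symm.trans hT.symm)
    refine ⟨E, Q, Q', hQ, ⟨hn, ?_⟩, he, rfl⟩
    rw [(h1.1.symm.aeq (wf_of_nodup_binders hn)).fv_eq, hc']
    simp
  have hcl : ClosedCls (E.fill Q').cls := ClosedCls.step ⟨_, rfl, hw, hc⟩ hstep
  have hr' : r'.cls = (E.fill Q').cls := Quotient.sound h2.1
  obtain ⟨hw', hf'⟩ := hcl.fv_eq hr'
  have hr : r.fv = ∅ := hR'.symm.closed_right hf'
  refine ⟨?_, hr, hR'.wf_left⟩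
  rw [(hR'.of_closed (S := Eq) hr).cls_eq, hr']
  exact hstep

end Contraction

-- Natural semantics is simulated by reduction.

section Simulation

variable {Var : Type u} [DecidableEq Var]

/-- A heap as a total function. -/
def hfun (Ψ : Heap Var) (x : Var) : Tm Var := (Ψ.lookup x).getD .bh

theorem hfun_of_lookup {Ψ : Heap Var} {x : Var} {M : Tm Var} (h : Ψ.lookup x = some M) :
    hfun Ψ x = M := by simp [hfun, h]

theorem lookup_of_mem {Ψ : Heap Var} {x : Var} (h : x ∈ Ψ) : Ψ.lookup x = some (hfun Ψ x) := by
  obtain ⟨M, hM⟩ := Finmap.mem_iff.1 h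
  rw [hM, hfun_of_lookup hM]

@[simp] theorem hfun_insert (Ψ : Heap Var) (x : Var) (M : Tm Var) :
    hfun (Ψ.insert x M) = Function.update (hfun Ψ) x M := by
  funext y
  by_cases hy : y = x
  · subst hy; simp [hfun]
  · simp [hfun, hy, Finmap.lookup_insert_of_ne]

@[simp] theorem hfun_extend (Ψ : Heap Var) (D : Defs Var) :
    hfun (Ψ.extend D) = hup (hfun Ψ) D := by
  induction D with
  | nil => rfl
  | cons b D ih =>
    rw [hup_cons, ← ih, ← hfun_insert]
    rfl

theorem mem_extend {Ψ : Heap Var} {D : Defs Var} {x : Var} :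
    x ∈ Ψ.extend D ↔ x ∈ names D ∨ x ∈ Ψ := by
  induction D with
  | nil => simp [Heap.extend]
  | cons b D ih =>
    rw [show Ψ.extend (b :: D) = (Ψ.extend D).insert b.1 b.2 from rfl, Finmap.mem_insert, ih]
    simp [or_assoc]

theorem mem_heap_occ {Ψ : Heap Var} {x : Var} (h : x ∈ Ψ) : x ∈ Ψ.occ :=
  ⟨x, _, lookup_of_mem h, Or.inl rfl⟩

theorem exists_finset_heap_occ (Ψ : Heap Var) : ∃ S : Finset Var, Ψ.occ ⊆ S := by
  refine ⟨Ψ.keys.biUnion fun y => insert y (hfun Ψ y).occ, ?_⟩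
  rintro x ⟨y, M, hM, hx⟩
  simp only [Finset.coe_biUnion, Set.mem_iUnion, Finset.mem_coe, Finmap.mem_keys,
    Finset.mem_insert]
  exact ⟨y, Finmap.mem_iff.2 ⟨M, hM⟩, by rwa [hfun_of_lookup hM]⟩

theorem Eval.isValue {Ψ Φ : Heap Var} {M V : Tm Var} (h : Eval Ψ M Φ V) : IsValue V := by
  induction h with
  | value h => exact h
  | app _ _ _ _ _ _ ih => exact ih
  | var _ _ ih => exact ih
  | letrec _ _ ih => exact ih
  | error_beta => exact .bh

theorem Alpha.unload {h h' : Var → Tm Var} {t t' : Tm Var} (H : ∀ x, Alpha (h x) (h' x))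
    (ht : Alpha t t') (K : Stack Var) : Alpha (unload h t K) (unload h' t' K) := by
  induction K generalizing h h' t t' with
  | nil => exact ht
  | cons F K ih =>
    cases F with
    | app N => exact ih H (ht.app (.refl N))
    | lets xs =>
      refine ih H (Alpha.trans (Alpha.letrec_defs t ?_ []) (ht.letrec_body _))
      exact List.forall₂_map_left_iff.2 (List.forall₂_map_right_iff.2
        (List.forall₂_same.2 fun x _ => ⟨rfl, H x⟩))
    | upd x =>
      refine ih (fun y => ?_) (.refl _)
      simp only [Function.update]
      split_ifs with hy
      · subst hy; exact ht
      · exact H y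

theorem cls_unload {h : Var → Tm Var} {t t' : Tm Var} (ht : Alpha t t') (K : Stack Var) :
    (unload h t K).cls = (unload h t' K).cls :=
  Quotient.sound (Alpha.unload (fun _ => .refl _) ht K)

theorem wf_of_unload {h : Var → Tm Var} {t : Tm Var} {K : Stack Var} (hK : StackOK K)
    (hw : (unload h t K).WF) :
    t.WF ∧ ∀ x ∈ letsNames K, x ∉ upds K → (h x).WF := by
  induction K generalizing h t with
  | nil => exact ⟨hw, by simp [letsNames]⟩
  | cons F K ih =>
    cases F with
    | app N =>
      obtain ⟨h1, h2⟩ := ih hK hw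
      cases h1 with
      | app h1 _ => exact ⟨h1, h2⟩
    | lets xs =>
      obtain ⟨h1, h2⟩ := ih hK.2.2 hw
      obtain ⟨-, h3, h4⟩ := Tm.WF.letrec_iff.1 h1
      refine ⟨h4, fun x hx hu => ?_⟩
      rcases List.mem_append.1 hx with hx | hx
      · exact h3 (x, h x) (mem_defsOf.2 ⟨hx, rfl⟩)
      · exact h2 x hx hu
    | upd x =>
      obtain ⟨-, h2⟩ := ih hK.2.2 hw
      refine ⟨by simpa using h2 x hK.1 hK.2.1, fun y hy hu => ?_⟩
      simp only [upds, List.mem_cons, not_or] at hu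
      simpa [hu.1] using h2 y hy hu.2

theorem ClosedCls.reduces {c c' : Cls Var} (hc : ClosedCls c) (h : Reduces c c') :
    ClosedCls c' := by
  induction h with
  | refl => exact hc
  | tail _ h ih => exact ih.step h

theorem step_of_fire_cls [Infinite Var] {s : State Var} {r : Tm Var} (hK : StackOK s.stack)
    (hc : ClosedCls s.unload.cls) (hf : Fire s r) : Step s.unload.cls r.cls :=
  (step_of_fire hK (hc.fv_eq rfl).1 (hc.fv_eq rfl).2 hf).1

/-- Frames that agree, except that more variables may be defined. -/
inductive FExt : Frame Var → Frame Var → Prop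
  | app (N : Tm Var) : FExt (.app N) (.app N)
  | lets (xs ys : List Var) : FExt (.lets xs) (.lets ys)
  | upd (x : Var) : FExt (.upd x) (.upd x)

theorem FExt.refl (F : Frame Var) : FExt F F := by
  cases F
  · exact .app _
  · exact .lets _ _
  · exact .upd _

theorem FExt.trans {F G H : Frame Var} (h : FExt F G) (h' : FExt G H) : FExt F H := by
  cases h <;> cases h' <;> constructor

/-- Stacks that agree, except that more variables may be defined in their frames. -/
def KExt : Stack Var → Stack Var → Prop := List.Forall₂ FExt

theorem KExt.refl (K : Stack Var) : KExt K K := List.forall₂_same.2 fun F _ => .refl F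

theorem KExt.trans {K K' K'' : Stack Var} (h : KExt K K') (h' : KExt K' K'') : KExt K K'' := by
  induction h generalizing K'' with
  | nil => cases h'; exact .nil
  | cons hF _ ih =>
    cases h' with
    | cons hF' h' => exact .cons (hF.trans hF') (ih h')

theorem kExt_addTo (x : Var) (xs : List Var) (K : Stack Var) : KExt K (addTo x xs K) := by
  induction K with
  | nil => exact .nil
  | cons F K ih =>
    cases F with
    | app N => exact .cons (.app N) ih
    | lets ys =>
      rw [addTo]
      split_ifs
      · exact .cons (.lets _ _) (KExt.refl K)
      · exact .cons (.lets _ _) ih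
    | upd y => exact .cons (.upd y) ih

theorem KExt.split_lets {Ls : List (List Var)} {K J : Stack Var} (h : KExt (Ls.map .lets ++ K) J) :
    ∃ (Ls' : List (List Var)) (K' : Stack Var), J = Ls'.map .lets ++ K' ∧ KExt K K' := by
  induction Ls generalizing J with
  | nil => exact ⟨[], J, rfl, h⟩
  | cons xs Ls ih =>
    cases h with
    | cons hF h =>
      cases hF with
      | lets _ ys =>
        obtain ⟨Ls', K', rfl, h'⟩ := ih h
        exact ⟨ys :: Ls', K', rfl, h'⟩

theorem letsNames_map_lets (Ls : List (List Var)) : letsNames (Ls.map .lets) = Ls.flatten := by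
  induction Ls with
  | nil => rfl
  | cons xs Ls ih => simp [letsNames, ih]

@[simp] theorem upds_map_lets (Ls : List (List Var)) : upds (Ls.map Frame.lets) = [] := by
  induction Ls with
  | nil => rfl
  | cons xs Ls ih => simpa [upds] using ih

theorem isAnswer_unload_lets (h : Var → Tm Var) {A : Tm Var} (hA : IsAnswer A)
    (Ls : List (List Var)) : IsAnswer (unload h A (Ls.map .lets)) := by
  induction Ls generalizing A with
  | nil => exact hA
  | cons xs Ls ih => exact ih (.letrec _ hA)

theorem unload_lets_concat (h : Var → Tm Var) (t : Tm Var) (Ls : List (List Var))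
    (xs : List Var) : unload h t ((Ls ++ [xs]).map .lets) =
      .letrec (defsOf h xs) (unload h t (Ls.map .lets)) := by
  rw [List.map_append, unload_append]
  rfl

theorem stackOK_append_app {J K : Stack Var} {N : Tm Var} :
    StackOK (J ++ .app N :: K) ↔ StackOK (J ++ K) := by
  induction J with
  | nil => rfl
  | cons F J ih =>
    cases F with
    | app M => exact ih
    | lets xs =>
      simp only [List.cons_append, StackOK, ih, letsNames_append, letsNames]
    | upd x =>
      simp only [List.cons_append, StackOK, ih, letsNames_append, letsNames, upds_append, upds]

/-- An argument moves into the `let rec` frames of an answer. -/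
theorem lift_reduces [Infinite Var] {h : Var → Tm Var} {V N : Tm Var} (hV : IsValue V)
    {Ls : List (List Var)} {K : Stack Var} (hK : StackOK (Ls.map .lets ++ .app N :: K))
    (hc : ClosedCls (unload h V (Ls.map .lets ++ .app N :: K)).cls) :
    Reduces (unload h V (Ls.map .lets ++ .app N :: K)).cls
      (unload h V (.app N :: (Ls.map .lets ++ K))).cls := by
  -- The last frame of `Ls` is the outermost one, next to the argument, and the first to be passed
  -- by a lift step.
  induction Ls using List.reverseRecOn generalizing K with
  | nil => exact .refl
  | append_singleton Ls xs ih =>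
    have hK' : StackOK (.lets xs :: .app N :: K) := by
      refine StackOK.of_append (K := Ls.map .lets) ?_
      simpa using hK
    have hs : Step (unload h V ((Ls ++ [xs]).map .lets ++ .app N :: K)).cls
        (unload h V (Ls.map .lets ++ .app N :: .lets xs :: K)).cls := by
      rw [unload_append] at hc ⊢
      rw [unload_lets_concat] at hc ⊢
      rw [unload_append h V Ls]
      exact step_of_fire_cls (s := ⟨h, _, .app N :: K⟩) hK'.2.2 hc
        (.lift h _ _ N K (isAnswer_unload_lets h (.value hV) Ls) (by rw [names_defsOf]; exact hK'.2.1))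
    have hok : StackOK (Ls.map .lets ++ .app N :: .lets xs :: K) := by
      rw [stackOK_append_app] at hK ⊢
      simpa using hK
    have := ih hok (hc.step hs)
    refine .head hs ?_
    rw [List.map_append, List.append_assoc]
    exact this

/-- The `let rec` frames around the definition of a variable move into its own frame. -/
theorem assoc_reduces [Infinite Var] {h : Var → Tm Var} {V : Tm Var} {x : Var} (hV : IsValue V)
    {Ls : List (List Var)} {K : Stack Var} (hK : StackOK (Ls.map .lets ++ .upd x :: K))
    (hc : ClosedCls (unload h V (Ls.map .lets ++ .upd x :: K)).cls) :
    ∃ K', KExt K K' ∧ StackOK (.upd x :: K') ∧ upds K' = upds K ∧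
      (∀ a, a ∈ letsNames K' ↔ a ∈ letsNames (Ls.map .lets ++ .upd x :: K)) ∧
      Reduces (unload h V (Ls.map .lets ++ .upd x :: K)).cls
        (unload h V (.upd x :: K')).cls := by
  induction Ls using List.reverseRecOn generalizing K with
  | nil => exact ⟨K, .refl K, hK, rfl, fun _ => Iff.rfl, .refl⟩
  | append_singleton Ls xs ih =>
    have hK' : StackOK (.lets xs :: .upd x :: K) := by
      refine StackOK.of_append (K := Ls.map .lets) ?_
      simpa using hK
    obtain ⟨hxs, hd, hxK, hxu, hKK⟩ := hK'
    have hs : Step (unload h V ((Ls ++ [xs]).map .lets ++ .upd x :: K)).cls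
        (unload h V (Ls.map .lets ++ .upd x :: addTo x xs K)).cls := by
      rw [unload_append] at hc ⊢
      rw [unload_lets_concat] at hc ⊢
      rw [unload_append h V Ls]
      have hf := Fire.assoc h (defsOf h xs) _ x K (isAnswer_unload_lets h (.value hV) Ls)
        (by rw [names_defsOf]; exact hd)
      -- The heap holds the lifted definitions already, so only the stack changes.
      rw [hup_defsOf, names_defsOf] at hf
      exact step_of_fire_cls (s := ⟨h, _, .upd x :: K⟩) ⟨hxK, hxu, hKK⟩ hc hf
    have hnames : ∀ a, a ∈ letsNames (addTo x xs K) ↔ a ∈ xs ∨ a ∈ letsNames K := by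
      intro a; rw [mem_letsNames_addTo]; tauto
    have hok : StackOK (Ls.map .lets ++ .upd x :: addTo x xs K) := by
      clear ih hc hs
      have hadd := StackOK.addTo (x := x) hKK hxs hd
      induction Ls with
      | nil => exact ⟨(hnames x).2 (Or.inr hxK), by simpa using hxu, hadd⟩
      | cons ys Ls ih =>
        obtain ⟨h1, h2, h3⟩ := hK
        refine ⟨h1, fun a ha h' => h2 a ha ?_, ih h3⟩
        change a ∈ letsNames ((Ls ++ [xs]).map .lets ++ .upd x :: K)
        change a ∈ letsNames (Ls.map .lets ++ .upd x :: addTo x xs K) at h'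
        simp only [letsNames_append, letsNames, List.mem_append, hnames, List.map_append,
          List.map_cons, List.map_nil, List.append_nil] at h' ⊢
        tauto
    obtain ⟨K', h1, h2, h3, h4, h5⟩ := ih hok (hc.step hs)
    refine ⟨K', (kExt_addTo x xs K).trans h1, h2, by simpa using h3, fun a => ?_, .head hs h5⟩
    rw [h4]
    simp only [letsNames_append, letsNames, List.mem_append, hnames, List.map_append,
      List.map_cons, List.map_nil, List.append_nil]
    tauto

/-- The configuration of heap, focus and stack represents a closed expression; the heap defines
the variables of the stack, and `•` for those under evaluation. -/
structure Inv (Ψ : Heap Var) (t : Tm Var) (K : Stack Var) : Prop where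
  ok : StackOK K
  dom : ∀ x, x ∈ Ψ ↔ x ∈ letsNames K
  upd : ∀ x ∈ upds K, hfun Ψ x = .bh
  closed : ClosedCls (unload (hfun Ψ) t K).cls

theorem Inv.app {Ψ : Heap Var} {M N : Tm Var} {K : Stack Var} (H : Inv Ψ (.app M N) K) :
    Inv Ψ M (.app N :: K) := ⟨H.ok, H.dom, H.upd, H.closed⟩

theorem names_renameAll (f : Var → Var) (D : Defs Var) : names (renameAll f D) = (names D).map f := by
  simp [names, renameAll, Function.comp_def]

/-- Freshness for the heap is more than α-conversion of the `let rec` requires. It also keeps the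
new names out of the stack, whose variables form the domain of the heap. -/
theorem Inv.enter_letrec {Ψ : Heap Var} {D : Defs Var} {N : Tm Var} {K : Stack Var}
    (H : Inv Ψ (.letrec D N) K) {f : Var → Var}
    (hf : Freshening (names D) (Ψ.occ ∪ (Tm.letrec D N).occ) f) :
    Inv (Ψ.extend (renameAll f D)) (N.rename f) (.lets (names (renameAll f D)) :: K) ∧
      (unload (hfun Ψ) (.letrec D N) K).cls = (unload (hfun (Ψ.extend (renameAll f D))) (N.rename f)
        (.lets (names (renameAll f D)) :: K)).cls := by
  have ha : Alpha (.letrec D N) (.letrec (renameAll f D) (N.rename f)) :=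
    .letrec_rename ⟨hf.1, fun x hx h => hf.2.1 x hx (Or.inr h), hf.2.2⟩
  have hw := (ha.wf_iff.1 (wf_of_unload H.ok (H.closed.fv_eq rfl).1).1)
  have hn := (Tm.WF.letrec_iff.1 hw).1
  have hd : ∀ x ∈ names (renameAll f D), x ∉ Ψ := by
    intro x hx h
    rw [names_renameAll] at hx
    obtain ⟨y, hy, rfl⟩ := List.mem_map.1 hx
    exact hf.2.1 y hy (Or.inl (mem_heap_occ h))
  have hdK : ∀ x ∈ names (renameAll f D), x ∉ letsNames K := fun x hx h =>
    hd x hx ((H.dom x).2 h)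
  have hcls : (unload (hfun Ψ) (.letrec D N) K).cls = (unload (hfun (Ψ.extend (renameAll f D)))
      (N.rename f) (.lets (names (renameAll f D)) :: K)).cls := by
    rw [hfun_extend, unload_enter_letrec hn hdK]
    exact cls_unload ha K
  refine ⟨⟨⟨hn, hdK, H.ok⟩, fun x => ?_, fun x hx => ?_, hcls ▸ H.closed⟩, hcls⟩
  · rw [mem_extend, H.dom]; simp [letsNames]
  · rw [hfun_extend, hup_of_not_mem fun h => hdK x h (H.ok.upds_subset hx)]
    exact H.upd x hx

/-- Storing • does not affect unloading, since the `upd` frame overwrites the entry; it lets the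
natural semantics recognize a cycle. -/
theorem Inv.enter_var {Ψ : Heap Var} {x : Var} {K : Stack Var} (H : Inv Ψ (.var x) K)
    (hx : x ∈ letsNames K) (hu : x ∉ upds K) :
    Inv (Ψ.insert x .bh) (hfun Ψ x) (.upd x :: K) ∧
      unload (hfun (Ψ.insert x .bh)) (hfun Ψ x) (.upd x :: K) = unload (hfun Ψ) (.var x) K := by
  have he : unload (hfun (Ψ.insert x .bh)) (hfun Ψ x) (.upd x :: K) =
      unload (hfun Ψ) (.var x) K := by
    rw [hfun_insert, unload, Function.update_idem, Function.update_eq_self]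
  refine ⟨⟨⟨hx, hu, H.ok⟩, fun y => ?_, fun y hy => ?_, he ▸ H.closed⟩, he⟩
  · rw [Finmap.mem_insert, H.dom]
    simp only [letsNames]
    exact ⟨fun h => h.elim (fun h => h ▸ hx) id, Or.inr⟩
  · rw [hfun_insert]
    by_cases hyx : y = x
    · simp [hyx]
    · rw [Function.update_of_ne hyx]
      exact H.upd y ((List.mem_cons.1 hy).resolve_left hyx)

/-- After the function of an application has been evaluated, the application is contracted. -/
theorem Inv.beta [Infinite Var] {Φ : Heap Var} {x x' : Var} {N M : Tm Var} {Ls : List (List Var)}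
    {K : Stack Var} (H : Inv Φ (.lam x N) (Ls.map .lets ++ .app M :: K)) (h₁ : x' ∉ Φ.occ)
    (h₂ : x' ∉ (Tm.lam x N).occ) :
    Inv (Φ.insert x' M) (N.subst x' x) (.lets [x'] :: (Ls.map .lets ++ K)) ∧
      Relation.TransGen Step (unload (hfun Φ) (.lam x N) (Ls.map .lets ++ .app M :: K)).cls
        (unload (hfun (Φ.insert x' M)) (N.subst x' x) (.lets [x'] :: (Ls.map .lets ++ K))).cls := by
  have hred := lift_reduces (.lam x N) H.ok H.closed
  have hok : StackOK (Ls.map .lets ++ K) := stackOK_append_app.1 H.ok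
  have hdom : ∀ y, y ∈ Φ ↔ y ∈ letsNames (Ls.map .lets ++ K) := by
    intro y; rw [H.dom]; simp [letsNames]
  have hx' : x' ∉ letsNames (Ls.map .lets ++ K) := fun h => h₁ (mem_heap_occ ((hdom x').2 h))
  have hc := H.closed.reduces hred
  have ha : Alpha (.lam x N) (.lam x' (N.subst x' x)) := .lam_rename h₂
  have he := cls_unload (h := hfun Φ) ha (.app M :: (Ls.map .lets ++ K))
  rw [he] at hred hc
  have hs := step_of_fire_cls (s := ⟨hfun Φ, _, .app M :: (Ls.map Frame.lets ++ K)⟩) hok hc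
    (.beta _ x' _ M _ hx')
  have hu := unload_enter_letrec (h := hfun Φ) (D := [(x', M)]) (t := N.subst x' x)
    (K := Ls.map .lets ++ K) (by simp) (by simpa using hx')
  rw [← hu] at hs
  have e : hfun (Φ.insert x' M) = hup (hfun Φ) [(x', M)] := by rw [hfun_insert]; rfl
  rw [e]
  refine ⟨⟨⟨by simp, by simpa using hx', hok⟩, fun y => ?_, fun y hy => ?_, ?_⟩,
    Relation.TransGen.tail' hred hs⟩
  · rw [Finmap.mem_insert, hdom]; simp [letsNames]
  · rw [hfun_insert, Function.update_of_ne]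
    · exact H.upd y (by simpa [upds] using hy)
    · rintro rfl
      exact hx' (hok.upds_subset (by simpa [upds] using hy))
  · rw [e]; exact hc.step hs

/-- The natural semantics is simulated by reduction. -/
theorem Eval.reduces [Infinite Var] {Ψ Φ : Heap Var} {M V : Tm Var} (h : Eval Ψ M Φ V) :
    ∀ {K : Stack Var}, Inv Ψ M K → ∃ (Ls : List (List Var)) (K' : Stack Var), KExt K K' ∧
      Inv Φ V (Ls.map .lets ++ K') ∧
      Reduces (unload (hfun Ψ) M K).cls (unload (hfun Φ) V (Ls.map .lets ++ K')).cls := by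
  -- The stack is arbitrary because premises are evaluated beneath further frames. Meanwhile frames
  -- of `K` may gain variables, so only `KExt K K'` can be claimed.
  induction h with
  | value _ => exact fun {K} H => ⟨[], K, .refl K, H, .refl⟩
  | @app Ψ Φ Ψ' M₁ M₂ N V x x' _ h₁ _ h₂ _ ih₁ ih₂ =>
    intro K H
    obtain ⟨Ls, K₁, hK₁, H₁, hr₁⟩ := ih₁ H.app
    cases hK₁ with
    | @cons _ _ _ K' hF hK' =>
    cases hF with
    | app =>
    obtain ⟨H₂, hr₂⟩ := H₁.beta h₁ h₂
    obtain ⟨Ls₂, K₂, hK₂, H₃, hr₃⟩ := ih₂ H₂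
    -- The frame of `x'` and those left by the function survive, perhaps enlarged, and count among
    -- the `lets` frames of the result.
    obtain ⟨Ls₃, K₃, rfl, hK₃⟩ := KExt.split_lets (Ls := [x'] :: Ls) hK₂
    rw [← List.append_assoc, ← List.map_append] at H₃ hr₃
    exact ⟨Ls₂ ++ Ls₃, K₃, KExt.trans hK' hK₃, H₃, hr₁.trans (hr₂.to_reflTransGen.trans hr₃)⟩
  | @var Ψ Φ x M V hx h ih =>
    intro K H
    have hM := hfun_of_lookup hx
    have hxK : x ∈ letsNames K := (H.dom x).1 (Finmap.mem_iff.2 ⟨M, hx⟩)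
    by_cases hu : x ∈ upds K
    -- A cycle: the heap holds • for a variable under evaluation, so the natural semantics returns
    -- •, just as the error rule does.
    · have hb : M = .bh := by rw [← hM]; exact H.upd x hu
      subst hb
      have hΦ : Φ = Ψ.insert x .bh ∧ V = .bh := by
        cases h; exact ⟨rfl, rfl⟩
      obtain ⟨rfl, rfl⟩ := hΦ
      have e : hfun ((Ψ.insert x .bh).insert x .bh) = hfun Ψ := by
        rw [hfun_insert, hfun_insert, Function.update_idem, ← hM, Function.update_eq_self]
      have hs := step_of_fire_cls (s := ⟨hfun Ψ, .var x, K⟩) H.ok H.closed (.error _ x K hu)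
      refine ⟨[], K, .refl K, ⟨H.ok, fun y => ?_, fun y hy => ?_, ?_⟩, ?_⟩
      · rw [Finmap.mem_insert, Finmap.mem_insert, H.dom]
        simp only [List.map_nil, List.nil_append]
        exact ⟨fun h => by rcases h with rfl | rfl | h <;> assumption, fun h => Or.inr (Or.inr h)⟩
      · rw [e]; exact H.upd y hy
      · rw [e]; exact H.closed.step hs
      · rw [e]; exact .single hs
    · obtain ⟨H₁, he⟩ := H.enter_var hxK hu
      rw [hM] at H₁ he
      obtain ⟨Ls, K₁, hK₁, H₂, hr⟩ := ih H₁
      cases hK₁ with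
      | @cons _ _ _ K₁ hF hK₁ =>
      cases hF with
      | upd =>
      have hV := h.isValue
      -- The answer reached for `x` is flattened into the frame of `x` before its value is copied.
      -- This is where frames of the surrounding stack grow.
      obtain ⟨K', hK', hok, hups, hnames, hr'⟩ := assoc_reduces hV H₂.ok H₂.closed
      have hc := H₂.closed.reduces hr'
      have hs := step_of_fire_cls (s := ⟨hfun Φ, V, .upd x :: K'⟩) hok hc (.deref _ V x K' hV)
      rw [he] at hr
      refine ⟨[], K', KExt.trans hK₁ hK', ⟨hok.2.2, fun y => ?_, fun y hy => ?_, ?_⟩, ?_⟩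
      · rw [Finmap.mem_insert, H₂.dom, ← hnames]
        simp only [List.map_nil, List.nil_append]
        exact ⟨fun h => h.elim (fun h => h ▸ hok.1) id, Or.inr⟩
      · have hy' : y ∈ upds K' := hy
        rw [hfun_insert, Function.update_of_ne (by rintro rfl; exact hok.2.1 hy')]
        exact H₂.upd y (by rw [hups] at hy'; simp [upds, hy'])
      · rw [hfun_insert]; exact hc.step hs
      · rw [hfun_insert]; exact hr.trans (hr'.tail hs)
  | letrec hf _ ih =>
    intro K H
    obtain ⟨H₁, he⟩ := H.enter_letrec hf
    obtain ⟨Ls, K₁, hK₁, H₂, hr⟩ := ih H₁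
    cases hK₁ with
    | @cons _ _ _ K₁ hF hK₁ =>
    cases hF with
    | lets _ ys =>
    refine ⟨Ls ++ [ys], K₁, hK₁, by simpa using H₂, ?_⟩
    rw [he]
    simpa using hr
  | @error_beta Ψ Φ M₁ M₂ _ ih =>
    intro K H
    obtain ⟨Ls, K₁, hK₁, H₁, hr₁⟩ := ih H.app
    cases hK₁ with
    | @cons _ _ _ K' hF hK' =>
    cases hF with
    | app =>
    have hr₂ := lift_reduces .bh H₁.ok H₁.closed
    have hok : StackOK (Ls.map .lets ++ K') := stackOK_append_app.1 H₁.ok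
    have hc := H₁.closed.reduces hr₂
    have hs := step_of_fire_cls (s := ⟨hfun Φ, .bh, .app M₂ :: (Ls.map Frame.lets ++ K')⟩) hok hc
      (.error_beta _ M₂ _)
    refine ⟨Ls, K', hK', ⟨hok, fun y => ?_, fun y hy => H₁.upd y ?_, hc.step hs⟩,
      hr₁.trans (hr₂.tail hs)⟩
    · rw [H₁.dom]; simp [letsNames]
    · simpa [upds] using hy

end Simulation

-- Terminating reduction yields a derivation; normal forms are unique.

section Termination

variable {Var : Type u} [DecidableEq Var]

mutual
/-- The size of an expression, where `•` does not count. -/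
def Tm.size : Tm Var → ℕ
  | .var _ => 1
  | .lam _ M => M.size + 1
  | .app M N => M.size + N.size + 1
  | .letrec D M => sizeDefs D + M.size + 1
  | .bh => 0
/-- The size of the right-hand sides of a sequence of definitions. -/
def sizeDefs : List (Var × Tm Var) → ℕ
  | [] => 0
  | (_, M) :: D => M.size + sizeDefs D
end

theorem sizeDefs_eq (D : Defs Var) : sizeDefs D = (D.map fun b => b.2.size).sum := by
  induction D with
  | nil => simp [sizeDefs]
  | cons b D ih => obtain ⟨x, M⟩ := b; simp [sizeDefs, ih]

theorem size_rename (M : Tm Var) (f : Var → Var) : (M.rename f).size = M.size := by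
  induction M using Tm.ind generalizing f with
  | var x => simp [Tm.rename, Tm.size]
  | lam x M ih => simp [Tm.rename, Tm.size, ih]
  | app M N ihM ihN => simp [Tm.rename, Tm.size, ihM, ihN]
  | letrec D M ihD ihM =>
    rw [rename_letrec, Tm.size, Tm.size, ihM, sizeDefs_eq, sizeDefs_eq, List.map_map]
    congr 3
    exact List.map_congr_left fun b hb => ihD b hb _
  | bh => rfl

/-- The size of the definitions of `xs` in a heap. -/
def heapSize (h : Var → Tm Var) (xs : List Var) : ℕ := (xs.map fun x => (h x).size).sum

theorem heapSize_congr {h h' : Var → Tm Var} {xs : List Var} (H : ∀ x ∈ xs, h x = h' x) :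
    heapSize h xs = heapSize h' xs := by
  unfold heapSize
  exact congrArg _ (List.map_congr_left fun x hx => by rw [H x hx])

theorem heapSize_update_bh {h : Var → Tm Var} {xs : List Var} (hxs : xs.Nodup) {x : Var}
    (hx : x ∈ xs) : (h x).size + heapSize (Function.update h x .bh) xs = heapSize h xs := by
  induction xs with
  | nil => simp at hx
  | cons y xs ih =>
    obtain ⟨hy, hn⟩ := List.nodup_cons.1 hxs
    have e : ∀ g : Var → Tm Var, heapSize g (y :: xs) = (g y).size + heapSize g xs := fun g => by
      simp [heapSize]
    rw [e, e]
    rcases List.mem_cons.1 hx with rfl | hx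
    · rw [heapSize_congr (h := Function.update h x .bh) (h' := h) fun z hz =>
        Function.update_of_ne (by rintro rfl; exact hy hz) _ _]
      simp [Tm.size]
    · rw [Function.update_of_ne (by rintro rfl; exact hy hx), ← ih hn hx]
      omega

theorem heapSize_hup {h : Var → Tm Var} {D : Defs Var} (hD : (names D).Nodup) {xs : List Var}
    (hd : ∀ x ∈ names D, x ∉ xs) :
    heapSize (hup h D) (names D ++ xs) = sizeDefs D + heapSize h xs := by
  have h1 : heapSize (hup h D) (names D ++ xs) =
      heapSize (hup h D) (names D) + heapSize (hup h D) xs := by simp [heapSize]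
  rw [h1, heapSize_congr (xs := xs) (h' := h) fun x hx => hup_of_not_mem fun hn => hd x hn hx]
  congr 1
  rw [sizeDefs_eq, heapSize, names, List.map_map]
  exact congrArg _ (List.map_congr_left fun b hb => by rw [Function.comp, hup_of_mem hD hb])

mutual
theorem scope_subset : ∀ {K : Stack Var} {x : Var}, x ∈ scope K → x ∈ letsNames K
  | [], _, h => by simp [scope] at h
  | .app _ :: K, _, h => by rw [scope] at h; exact scope_subset (K := K) h
  | .lets xs :: K, _, h => by
    rw [scope, List.mem_append] at h
    exact List.mem_append.2 (h.imp id scope_subset)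
  | .upd y :: K, _, h => by rw [scope] at h; exact scopeAt_subset (K := K) h
theorem scopeAt_subset : ∀ {K : Stack Var} {x y : Var}, x ∈ scopeAt y K → x ∈ letsNames K
  | [], _, _, h => by simp [scopeAt] at h
  | .app _ :: K, _, _, h => by rw [scopeAt] at h; exact scopeAt_subset (K := K) h
  | .lets xs :: K, _, _, h => by
    rw [scopeAt] at h
    split_ifs at h
    · exact List.mem_append.2 ((List.mem_append.1 h).imp id scope_subset)
    · exact List.mem_append_right _ (scopeAt_subset h)
  | .upd z :: K, _, _, h => by rw [scopeAt] at h; exact scopeAt_subset (K := K) h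
end

/-- If reduction terminates then so does evaluation. -/
theorem exists_eval [Infinite Var] {c : Cls Var} (hacc : Acc (fun b a => Step a b) c) :
    ∀ (Ψ : Heap Var) (M : Tm Var) (K : Stack Var), Inv Ψ M K → (unload (hfun Ψ) M K).cls = c →
      ∃ Φ V, Eval Ψ M Φ V := by
  -- An application may consume several reduction steps before its body is evaluated, hence the
  -- transitive closure.
  replace hacc := hacc.transGen
  induction hacc with
  | intro c _ ihc =>
  intro Ψ M K
  -- The inner measure handles the premises reached without contraction. As • has size zero,
  -- entering a variable moves its definition from the heap into the focus and saves the variable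
  -- itself; a `let rec` moves its definitions into the heap and saves the constructor.
  induction hn : M.size + heapSize (hfun Ψ) (letsNames K) using Nat.strong_induction_on
    generalizing Ψ M K with
  | _ n ih =>
  subst hn
  intro H hcls
  cases M with
  | var x =>
    -- Closedness guarantees that the lookup succeeds.
    have hx : x ∈ letsNames K :=
      scope_subset ((scoped_of_closed H.ok (H.closed.fv_eq rfl).2).1 x (by simp [Tm.fv]))
    have hl := lookup_of_mem ((H.dom x).2 hx)
    by_cases hu : x ∈ upds K
    · rw [H.upd x hu] at hl
      exact ⟨_, _, .var hl (.value .bh)⟩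
    · obtain ⟨H', he⟩ := H.enter_var hx hu
      have hsz := heapSize_update_bh (h := hfun Ψ) H.ok.nodup hx
      obtain ⟨Φ, V, hV⟩ := ih _ (by
        rw [hfun_insert, Tm.size, letsNames, hsz]
        omega) _ _ _ rfl H' (by rw [he, hcls])
      exact ⟨_, _, .var hl hV⟩
  | lam x M => exact ⟨_, _, .value (.lam x M)⟩
  | app M N =>
    obtain ⟨Φ, V, hV⟩ := ih _ (by simp only [Tm.size, letsNames]; omega) _ _ _ rfl H.app hcls
    obtain ⟨Ls, K₁, hK₁, H₁, hr₁⟩ := hV.reduces H.app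
    cases hK₁ with
    | @cons _ _ _ K' hF hK' =>
    cases hF with
    | app =>
    cases hV.isValue with
    | bh => exact ⟨_, _, .error_beta hV⟩
    | lam x L =>
      obtain ⟨S, hS⟩ := exists_finset_heap_occ Φ
      obtain ⟨x', hx'⟩ := Infinite.exists_notMem_finset (S ∪ (N.occ ∪ (Tm.lam x L).occ))
      simp only [Finset.mem_union, not_or] at hx'
      have hx'Φ : x' ∉ Φ.occ := fun h => hx'.1 (hS h)
      obtain ⟨H₂, hr₂⟩ := H₁.beta hx'Φ hx'.2.2
      -- Simulating the derivation for the function and contracting the application takes at least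
      -- one reduction step, so the outer induction applies whatever the size of the new state.
      have ht := Relation.TransGen.trans_right hr₁ hr₂
      rw [show unload (hfun Ψ) M (.app N :: K) = unload (hfun Ψ) (.app M N) K from rfl, hcls] at ht
      obtain ⟨Φ', V', hV'⟩ := ihc _ (Relation.transGen_swap.2 ht) _ _ _ H₂ rfl
      exact ⟨_, _, .app hV hx'Φ hx'.2.1 hx'.2.2 hV'⟩
  | letrec D N =>
    obtain ⟨S, hS⟩ := exists_finset_heap_occ Ψ
    obtain ⟨f, hf⟩ := exists_freshening (names D) (S ∪ (Tm.letrec D N).occ)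
    have hf' : Freshening (names D) (Ψ.occ ∪ (Tm.letrec D N).occ) f := by
      refine ⟨hf.1, fun x hx h => hf.2.1 x hx ?_, hf.2.2⟩
      rw [Finset.coe_union]
      exact h.imp (fun h => hS h) id
    obtain ⟨H', he⟩ := H.enter_letrec hf'
    have hsz := heapSize_hup (h := hfun Ψ) (D := renameAll f D) (xs := letsNames K) H'.ok.1 H'.ok.2.1
    have hsd : sizeDefs (renameAll f D) = sizeDefs D := by
      rw [sizeDefs_eq, sizeDefs_eq, renameAll, List.map_map]
      exact congrArg _ (List.map_congr_left fun b _ => size_rename b.2 f)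
    obtain ⟨Φ, V, hV⟩ := ih _ (by
      rw [hfun_extend, letsNames, hsz, hsd, size_rename, Tm.size]
      omega) _ _ _ rfl H' (by rw [← he, hcls])
    exact ⟨_, _, .letrec hf' hV⟩
  | bh => exact ⟨_, _, .value .bh⟩

/-- By determinism, the given reduction to a normal form is the only maximal one. -/
theorem acc_of_reduces [Infinite Var] {c c' : Cls Var} (hc : ClosedCls c) (h : Reduces c c')
    (hn : ∀ d, ¬ Step c' d) : Acc (fun b a => Step a b) c := by
  induction h using Relation.ReflTransGen.head_induction_on with
  | refl => exact ⟨_, fun d hd => (hn d hd).elim⟩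
  | head hs _ ih =>
    refine ⟨_, fun d hd => ?_⟩
    rw [step_det hc hd hs]
    exact ih (hc.step hs)

theorem normal_unique [Infinite Var] {c a b : Cls Var} (hc : ClosedCls c) (ha : Reduces c a)
    (hb : Reduces c b) (hna : ∀ d, ¬ Step a d) (hnb : ∀ d, ¬ Step b d) : a = b := by
  induction ha using Relation.ReflTransGen.head_induction_on with
  | refl =>
    rcases hb.cases_head with h | ⟨d, hd, -⟩
    · exact h
    · exact (hna d hd).elim
  | head hs _ ih =>
    rcases hb.cases_head with rfl | ⟨d, hd, hb⟩
    · exact (hnb _ hs).elim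
    · rw [step_det hc hd hs] at hb
      exact ih (hc.step hs) hb

theorem fill_lets (h : Var → Tm Var) (t : Tm Var) (Ls : List (List Var)) :
    Letrecs.fill (Ls.reverse.map (defsOf h)) t = unload h t (Ls.map .lets) := by
  induction Ls generalizing t with
  | nil => rfl
  | cons xs Ls ih =>
    rw [List.map_cons, unload, ← ih]
    simp [Letrecs.fill]

theorem Inv.initial {M : Tm Var} (hM : IsProgram M) : Inv ∅ M [] where
  ok := trivial
  dom x := by simp [letsNames, Finmap.notMem_empty]
  upd := by simp [upds]
  closed := ⟨M, rfl, hM.1, hM.2⟩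

/-- Starting from the empty stack, only `lets` frames can remain. They form Θ in reverse order,
because stacks list the innermost frame first. -/
theorem Eval.exists_letrecs [Infinite Var] {M V : Tm Var} {Ψ : Heap Var} (hM : IsProgram M)
    (h : Eval ∅ M Ψ V) :
    ∃ Θ : Letrecs Var, IsHeap Θ.floor Ψ ∧ Reduces M.cls (Θ.fill V).cls ∧
      IsAnswer (Θ.fill V) := by
  obtain ⟨Ls, K', hK', H, hr⟩ := h.reduces (Inv.initial hM)
  cases hK'
  rw [List.append_nil] at H hr
  refine ⟨Ls.reverse.map (defsOf (hfun Ψ)), ⟨?_, fun x N => ?_⟩, ?_, ?_⟩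
  · have hp : (names (Letrecs.floor (Ls.reverse.map (defsOf (hfun Ψ))))).Perm
        (letsNames (Ls.map .lets)) := by
      rw [letsNames_map_lets, Letrecs.floor, names, List.map_flatten, List.map_map]
      have : (List.map Prod.fst ∘ defsOf (hfun Ψ)) = id := by
        funext xs; exact names_defsOf (hfun Ψ) xs
      rw [this, List.map_id]
      exact (List.reverse_perm Ls).flatten
    exact hp.nodup_iff.2 H.ok.nodup
  · have hmem : (x, N) ∈ Letrecs.floor (Ls.reverse.map (defsOf (hfun Ψ))) ↔
        x ∈ letsNames (Ls.map .lets) ∧ N = hfun Ψ x := by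
      rw [letsNames_map_lets, Letrecs.floor]
      simp only [List.mem_flatten, List.mem_map, List.mem_reverse]
      constructor
      · rintro ⟨_, ⟨xs, hxs, rfl⟩, hx⟩
        have := mem_defsOf.1 hx
        exact ⟨⟨xs, hxs, this.1⟩, this.2⟩
      · rintro ⟨⟨xs, hxs, hx⟩, rfl⟩
        exact ⟨_, ⟨xs, hxs, rfl⟩, mem_defsOf.2 ⟨hx, rfl⟩⟩
    rw [hmem, ← H.dom]
    constructor
    · exact fun h => ⟨Finmap.mem_iff.2 ⟨N, h⟩, (hfun_of_lookup h).symm⟩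
    · rintro ⟨h, rfl⟩; exact lookup_of_mem h
  · rw [fill_lets]; exact hr
  · rw [fill_lets]; exact isAnswer_unload_lets _ (.value h.isValue) Ls

end Termination

end Letrec

-- The correspondence of the two semantics.

theorem mainTheorem2 {Var : Type*} [DecidableEq Var] [Infinite Var]
    (M : Letrec.Tm Var) (hM : Letrec.IsProgram M) :
    (∀ A : Letrec.Tm Var, Letrec.IsAnswer A → Letrec.Reduces M.cls A.cls →
      ∃ (Θ : Letrec.Letrecs Var) (V : Letrec.Tm Var) (Ψ : Letrec.Heap Var),
        Letrec.IsValue V ∧ (Θ.fill V).cls = A.cls ∧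
        Letrec.IsHeap Θ.floor Ψ ∧ Letrec.Eval ∅ M Ψ V) ∧
    (∀ (Ψ : Letrec.Heap Var) (V : Letrec.Tm Var), Letrec.Eval ∅ M Ψ V →
      ∃ Θ : Letrec.Letrecs Var,
        Letrec.IsHeap Θ.floor Ψ ∧ Letrec.Reduces M.cls (Θ.fill V).cls) := by
  have hc : Letrec.ClosedCls M.cls := ⟨M, rfl, hM.1, hM.2⟩
  constructor
  · intro A hA hr
    -- As `A` is a normal form, determinism makes reduction of `M` terminate. The derivation
    -- obtained from termination leads, by simulation, to a normal form again, and that can only be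
    -- the class of `A`.
    have hn : ∀ d, ¬ Letrec.Step A.cls d := fun d =>
      Letrec.not_step_of_isAnswer hA (hc.reduces hr)
    obtain ⟨Ψ, V, hV⟩ := Letrec.exists_eval (Letrec.acc_of_reduces hc hr hn) ∅ M []
      (Letrec.Inv.initial hM) rfl
    obtain ⟨Θ, hΘ, hr', hA'⟩ := hV.exists_letrecs hM
    exact ⟨Θ, V, Ψ, hV.isValue, Letrec.normal_unique hc hr' hr
      (fun d => Letrec.not_step_of_isAnswer hA' (hc.reduces hr')) hn, hΘ, hV⟩
  · intro Ψ V hV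
    obtain ⟨Θ, hΘ, hr, -⟩ := hV.exists_letrecs hM
    exact ⟨Θ, hΘ, hr⟩
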